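/- Let $M$ be $\mathbb{R}^N$ ($N\ge 1$), the round unit sphere $\mathbb{S}^2$, or the hyperbolic plane $\mathbb{H}^2$ of curvature $-1$, with Riemannian volume $dV$, Laplace--Beltrami operator $\Delta$ and geodesic distance $d$. For an open set $\Omega\subseteq M$, let $H^2_0(\Omega)$ be the closure of $C_c^\infty(\Omega)$ in the norm $\|v\|_{H^2}^2=\int(|v|^2+|\nabla v|^2+|\nabla^2v|^2)\,dV$. A weak solution of $$\Delta^2u=1\ \text{ in }\Omega,\qquad u=\frac{\partial u}{\partial n}=0\ \text{ on }\partial\Omega ,$$ is a function $u\in H^2_0(\Omega)$ with $\int_\Omega\Delta u\,\Delta v\,dV=\int_\Omega v\,dV$ for all $v\in H^2_0(\Omega)$, where $\Delta u,\Delta v$ are weak Laplacians. Let $B_R=\{x\in M: d(p,x)<R\}$ be the geodesic ball of radius $R>0$ about a point $p\in M$, with $R<\pi$ if $M=\mathbb{S}^2$. Then the problem on $\Omega=B_R$ has a unique weak solution $u_{B_R}$. With $r=d(p,x)$, it is given (almost everywhere in $B_R$) by - $\displaystyle u_{B_R}=\frac{R^4}{8N(N+2)}\Big(1-\frac{r^2}{R^2}\Big)^2$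 if $M=\mathbb{R}^N$; - $\displaystyle u_{B_R}=2(\log\cos\tfrac r2)^2-2(\log\cos\tfrac R2)^2+\operatorname{Li}_2(-\tan^2\tfrac r2)-\operatorname{Li}_2(-\tan^2\tfrac R2)+4\cot^2\tfrac R2\,\log\cos\tfrac R2\,\log\frac{\cos(r/2)}{\cos(R/2)}$ if $M=\mathbb{S}^2$; - $\displaystyle u_{B_R}=2(\log\cosh\tfrac r2)^2-2(\log\cosh\tfrac R2)^2+\operatorname{Li}_2(\tanh^2\tfrac r2)-\operatorname{Li}_2(\tanh^2\tfrac R2)-4\coth^2\tfrac R2\,\log\cosh\tfrac R2\,\log\frac{\cosh(r/2)}{\cosh(R/2)}$ if $M=\mathbb{H}^2$. Here $\operatorname{Li}_2(x)=-\int_0^x\frac{\log(1-t)}{t}\,dt$ for real $x<1$, which equals $\sum_{k\ge1}x^k/k^2$ for $|x|<1$. Moreover, $u_{B_R}$ is integrable on $B_R$ and its mean deflection is $$\int_{B_R}u_{B_R}\,dV=\begin{cases}|\mathbb{S}^{N-1}|\,\dfrac{R^{N+4}}{N^2(N+2)^2(N+4)},& M=\mathbb{R}^N,\ N\ge 1,\\[2mm]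 4\pi\big(\sin^2\tfrac R2-4\cot^2\tfrac R2\,(\log\cos\tfrac R2)^2\big),& M=\mathbb{S}^2,\\[1mm] 4\pi\big(\sinh^2\tfrac R2-4\coth^2\tfrac R2\,(\log\cosh\tfrac R2)^2\big),& M=\mathbb{H}^2,\end{cases}$$ where $|\mathbb{S}^{N-1}|$ is the surface measure of the unit sphere in $\mathbb{R}^N$ (so $|\mathbb{S}^0|=2$). -/

import Mathlib

open MeasureTheory Filter Topology Set
open scoped ContDiff Manifold

namespace ClampedPlate

/-- The differential-geometric data of a Riemannian manifold that enter the clamped plate problem: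
the Riemannian volume, the smooth functions, the Laplace-Beltrami operator (with the sign of the
analyst, so that it is the trace of the Hessian), and the squared pointwise norms of the gradient
and of the covariant Hessian of a smooth function. It is only used through the three
concrete models `euclidean N`, `sphereTwo` and `hyperbolicPlane` below. -/
structure Geometry (M : Type) [TopologicalSpace M] [MeasurableSpace M] where
  vol : Measure M
  Smooth : (M → ℝ) → Prop
  lap : (M → ℝ) → M → ℝ
  gradSq : (M → ℝ) → M → ℝ
  hessSq : (M → ℝ) → M → ℝ

section General

variable {M : Type} [TopologicalSpace M] [MeasurableSpace M]

/-- `φ ∈ C_c^∞(Ω)`, extended by zero to `M`. -/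
def IsTest (G : Geometry M) (Ω : Set M) (φ : M → ℝ) : Prop :=
  G.Smooth φ ∧ HasCompactSupport φ ∧ tsupport φ ⊆ Ω

/-- `‖φ‖²_{H²(M)} = ∫ (|φ|² + |∇φ|² + |∇²φ|²) dV` for a test function `φ`. -/
noncomputable def h2NormSq (G : Geometry M) (φ : M → ℝ) : ℝ :=
  ∫ x, (φ x ^ 2 + G.gradSq φ x + G.hessSq φ x) ∂G.vol

/-- `u ∈ H²_0(Ω)` (extended by zero to `M`), where `H²_0(Ω)` is the completion of `C_c^∞(Ω)` for
the `H²` norm: `u` is the limit in `L²(M)` of a sequence in `C_c^∞(Ω)` that is Cauchy in `H²`. -/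
def MemH20 (G : Geometry M) (Ω : Set M) (u : M → ℝ) : Prop :=
  MemLp u 2 G.vol ∧
    ∃ φ : ℕ → M → ℝ, (∀ k, IsTest G Ω (φ k)) ∧
      Tendsto (fun k => eLpNorm (φ k - u) 2 G.vol) atTop (𝓝 0) ∧
      Tendsto (fun jk : ℕ × ℕ => h2NormSq G (φ jk.1 - φ jk.2)) atTop (𝓝 0)

/-- `w ∈ L²(Ω)` is the weak (distributional) Laplacian of `u` on `Ω`. -/
def IsWeakLaplacian (G : Geometry M) (Ω : Set M) (u w : M → ℝ) : Prop :=
  MemLp w 2 (G.vol.restrict Ω) ∧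
    ∀ φ : M → ℝ, IsTest G Ω φ → ∫ x in Ω, w x * φ x ∂G.vol = ∫ x in Ω, u x * G.lap φ x ∂G.vol

/-- `u` is a weak solution of the clamped plate problem under zero compression and constant load,
`Δ² u = 1` in `Ω`, `u = ∂u/∂n = 0` on `∂Ω`: it lies in `H²_0(Ω)` and
`∫_Ω Δu Δv dV = ∫_Ω v dV` for all `v ∈ H²_0(Ω)`. -/
def IsDeflection (G : Geometry M) (Ω : Set M) (u : M → ℝ) : Prop :=
  MemH20 G Ω u ∧
    ∃ Δu : M → ℝ, IsWeakLaplacian G Ω u Δu ∧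
      ∀ v Δv : M → ℝ, MemH20 G Ω v → IsWeakLaplacian G Ω v Δv →
        ∫ x in Ω, Δu x * Δv x ∂G.vol = ∫ x in Ω, v x ∂G.vol

end General

/-! ### Euclidean space -/

/-- Euclidean space `ℝ^N`. -/
noncomputable def euclidean (N : ℕ) : Geometry (EuclideanSpace ℝ (Fin N)) where
  vol := volume
  Smooth f := ContDiff ℝ ∞ f
  lap f x := Laplacian.laplacian f x
  gradSq f x := ‖fderiv ℝ f x‖ ^ 2
  hessSq f x := ∑ i, ∑ j,
    (fderiv ℝ (fderiv ℝ f) x (EuclideanSpace.single i 1) (EuclideanSpace.single j 1)) ^ 2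

/-! ### The round unit sphere in `ℝ³` -/

instance factFinrankThree : Fact (Module.finrank ℝ (EuclideanSpace ℝ (Fin 3)) = 2 + 1) :=
  ⟨by simp⟩

/-- The unit sphere in `ℝ³`. -/
abbrev S2 : Type := Metric.sphere (0 : EuclideanSpace ℝ (Fin 3)) 1

/-- The extension of a function on the sphere to `ℝ³ ∖ {0}`, constant along rays
(and `0` at the origin). -/
noncomputable def radialExt (f : S2 → ℝ) (y : EuclideanSpace ℝ (Fin 3)) : ℝ :=
  if h : y = 0 then 0
  else f ⟨‖y‖⁻¹ • y, by
    rw [mem_sphere_zero_iff_norm, norm_smul, norm_inv, norm_norm,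
      inv_mul_cancel₀ (norm_ne_zero_iff.mpr h)]⟩

/-- The orthogonal projection of `v` to the tangent plane `x^⊥` of the sphere at `x`. -/
noncomputable def tangentProj (x : S2) (v : EuclideanSpace ℝ (Fin 3)) : EuclideanSpace ℝ (Fin 3) :=
  v - inner ℝ (x : EuclideanSpace ℝ (Fin 3)) v • (x : EuclideanSpace ℝ (Fin 3))

/-- The round unit sphere `𝕊²`, with surface measure. At points of the sphere, the gradient and the
Laplacian of the radially constant extension are the spherical ones, and the covariant Hessian
is the restriction of its Hessian to the tangent plane. -/
noncomputable def sphereTwo : Geometry S2 where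
  vol := (volume : Measure (EuclideanSpace ℝ (Fin 3))).toSphere
  Smooth f := ContMDiff (𝓡 2) 𝓘(ℝ, ℝ) ∞ f
  lap f x := Laplacian.laplacian (radialExt f) (x : EuclideanSpace ℝ (Fin 3))
  gradSq f x := ‖fderiv ℝ (radialExt f) (x : EuclideanSpace ℝ (Fin 3))‖ ^ 2
  hessSq f x := ∑ i : Fin 3, ∑ j : Fin 3,
    (fderiv ℝ (fderiv ℝ (radialExt f)) (x : EuclideanSpace ℝ (Fin 3))
      (tangentProj x (EuclideanSpace.single i 1)) (tangentProj x (EuclideanSpace.single j 1))) ^ 2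

/-- Geodesic distance on `𝕊²`: the angle between two unit vectors. -/
noncomputable def sphereDist (p x : S2) : ℝ :=
  InnerProductGeometry.angle (p : EuclideanSpace ℝ (Fin 3)) (x : EuclideanSpace ℝ (Fin 3))

/-! ### The hyperbolic plane -/

/-- A function on the upper half-plane as a function on `ℂ` (only its values at points with
positive imaginary part matter). -/
noncomputable def halfPlaneExt (f : UpperHalfPlane → ℝ) (z : ℂ) : ℝ :=
  f (UpperHalfPlane.ofComplex z)

/-- The hyperbolic plane `ℍ²` of curvature `-1`: the upper half-plane with the metric
`(dx² + dy²) / y²` and Mathlib's distance and volume `dx dy / y²`. The components of the covariant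
Hessian are `f_xx - f_y / y`, `f_xy + f_x / y`, `f_yy + f_y / y`. -/
noncomputable def hyperbolicPlane : Geometry UpperHalfPlane where
  vol := volume
  Smooth f := ContMDiff 𝓘(ℝ, ℂ) 𝓘(ℝ, ℝ) ∞ f
  lap f z := z.im ^ 2 * Laplacian.laplacian (halfPlaneExt f) (z : ℂ)
  gradSq f z := z.im ^ 2 *
    (fderiv ℝ (halfPlaneExt f) z 1 ^ 2 + fderiv ℝ (halfPlaneExt f) z Complex.I ^ 2)
  hessSq f z := z.im ^ 4 *
    ((fderiv ℝ (fderiv ℝ (halfPlaneExt f)) z 1 1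
        - fderiv ℝ (halfPlaneExt f) z Complex.I / z.im) ^ 2
      + 2 * (fderiv ℝ (fderiv ℝ (halfPlaneExt f)) z 1 Complex.I
        + fderiv ℝ (halfPlaneExt f) z 1 / z.im) ^ 2
      + (fderiv ℝ (fderiv ℝ (halfPlaneExt f)) z Complex.I Complex.I
        + fderiv ℝ (halfPlaneExt f) z Complex.I / z.im) ^ 2)

/-! ### The radial deflection functions -/

/-- The real dilogarithm `Li₂(x) = -∫₀ˣ log(1 - t) / t dt` for `x ≤ 1`, the analytic continuation of
`∑ x^k / k²` from `|x| < 1` to `(-∞, 1)`. -/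
noncomputable def dilog (x : ℝ) : ℝ := -∫ t in (0 : ℝ)..x, Real.log (1 - t) / t

/-- On `(-1, 1)` the dilogarithm is given by its power series. -/
theorem hasSum_dilog {x : ℝ} (hx : |x| < 1) :
    HasSum (fun k : ℕ => x ^ (k + 1) / ((k : ℝ) + 1) ^ 2) (dilog x) := by
  have key : HasSum (fun k : ℕ => ∫ t in (0 : ℝ)..x, t ^ k / ((k : ℝ) + 1))
      (∫ t in (0 : ℝ)..x, -(Real.log (1 - t) / t)) := by
    refine intervalIntegral.hasSum_integral_of_dominated_convergence
      (fun k _ => |x| ^ k) (fun k => ?_) (fun k => ?_) ?_ ?_ ?_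
    · exact (by fun_prop : Continuous fun t : ℝ => t ^ k / ((k : ℝ) + 1)).aestronglyMeasurable
    · refine Eventually.of_forall fun t ht => ?_
      have htx : |t| ≤ |x| := by
        rcases le_total 0 x with h | h
        · rw [uIoc_of_le h] at ht
          rw [abs_of_pos ht.1, abs_of_nonneg h]; exact ht.2
        · rw [uIoc_of_ge h] at ht
          rw [abs_of_nonpos ht.2, abs_of_nonpos h]; linarith [ht.1]
      rw [norm_div, norm_pow, Real.norm_eq_abs]
      have h1 : (1 : ℝ) ≤ ‖(k : ℝ) + 1‖ := by
        rw [Real.norm_eq_abs, abs_of_nonneg (by positivity)]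
        have : (0 : ℝ) ≤ k := by positivity
        linarith
      calc |t| ^ k / ‖(k : ℝ) + 1‖ ≤ |t| ^ k := div_le_self (by positivity) h1
        _ ≤ |x| ^ k := by gcongr
    · exact Eventually.of_forall fun t _ => summable_geometric_of_lt_one (abs_nonneg x) hx
    · simp
    · have h0 : ∀ᵐ t : ℝ, t ≠ 0 := by
        simp [ae_iff]
      filter_upwards [h0] with t ht0 ht
      have htx : |t| < 1 := by
        rcases le_total 0 x with h | h
        · rw [uIoc_of_le h] at ht
          rw [abs_of_pos ht.1]; rw [abs_of_nonneg h] at hx; linarith [ht.2]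
        · rw [uIoc_of_ge h] at ht
          rw [abs_of_nonpos ht.2]; rw [abs_of_nonpos h] at hx; linarith [ht.1]
      have h2 := (Real.hasSum_pow_div_log_of_abs_lt_one htx).div_const t
      rw [neg_div] at h2
      have e : (fun k : ℕ => t ^ k / ((k : ℝ) + 1))
          = fun k : ℕ => t ^ (k + 1) / ((k : ℝ) + 1) / t := by
        funext k
        rw [pow_succ]
        field_simp
      rw [e]
      exact h2
  rw [intervalIntegral.integral_neg] at key
  have e : (fun k : ℕ => x ^ (k + 1) / ((k : ℝ) + 1) ^ 2)
      = fun k : ℕ => ∫ t in (0 : ℝ)..x, t ^ k / ((k : ℝ) + 1) := by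
    funext k
    rw [intervalIntegral.integral_div, integral_pow, div_div]
    simp [pow_two]
  rw [e]
  exact key

/-- The deflection of the Euclidean ball of radius `R` at distance `r` from its centre. -/
noncomputable def euclideanProfile (N : ℕ) (R r : ℝ) : ℝ :=
  R ^ 4 / (8 * N * (N + 2)) * (1 - r ^ 2 / R ^ 2) ^ 2

/-- The deflection of the spherical cap of radius `R` in `𝕊²` at distance `r` from its centre. -/
noncomputable def sphereProfile (R r : ℝ) : ℝ :=
  2 * Real.log (Real.cos (r / 2)) ^ 2 - 2 * Real.log (Real.cos (R / 2)) ^ 2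
    + dilog (-Real.tan (r / 2) ^ 2) - dilog (-Real.tan (R / 2) ^ 2)
    + 4 * Real.cot (R / 2) ^ 2 * Real.log (Real.cos (R / 2))
      * Real.log (Real.cos (r / 2) / Real.cos (R / 2))

/-- The deflection of the disk of radius `R` in `ℍ²` at distance `r` from its centre
(`coth = cosh / sinh`). -/
noncomputable def hyperbolicProfile (R r : ℝ) : ℝ :=
  2 * Real.log (Real.cosh (r / 2)) ^ 2 - 2 * Real.log (Real.cosh (R / 2)) ^ 2
    + dilog (Real.tanh (r / 2) ^ 2) - dilog (Real.tanh (R / 2) ^ 2)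
    + -4 * (Real.cosh (R / 2) / Real.sinh (R / 2)) ^ 2 * Real.log (Real.cosh (R / 2))
      * Real.log (Real.cosh (r / 2) / Real.cosh (R / 2))

end ClampedPlate

/-! The fourth-order problem splits into two second-order radial equations. Let `q` be a smooth
function of the distance to the centre with Δ(F∘q) = a(q)F'' + b(q)F'. It suffices to find profiles
`w` and `H` with Δ(w∘q) = 1 and Δ(H∘q) = w∘q on the ball, and with `H` and `H'` zero at the boundary
value `t₀`. The double zero puts H∘q, cut off outside the ball, in H²_0
(`Geometry.IsRadial.memH20`). Green's identity, passed to the limit along test functions, gives ∫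
w(q) Δv = ∫ v for every v in H²_0 (`integral_mul_weakLaplacian`), which is the weak equation.
`Geometry.IsRadial.deflection` assembles this.

For uniqueness, testing two solutions against each other shows that their weak Laplacians agree. A
Poincaré inequality ‖φ‖ ≤ 2B‖Δφ‖ in L² then makes the solutions agree (`isDeflection_unique`). That
inequality needs only a function ρ with Δρ = 1 and -B ≤ ρ ≤ 0, and `w` minus a constant is one.

The variable is q = |x-p|² in ℝ^N, sin²(d/2) on the sphere and sinh²(d/2) in the hyperbolic plane.
These are smooth at the centre, and |∇q|² and Δq are polynomials in q: 4q and 2N in the flat case,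
q(1-εq) and 1-2εq for curvature ε = ±1. In the curved cases s = 1-εq turns the Laplacian into
ε(s(1-s)F')', so integrating twice produces first a logarithm and then a dilogarithm. The single
function `logProfile` serves both surfaces (`deriv_logProfile_mul`, `logProfile_ode`,
`Geometry.IsRadial.deflection_log`).

For the mean deflection, q pushes the area of either surface forward to 4π dt on its range, so one
integration by parts suffices (`integral_logProfile`). In the hyperbolic plane this comes from the
Cayley transform and polar coordinates in the disk. On the sphere it is Archimedes' theorem,
obtained from the moments of q through ∫ Δ(q^(k+1)) = 0.

The remaining substance is Green's identity on each model. In the half-plane it reduces to the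
Euclidean one by conformal invariance. On the sphere it follows from the Euclidean one for
degree-zero extensions multiplied by a radial cutoff. -/

namespace ClampedPlate

/-! ### Convergence, pairing and completeness in L². -/

section SquareIntegrable

variable {α ι : Type*} [MeasurableSpace α] {μ : Measure α} {l : Filter ι}

theorem eLpNorm_two_eq_ofReal_sqrt {f : α → ℝ} (hf : MemLp f 2 μ) :
    eLpNorm f 2 μ = ENNReal.ofReal √(∫ x, f x ^ 2 ∂μ) := by
  rw [hf.eLpNorm_eq_integral_rpow_norm (by norm_num) (by norm_num), Real.sqrt_eq_rpow]
  simp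

theorem tendsto_eLpNorm_two_zero_iff {f : ι → α → ℝ} (hf : ∀ i, MemLp (f i) 2 μ) :
    Tendsto (fun i => eLpNorm (f i) 2 μ) l (𝓝 0) ↔
      Tendsto (fun i => ∫ x, f i x ^ 2 ∂μ) l (𝓝 0) := by
  have h0 : ∀ i, 0 ≤ ∫ x, f i x ^ 2 ∂μ := fun i => integral_nonneg fun x => sq_nonneg _
  simp_rw [fun i => eLpNorm_two_eq_ofReal_sqrt (hf i)]
  constructor
  · intro h
    have h1 := (ENNReal.continuousAt_toReal ENNReal.zero_ne_top).tendsto.comp h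
    have h2 := h1.pow 2
    refine Tendsto.congr (fun i => ?_) (by simpa using h2)
    simp [Real.sq_sqrt (h0 i)]
  · intro h
    simpa using ENNReal.tendsto_ofReal (h.sqrt)

/-- The integral of the product is the inner product of L², which is jointly continuous. -/
theorem tendsto_integral_mul_of_tendsto_eLpNorm_sub {f g : ι → α → ℝ} {f₀ g₀ : α → ℝ}
    (hf : ∀ i, MemLp (f i) 2 μ) (hf₀ : MemLp f₀ 2 μ)
    (hg : ∀ i, MemLp (g i) 2 μ) (hg₀ : MemLp g₀ 2 μ)
    (hlf : Tendsto (fun i => eLpNorm (f i - f₀) 2 μ) l (𝓝 0))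
    (hlg : Tendsto (fun i => eLpNorm (g i - g₀) 2 μ) l (𝓝 0)) :
    Tendsto (fun i => ∫ x, f i x * g i x ∂μ) l (𝓝 (∫ x, f₀ x * g₀ x ∂μ)) := by
  have key : ∀ {u v : α → ℝ} (hu : MemLp u 2 μ) (hv : MemLp v 2 μ),
      inner ℝ (hv.toLp v) (hu.toLp u) = ∫ x, u x * v x ∂μ := by
    intro u v hu hv
    rw [L2.inner_def]
    refine integral_congr_ae ?_
    filter_upwards [hu.coeFn_toLp, hv.coeFn_toLp] with x h1 h2
    simp [h1, h2]
  have h1 := (Lp.tendsto_Lp_iff_tendsto_eLpNorm'' f hf f₀ hf₀).2 hlf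
  have h2 := (Lp.tendsto_Lp_iff_tendsto_eLpNorm'' g hg g₀ hg₀).2 hlg
  simpa only [key] using h2.inner (𝕜 := ℝ) h1

theorem tendsto_eLpNorm_sub_restrict {f : ι → α → ℝ} {f₀ : α → ℝ} {s : Set α}
    (h : Tendsto (fun i => eLpNorm (f i - f₀) 2 μ) l (𝓝 0)) :
    Tendsto (fun i => eLpNorm (f i - f₀) 2 (μ.restrict s)) l (𝓝 0) :=
  tendsto_of_tendsto_of_tendsto_of_le_of_le tendsto_const_nhds h (fun _ => zero_le)
    fun _ => eLpNorm_mono_measure _ Measure.restrict_le_self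

theorem exists_tendsto_eLpNorm_sub_of_cauchy {f : ℕ → α → ℝ} (hf : ∀ k, MemLp (f k) 2 μ)
    (h : Tendsto (fun jk : ℕ × ℕ => ∫ x, (f jk.1 x - f jk.2 x) ^ 2 ∂μ) atTop (𝓝 0)) :
    ∃ g, MemLp g 2 μ ∧ Tendsto (fun k => eLpNorm (f k - g) 2 μ) atTop (𝓝 0) := by
  have hc : CauchySeq fun k => (hf k).toLp (f k) := by
    rw [cauchySeq_iff_tendsto_dist_atTop_0]
    have h1 := (tendsto_eLpNorm_two_zero_iff (f := fun jk : ℕ × ℕ => f jk.1 - f jk.2)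
      (fun jk => (hf jk.1).sub (hf jk.2))).2 h
    have h2 := (ENNReal.continuousAt_toReal ENNReal.zero_ne_top).tendsto.comp h1
    refine Tendsto.congr (fun jk => ?_) (by simpa using h2)
    rw [dist_eq_norm, ← MemLp.toLp_sub, Lp.norm_toLp]
    rfl
  obtain ⟨g, hg⟩ := cauchySeq_tendsto_of_complete hc
  refine ⟨g, Lp.memLp g, ?_⟩
  rw [← Lp.tendsto_Lp_iff_tendsto_eLpNorm'' f hf _ (Lp.memLp g), Lp.toLp_coeFn]
  exact hg

end SquareIntegrable

/-- Local operators do not enlarge supports. This is applied to Laplacians, gradients and Hessians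
of test functions. -/
theorem hasCompactSupport_of_local {M : Type*} [TopologicalSpace M] {f g : M → ℝ}
    (hf : HasCompactSupport f)
    (h : ∀ x, f =ᶠ[𝓝 x] 0 → g x = 0) : HasCompactSupport g := by
  refine hf.mono' fun x hx => ?_
  by_contra hx'
  exact hx (h x (notMem_tsupport_iff_eventuallyEq.1 hx'))

/-! ### Weak solutions on an abstract geometry: limits of Laplacians, Poincaré inequality,
uniqueness. -/

section Abstract

variable {M : Type} [TopologicalSpace M] [MeasurableSpace M]

/-- The properties of a Riemannian manifold used in the solution of the clamped plate problem. -/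
structure Geometry.IsRegular (G : Geometry M) : Prop where
  smooth_sub : ∀ {f g : M → ℝ}, G.Smooth f → G.Smooth g → G.Smooth (f - g)
  smooth_sq : ∀ {f : M → ℝ}, G.Smooth f → G.Smooth (f * f)
  continuous : ∀ {f : M → ℝ}, G.Smooth f → Continuous f
  continuous_lap : ∀ {f : M → ℝ}, G.Smooth f → Continuous (G.lap f)
  continuous_gradSq : ∀ {f : M → ℝ}, G.Smooth f → Continuous (G.gradSq f)
  continuous_hessSq : ∀ {f : M → ℝ}, G.Smooth f → Continuous (G.hessSq f)
  lap_eq_zero : ∀ {f : M → ℝ} {x : M}, f =ᶠ[𝓝 x] 0 → G.lap f x = 0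
  gradSq_eq_zero : ∀ {f : M → ℝ} {x : M}, f =ᶠ[𝓝 x] 0 → G.gradSq f x = 0
  hessSq_eq_zero : ∀ {f : M → ℝ} {x : M}, f =ᶠ[𝓝 x] 0 → G.hessSq f x = 0
  gradSq_nonneg : ∀ (f : M → ℝ) (x : M), 0 ≤ G.gradSq f x
  hessSq_nonneg : ∀ (f : M → ℝ) (x : M), 0 ≤ G.hessSq f x
  lap_sub : ∀ {f g : M → ℝ}, G.Smooth f → G.Smooth g → G.lap (f - g) = G.lap f - G.lap g
  lap_sq_ge : ∀ {f : M → ℝ}, G.Smooth f → ∀ x, 2 * (f x * G.lap f x) ≤ G.lap (f * f) x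
  lap_bound : ∃ C, 0 ≤ C ∧ ∀ {f : M → ℝ}, G.Smooth f → ∀ x, G.lap f x ^ 2 ≤ C * G.hessSq f x
  green : ∀ {f φ : M → ℝ}, G.Smooth f → G.Smooth φ → HasCompactSupport φ →
    ∫ x, f x * G.lap φ x ∂G.vol = ∫ x, G.lap f x * φ x ∂G.vol
  ae_zero : ∀ {Ω : Set M} {w : M → ℝ}, IsOpen Ω → IntegrableOn w Ω G.vol →
    (∀ φ, IsTest G Ω φ → ∫ x in Ω, w x * φ x ∂G.vol = 0) → ∀ᵐ x ∂G.vol.restrict Ω, w x = 0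

/-- A function `q` whose sublevel sets are geodesic balls, with
`Δ (F ∘ q) = a(q) F''(q) + b(q) F'(q)`. -/
structure Geometry.IsRadial (G : Geometry M) (q : M → ℝ) (a b : ℝ → ℝ) : Prop where
  continuous : Continuous q
  isCompact : ∀ c, IsCompact {x | q x ≤ c}
  smooth_comp : ∀ {F : ℝ → ℝ}, ContDiff ℝ ∞ F → G.Smooth (F ∘ q)
  lap_comp : ∀ {F : ℝ → ℝ}, ContDiff ℝ ∞ F → ∀ x,
    G.lap (F ∘ q) x = a (q x) * deriv (deriv F) (q x) + b (q x) * deriv F (q x)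
  bound : ∃ C : M → ℝ, Continuous C ∧ ∀ {F : ℝ → ℝ}, ContDiff ℝ ∞ F → ∀ x,
    G.gradSq (F ∘ q) x + G.hessSq (F ∘ q) x
      ≤ C x * (deriv F (q x) ^ 2 + deriv (deriv F) (q x) ^ 2)

variable {G : Geometry M} {Ω : Set M}

theorem IsTest.eq_zero {φ : M → ℝ} (h : IsTest G Ω φ) {x : M} (hx : x ∉ Ω) : φ x = 0 :=
  image_eq_zero_of_notMem_tsupport fun h' => hx (h.2.2 h')

theorem Geometry.IsRegular.isTest_sub (hG : G.IsRegular) {φ ψ : M → ℝ} (hφ : IsTest G Ω φ)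
    (hψ : IsTest G Ω ψ) : IsTest G Ω (φ - ψ) :=
  ⟨hG.smooth_sub hφ.1 hψ.1, hφ.2.1.sub hψ.2.1,
    (tsupport_sub φ ψ).trans (union_subset hφ.2.2 hψ.2.2)⟩

theorem Geometry.IsRegular.lap_eq_zero_of_notMem (hG : G.IsRegular) {φ : M → ℝ}
    (h : IsTest G Ω φ) {x : M} (hx : x ∉ Ω) : G.lap φ x = 0 :=
  hG.lap_eq_zero (notMem_tsupport_iff_eventuallyEq.1 fun h' => hx (h.2.2 h'))

theorem Geometry.IsRegular.setIntegral_mul_lap (hG : G.IsRegular) {φ : M → ℝ} (hφ : IsTest G Ω φ)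
    {f : M → ℝ} (hf : G.Smooth f) :
    ∫ x in Ω, f x * G.lap φ x ∂G.vol = ∫ x in Ω, G.lap f x * φ x ∂G.vol := by
  rw [setIntegral_eq_integral_of_forall_compl_eq_zero, hG.green hf hφ.1 hφ.2.1,
    setIntegral_eq_integral_of_forall_compl_eq_zero]
  · intro x hx
    rw [hφ.eq_zero hx, mul_zero]
  · intro x hx
    rw [hG.lap_eq_zero_of_notMem hφ hx, mul_zero]

variable [OpensMeasurableSpace M] [IsFiniteMeasureOnCompacts G.vol]

namespace Geometry.IsRegular

variable (hG : G.IsRegular)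
include hG

theorem memLp_of_isTest {φ : M → ℝ} (h : IsTest G Ω φ) : MemLp φ 2 G.vol :=
  (hG.continuous h.1).memLp_of_hasCompactSupport h.2.1

theorem memLp_lap_of_isTest {φ : M → ℝ} (h : IsTest G Ω φ) : MemLp (G.lap φ) 2 G.vol :=
  (hG.continuous_lap h.1).memLp_of_hasCompactSupport
    (hasCompactSupport_of_local h.2.1 fun _ => hG.lap_eq_zero)

/-- The Laplacian is the trace of the Hessian, so the Hessian term of the H² norm alone controls it.
This makes the Laplacians of an H²-Cauchy sequence Cauchy in L². -/
theorem integral_lap_sq_le_h2NormSq : ∃ C, 0 ≤ C ∧ ∀ φ, IsTest G Ω φ →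
    ∫ x, G.lap φ x ^ 2 ∂G.vol ≤ C * h2NormSq G φ := by
  obtain ⟨C, hC, h⟩ := hG.lap_bound
  refine ⟨C, hC, fun φ hφ => ?_⟩
  rw [h2NormSq, ← integral_const_mul]
  have hint : Integrable (fun x => φ x ^ 2 + G.gradSq φ x + G.hessSq φ x) G.vol := by
    refine Continuous.integrable_of_hasCompactSupport ?_ ?_
    · exact (((hG.continuous hφ.1).pow 2).add (hG.continuous_gradSq hφ.1)).add
        (hG.continuous_hessSq hφ.1)
    · refine hasCompactSupport_of_local hφ.2.1 fun x hx => ?_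
      simp [hG.gradSq_eq_zero hx, hG.hessSq_eq_zero hx, hx.self_of_nhds]
  refine integral_mono (hG.memLp_lap_of_isTest hφ).integrable_sq (hint.const_mul C) fun x => ?_
  refine (h hφ.1 x).trans (mul_le_mul_of_nonneg_left ?_ hC)
  nlinarith [hG.gradSq_nonneg φ x, sq_nonneg (φ x)]

/-- The Laplacians of test functions approximating `u` in `H²` converge to the weak Laplacian. -/
theorem tendsto_lap (hΩ : IsOpen Ω) (hΩf : G.vol Ω ≠ ⊤) {u w : M → ℝ} {φ : ℕ → M → ℝ}
    (hu : MemLp u 2 G.vol) (hφ : ∀ k, IsTest G Ω (φ k))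
    (hφu : Tendsto (fun k => eLpNorm (φ k - u) 2 G.vol) atTop (𝓝 0))
    (hc : Tendsto (fun jk : ℕ × ℕ => h2NormSq G (φ jk.1 - φ jk.2)) atTop (𝓝 0))
    (hw : IsWeakLaplacian G Ω u w) :
    Tendsto (fun k => eLpNorm (G.lap (φ k) - w) 2 (G.vol.restrict Ω)) atTop (𝓝 0) := by
  obtain ⟨C, hC, hb⟩ := hG.integral_lap_sq_le_h2NormSq (Ω := Ω)
  have hm : ∀ k, MemLp (G.lap (φ k)) 2 (G.vol.restrict Ω) := fun k =>
    (hG.memLp_lap_of_isTest (hφ k)).restrict Ω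
  obtain ⟨g, hg, hlim⟩ := exists_tendsto_eLpNorm_sub_of_cauchy hm (by
    refine tendsto_of_tendsto_of_tendsto_of_le_of_le tendsto_const_nhds
      (by simpa using hc.const_mul C) (fun _ => integral_nonneg fun x => sq_nonneg _) fun jk => ?_
    have ht := hG.isTest_sub (hφ jk.1) (hφ jk.2)
    have h2 := hb _ ht
    rw [hG.lap_sub (hφ jk.1).1 (hφ jk.2).1] at h2
    refine le_trans ?_ h2
    refine setIntegral_le_integral ?_ (Eventually.of_forall fun x => sq_nonneg _)
    simpa using ((hG.memLp_lap_of_isTest (hφ jk.1)).sub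
      (hG.memLp_lap_of_isTest (hφ jk.2))).integrable_sq)
  -- The L² limit `g` of the Laplacians and the given weak Laplacian `w` have the same pairing with
  -- every test function: move the Laplacian onto the test function, pass to the limit, and use the
  -- definition of `w`.
  have hgw : ∀ᵐ x ∂G.vol.restrict Ω, (g - w) x = 0 := by
    have : IsFiniteMeasure (G.vol.restrict Ω) := ⟨by simpa using hΩf.lt_top⟩
    refine hG.ae_zero hΩ ((hg.sub hw.1).integrable (by norm_num)) fun ψ hψ => ?_
    have hψm := (hG.memLp_of_isTest hψ).restrict Ω
    have hlψm := (hG.memLp_lap_of_isTest hψ).restrict Ω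
    have h1 : Tendsto (fun k => ∫ x in Ω, G.lap (φ k) x * ψ x ∂G.vol) atTop
        (𝓝 (∫ x in Ω, g x * ψ x ∂G.vol)) :=
      tendsto_integral_mul_of_tendsto_eLpNorm_sub hm hg (fun _ => hψm) hψm hlim (by simp)
    have h2 : Tendsto (fun k => ∫ x in Ω, φ k x * G.lap ψ x ∂G.vol) atTop
        (𝓝 (∫ x in Ω, u x * G.lap ψ x ∂G.vol)) :=
      tendsto_integral_mul_of_tendsto_eLpNorm_sub
        (fun k => (hG.memLp_of_isTest (hφ k)).restrict Ω) (hu.restrict Ω) (fun _ => hlψm) hlψm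
        (tendsto_eLpNorm_sub_restrict hφu) (by simp)
    simp_rw [fun k => hG.setIntegral_mul_lap hψ (hφ k).1] at h2
    have h3 := tendsto_nhds_unique h1 h2
    rw [← hw.2 ψ hψ] at h3
    simp only [Pi.sub_apply, sub_mul]
    rw [integral_sub, h3, sub_self]
    · exact hg.integrable_mul hψm
    · exact hw.1.integrable_mul hψm
  refine hlim.congr fun k => eLpNorm_congr_ae ?_
  filter_upwards [hgw] with x hx
  have : g x = w x := by simpa [sub_eq_zero] using hx
  simp [this]

/-- A Poincaré inequality, from a bounded function with Laplacian `1`. -/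
theorem integral_sq_le_of_isTest {ρ : M → ℝ} {B : ℝ} (hρ : G.Smooth ρ)
    (hlap : ∀ x ∈ Ω, G.lap ρ x = 1) (hneg : ∀ x ∈ Ω, ρ x ≤ 0) (hB : ∀ x ∈ Ω, -B ≤ ρ x)
    {φ : M → ℝ} (hφ : IsTest G Ω φ) :
    ∫ x, φ x ^ 2 ∂G.vol ≤ 4 * B ^ 2 * ∫ x, G.lap φ x ^ 2 ∂G.vol := by
  have hφc := hG.continuous hφ.1
  have hsq : IsTest G Ω (φ * φ) :=
    ⟨hG.smooth_sq hφ.1, hφ.2.1.mul_left, (tsupport_mul_subset_left).trans hφ.2.2⟩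
  have hi1 := (hG.memLp_of_isTest hφ).integrable_sq
  have hi2 := (hG.memLp_lap_of_isTest hφ).integrable_sq
  have h1 : ∫ x, φ x ^ 2 ∂G.vol = ∫ x, ρ x * G.lap (φ * φ) x ∂G.vol := by
    rw [hG.green hρ hsq.1 hsq.2.1]
    refine integral_congr_ae (Eventually.of_forall fun x => ?_)
    by_cases hx : x ∈ Ω
    · simp [hlap x hx, sq]
    · simp [hφ.eq_zero hx]
  have hi3 : Integrable (fun x => ρ x * G.lap (φ * φ) x) G.vol :=
    ((hG.continuous hρ).mul (hG.continuous_lap hsq.1)).integrable_of_hasCompactSupport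
      (hasCompactSupport_of_local hsq.2.1 fun x hx => by simp [hG.lap_eq_zero hx])
  have h2 : ∫ x, ρ x * G.lap (φ * φ) x ∂G.vol
      ≤ ∫ x, (1 / 2 * φ x ^ 2 + 2 * B ^ 2 * G.lap φ x ^ 2) ∂G.vol := by
    refine integral_mono hi3 ((hi1.const_mul _).add (hi2.const_mul _)) fun x => ?_
    by_cases hx : x ∈ Ω
    -- Since ρ ≤ 0, the bound Δ(φ²) ≥ 2φΔφ reverses to ρΔ(φ²) ≤ 2ρφΔφ, and this is at most φ²/2 +
    -- 2ρ²(Δφ)². The term φ²/2 is later absorbed on the left, which gives the factor 4B².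
    · have h3 := mul_le_mul_of_nonpos_left (hG.lap_sq_ge hφ.1 x) (hneg x hx)
      have h4 : ρ x ^ 2 ≤ B ^ 2 := by nlinarith [hneg x hx, hB x hx]
      have h5 := mul_le_mul_of_nonneg_right h4 (sq_nonneg (G.lap φ x))
      simp only
      nlinarith [sq_nonneg (φ x - 2 * ρ x * G.lap φ x)]
    · simp [hG.lap_eq_zero_of_notMem hφ hx, hG.lap_eq_zero_of_notMem hsq hx, hφ.eq_zero hx]
  rw [integral_add (hi1.const_mul _) (hi2.const_mul _), integral_const_mul,
    integral_const_mul] at h2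
  linarith

/-- A radial function with `Δ w = 1` can be tested against weak Laplacians. -/
theorem integral_mul_weakLaplacian (hΩ : IsOpen Ω) (hΩf : G.vol Ω ≠ ⊤) {w : M → ℝ}
    (hw : G.Smooth w) (hwm : MemLp w 2 (G.vol.restrict Ω)) (hlap : ∀ x ∈ Ω, G.lap w x = 1)
    {v Δv : M → ℝ} (hv : MemH20 G Ω v) (hΔv : IsWeakLaplacian G Ω v Δv) :
    ∫ x in Ω, w x * Δv x ∂G.vol = ∫ x in Ω, v x ∂G.vol := by
  obtain ⟨hvm, φ, hφ, hφv, hc⟩ := hv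
  have : IsFiniteMeasure (G.vol.restrict Ω) := ⟨by simpa using hΩf.lt_top⟩
  have h1 : Tendsto (fun k => ∫ x in Ω, w x * G.lap (φ k) x ∂G.vol) atTop
      (𝓝 (∫ x in Ω, w x * Δv x ∂G.vol)) :=
    tendsto_integral_mul_of_tendsto_eLpNorm_sub (fun _ => hwm) hwm
      (fun k => (hG.memLp_lap_of_isTest (hφ k)).restrict Ω) hΔv.1 (by simp)
      (hG.tendsto_lap hΩ hΩf hvm hφ hφv hc hΔv)
  have h2 : Tendsto (fun k => ∫ x in Ω, 1 * φ k x ∂G.vol) atTop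
      (𝓝 (∫ x in Ω, 1 * v x ∂G.vol)) :=
    tendsto_integral_mul_of_tendsto_eLpNorm_sub (fun _ => memLp_const 1) (memLp_const 1)
      (fun k => (hG.memLp_of_isTest (hφ k)).restrict Ω) (hvm.restrict Ω) (by simp)
      (tendsto_eLpNorm_sub_restrict hφv)
  have h3 : ∀ k, ∫ x in Ω, w x * G.lap (φ k) x ∂G.vol = ∫ x in Ω, 1 * φ k x ∂G.vol := fun k => by
    rw [hG.setIntegral_mul_lap (hφ k) hw]
    refine setIntegral_congr_fun hΩ.measurableSet fun x hx => ?_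
    simp only [hlap x hx]
  simp_rw [h3] at h1
  simpa using tendsto_nhds_unique h1 h2

/-- Two weak solutions of the clamped plate problem coincide. -/
theorem isDeflection_unique (hΩ : IsOpen Ω) (hΩf : G.vol Ω ≠ ⊤) {ρ : M → ℝ} {B : ℝ}
    (hρ : G.Smooth ρ) (hlap : ∀ x ∈ Ω, G.lap ρ x = 1) (hneg : ∀ x ∈ Ω, ρ x ≤ 0)
    (hB : ∀ x ∈ Ω, -B ≤ ρ x) {u u' : M → ℝ} (hu : IsDeflection G Ω u)
    (hu' : IsDeflection G Ω u') : u =ᵐ[G.vol] u' := by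
  obtain ⟨hH, w, hw, h⟩ := hu
  obtain ⟨hH', w', hw', h'⟩ := hu'
  -- Each of the two equations is tested with both solutions. The four resulting identities are the
  -- terms of ∫ (w - w')², and they cancel.
  have hww : w - w' =ᵐ[G.vol.restrict Ω] 0 := by
    have e1 := h u w hH hw
    have e2 := h u' w' hH' hw'
    have e3 := h' u w hH hw
    have e4 := h' u' w' hH' hw'
    have i1 := hw.1.integrable_mul hw.1
    have i2 := hw.1.integrable_mul hw'.1
    have i3 := hw'.1.integrable_mul hw.1
    have i4 := hw'.1.integrable_mul hw'.1
    have e : ∫ x in Ω, (w - w') x ^ 2 ∂G.vol = 0 := by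
      have : ∀ x, (w - w') x ^ 2 = ((w * w) x - (w * w') x) - ((w' * w) x - (w' * w') x) := by
        intro x; simp; ring
      simp_rw [this]
      have h1 := integral_sub (i1.sub i2) (i3.sub i4)
      have h2 := integral_sub i1 i2
      have h3 := integral_sub i3 i4
      simp only [Pi.sub_apply, Pi.mul_apply] at h1 h2 h3
      simp only [Pi.mul_apply]
      rw [h1, h2, h3]
      linarith
    have := (integral_eq_zero_iff_of_nonneg (fun x => sq_nonneg _)
      (hw.1.sub hw'.1).integrable_sq).1 e
    filter_upwards [this] with x hx
    simpa using hx
  obtain ⟨hm, φ, hφ, hl, hc⟩ := hH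
  obtain ⟨hm', φ', hφ', hl', hc'⟩ := hH'
  have hd := fun k => hG.isTest_sub (hφ k) (hφ' k)
  -- The Poincaré inequality is available only for test functions, so it is applied to differences
  -- of the approximants, whose Laplacians tend to w - w' = 0.
  have t1 : Tendsto (fun k => eLpNorm (G.lap (φ k - φ' k)) 2 (G.vol.restrict Ω)) atTop (𝓝 0) := by
    have ht := (hG.tendsto_lap hΩ hΩf hm hφ hl hc hw).add
      (hG.tendsto_lap hΩ hΩf hm' hφ' hl' hc' hw')
    rw [add_zero] at ht
    refine tendsto_of_tendsto_of_tendsto_of_le_of_le tendsto_const_nhds ht (fun _ => zero_le)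
      fun k => ?_
    have m1 := ((hG.memLp_lap_of_isTest (hφ k)).restrict Ω).sub hw.1
    have m2 := ((hG.memLp_lap_of_isTest (hφ' k)).restrict Ω).sub hw'.1
    refine le_trans (le_of_eq (eLpNorm_congr_ae ?_))
      (eLpNorm_sub_le m1.aestronglyMeasurable m2.aestronglyMeasurable (by norm_num))
    rw [hG.lap_sub (hφ k).1 (hφ' k).1]
    filter_upwards [hww] with x hx
    simp only [Pi.sub_apply, Pi.zero_apply] at hx ⊢
    linarith
  rw [tendsto_eLpNorm_two_zero_iff fun k => (hG.memLp_lap_of_isTest (hd k)).restrict Ω] at t1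
  have t2 : Tendsto (fun k => ∫ x, (φ k - φ' k) x ^ 2 ∂G.vol) atTop (𝓝 0) := by
    refine tendsto_of_tendsto_of_tendsto_of_le_of_le tendsto_const_nhds
      (by simpa using t1.const_mul (4 * B ^ 2)) (fun _ => integral_nonneg fun x => sq_nonneg _)
      fun k => ?_
    refine (hG.integral_sq_le_of_isTest hρ hlap hneg hB (hd k)).trans (le_of_eq ?_)
    rw [setIntegral_eq_integral_of_forall_compl_eq_zero]
    intro x hx
    simp [hG.lap_eq_zero_of_notMem (hd k) hx]
  rw [← tendsto_eLpNorm_two_zero_iff fun k => hG.memLp_of_isTest (hd k)] at t2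
  have t3 : Tendsto (fun _ : ℕ => eLpNorm (u - u') 2 G.vol) atTop (𝓝 0) := by
    have ht := (hl.add hl').add t2
    simp only [add_zero] at ht
    refine tendsto_of_tendsto_of_tendsto_of_le_of_le tendsto_const_nhds ht (fun _ => zero_le)
      fun k => ?_
    have m1 := (hG.memLp_of_isTest (hφ k)).sub hm
    have m2 := (hG.memLp_of_isTest (hφ' k)).sub hm'
    have m3 := hG.memLp_of_isTest (hd k)
    have e : u - u' = (φ k - φ' k) - ((φ k - u) - (φ' k - u')) := by abel
    calc eLpNorm (u - u') 2 G.vol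
        ≤ eLpNorm (φ k - φ' k) 2 G.vol + eLpNorm ((φ k - u) - (φ' k - u')) 2 G.vol := by
          conv_lhs => rw [e]
          exact eLpNorm_sub_le m3.aestronglyMeasurable (m1.sub m2).aestronglyMeasurable
            (by norm_num)
      _ ≤ eLpNorm (φ k - φ' k) 2 G.vol
            + (eLpNorm (φ k - u) 2 G.vol + eLpNorm (φ' k - u') 2 G.vol) := by
          gcongr
          exact eLpNorm_sub_le m1.aestronglyMeasurable m2.aestronglyMeasurable (by norm_num)
      _ = _ := by ring
  have t4 := tendsto_nhds_unique tendsto_const_nhds t3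
  rw [eLpNorm_eq_zero_iff (hm.sub hm').aestronglyMeasurable (by norm_num)] at t4
  filter_upwards [t4] with x hx
  simpa [sub_eq_zero] using hx

end Geometry.IsRegular

end Abstract

/-! ### Cutting off a function with a double zero while keeping its second derivative bounded. -/

section Cutoff

/-- The weighted bounds on χ' and χ'' are invariant under dilation, so every rescaling χ(k·)
satisfies them with the same `A`. They hold because the derivatives vanish beyond s = 2. -/
theorem exists_cutoff : ∃ χ : ℝ → ℝ, ContDiff ℝ ∞ χ ∧ (∀ s ≤ 1, χ s = 0) ∧
    (∀ s, 2 ≤ s → χ s = 1) ∧ ∃ A, 0 ≤ A ∧ ∀ s, 0 ≤ s →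
      |χ s| ≤ 1 ∧ |deriv χ s| * s ≤ A ∧ |deriv (deriv χ) s| * s ^ 2 ≤ A := by
  set χ : ℝ → ℝ := fun s => Real.smoothTransition (s - 1)
  have hsm : ContDiff ℝ ∞ χ := Real.smoothTransition.contDiff.comp (contDiff_id.sub contDiff_const)
  have hsm1 : ContDiff ℝ ∞ (deriv χ) := (contDiff_infty_iff_deriv.1 hsm).2
  have hsm2 : ContDiff ℝ ∞ (deriv (deriv χ)) := (contDiff_infty_iff_deriv.1 hsm1).2
  have h0 : ∀ s ≤ 1, χ s = 0 := fun s hs =>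
    Real.smoothTransition.zero_of_nonpos (by linarith)
  have h1 : ∀ s, 2 ≤ s → χ s = 1 := fun s hs => Real.smoothTransition.one_of_one_le (by linarith)
  have d1 : ∀ s, 2 < s → deriv χ =ᶠ[𝓝 s] 0 := fun s hs => by
    filter_upwards [lt_mem_nhds hs] with t ht
    have : χ =ᶠ[𝓝 t] fun _ => 1 := by
      filter_upwards [lt_mem_nhds ht] with r hr using h1 r hr.le
    rw [this.deriv_eq]
    simp
  have d2 : ∀ s, 2 < s → deriv (deriv χ) s = 0 := fun s hs => by
    rw [(d1 s hs).deriv_eq]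
    simp
  obtain ⟨A, hA⟩ := isCompact_Icc.exists_bound_of_continuousOn (s := Icc (0 : ℝ) 2)
    (f := fun s => deriv χ s * s) (hsm1.continuous.mul continuous_id).continuousOn
  obtain ⟨B, hB⟩ := isCompact_Icc.exists_bound_of_continuousOn (s := Icc (0 : ℝ) 2)
    (f := fun s => deriv (deriv χ) s * s ^ 2)
    (hsm2.continuous.mul (continuous_id.pow 2)).continuousOn
  have hA0 : 0 ≤ A := (norm_nonneg _).trans (hA 0 (by simp))
  refine ⟨χ, hsm, h0, h1, max A B, le_max_of_le_left hA0, fun s hs => ⟨?_, ?_, ?_⟩⟩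
  · rw [abs_of_nonneg (Real.smoothTransition.nonneg _)]
    exact Real.smoothTransition.le_one _
  · rcases le_or_gt s 2 with h | h
    · refine le_max_of_le_left ((le_of_eq ?_).trans (hA s ⟨hs, h⟩))
      rw [Real.norm_eq_abs, abs_mul, abs_of_nonneg hs]
    · rw [(d1 s h).self_of_nhds]
      simp [hA0]
  · rcases le_or_gt s 2 with h | h
    · refine le_max_of_le_right ((le_of_eq ?_).trans (hB s ⟨hs, h⟩))
      rw [Real.norm_eq_abs, abs_mul, abs_of_nonneg (sq_nonneg s)]
    · rw [d2 s h]
      simp [hA0]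

/-- A smooth function vanishing to second order at `t₀` is approximated, with bounded second
derivatives, by smooth functions vanishing near `[t₀, ∞)`. -/
theorem exists_approx_of_vanishing {H : ℝ → ℝ} (hH : ContDiff ℝ ∞ H) {m t₀ : ℝ}
    (h0 : H t₀ = 0) (h1 : deriv H t₀ = 0) :
    ∃ g : ℕ → ℝ → ℝ, (∀ k, ContDiff ℝ ∞ (g k)) ∧
      (∀ k, ∃ c < t₀, ∀ t, c ≤ t → g k t = 0) ∧
      (∃ C, ∀ k, ∀ t ∈ Icc m t₀, |g k t| ≤ C ∧ |deriv (g k) t| ≤ C ∧ |deriv (deriv (g k)) t| ≤ C) ∧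
      ∀ t < t₀, ∀ᶠ k in atTop, g k =ᶠ[𝓝 t] H := by
  obtain ⟨χ, hχ, hχ0, hχ1, A, hA0, hA⟩ := exists_cutoff
  have hd1 : ContDiff ℝ ∞ (deriv H) := (contDiff_infty_iff_deriv.1 hH).2
  have hd2 : ContDiff ℝ ∞ (deriv (deriv H)) := (contDiff_infty_iff_deriv.1 hd1).2
  have cχ1 : ContDiff ℝ ∞ (deriv χ) := (contDiff_infty_iff_deriv.1 hχ).2
  obtain ⟨D, hD⟩ := isCompact_Icc.exists_bound_of_continuousOn (s := Icc m t₀)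
    hd2.continuous.continuousOn
  -- Two applications of the mean value inequality give H' = O(t₀ - t) and H = O((t₀ - t)²). These
  -- orders offset the factors k and k² that come from differentiating the cutoff.
  have bH1 : ∀ t ∈ Icc m t₀, |deriv H t| ≤ D * (t₀ - t) := fun t ht => by
    have := Convex.norm_image_sub_le_of_norm_deriv_le (f := deriv H) (s := Icc m t₀) (C := D)
      (fun x _ => hd1.differentiable (by simp) x) hD (convex_Icc _ _)
      (x := t₀) (y := t) ⟨ht.1.trans ht.2, le_rfl⟩ ht
    rw [h1, sub_zero, Real.norm_eq_abs, Real.norm_eq_abs, abs_sub_comm,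
      abs_of_nonneg (sub_nonneg.2 ht.2)] at this
    exact this
  have bH : ∀ t ∈ Icc m t₀, |H t| ≤ D * (t₀ - t) ^ 2 := fun t ht => by
    have hD0 : 0 ≤ D := (norm_nonneg _).trans (hD t ht)
    have := Convex.norm_image_sub_le_of_norm_deriv_le (f := H) (s := Icc t t₀)
      (C := D * (t₀ - t)) (fun x _ => hH.differentiable (by simp) x)
      (fun x hx => (bH1 x ⟨ht.1.trans hx.1, hx.2⟩).trans
        (mul_le_mul_of_nonneg_left (by linarith [hx.1]) hD0)) (convex_Icc _ _)
      (x := t₀) (y := t) ⟨ht.2, le_rfl⟩ ⟨le_rfl, ht.2⟩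
    rw [h0, sub_zero, Real.norm_eq_abs, Real.norm_eq_abs, abs_sub_comm,
      abs_of_nonneg (sub_nonneg.2 ht.2)] at this
    calc |H t| ≤ _ := this
      _ = _ := by ring
  set c : ℕ → ℝ → ℝ := fun k t => χ (k * (t₀ - t))
  have hcsm : ∀ k, ContDiff ℝ ∞ (c k) := fun k => hχ.comp (by fun_prop)
  have hinner : ∀ (k : ℕ) (t : ℝ), HasDerivAt (fun t => (k : ℝ) * (t₀ - t)) (-(k : ℝ)) t :=
    fun k t => by simpa using ((hasDerivAt_id t).const_sub t₀).const_mul (k : ℝ)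
  have hc1 : ∀ (k : ℕ) (t : ℝ), HasDerivAt (c k) (-(k : ℝ) * deriv χ (k * (t₀ - t))) t :=
      fun k t => by
    have := ((hχ.differentiable (by simp) (k * (t₀ - t))).hasDerivAt).comp t (hinner k t)
    rwa [mul_comm] at this
  have hc2 : ∀ (k : ℕ) (t : ℝ), HasDerivAt (fun t => -(k : ℝ) * deriv χ (k * (t₀ - t)))
      ((k : ℝ) ^ 2 * deriv (deriv χ) (k * (t₀ - t))) t := fun k t => by
    have := (((cχ1.differentiable (by simp) (k * (t₀ - t))).hasDerivAt).comp t
      (hinner k t)).const_mul (-(k : ℝ))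
    exact this.congr_deriv (by ring)
  have hg1 : ∀ (k : ℕ) (t : ℝ), HasDerivAt (fun t => c k t * H t)
      (-(k : ℝ) * deriv χ (k * (t₀ - t)) * H t + c k t * deriv H t) t := fun k t =>
    (hc1 k t).mul (hH.differentiable (by simp) t).hasDerivAt
  have hg2 : ∀ (k : ℕ) (t : ℝ), HasDerivAt
      (fun t => -(k : ℝ) * deriv χ (k * (t₀ - t)) * H t + c k t * deriv H t)
      ((k : ℝ) ^ 2 * deriv (deriv χ) (k * (t₀ - t)) * H t
        + 2 * (-(k : ℝ) * deriv χ (k * (t₀ - t)) * deriv H t) + c k t * deriv (deriv H) t) t :=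
    fun k t => by
      have := ((hc2 k t).mul (hH.differentiable (by simp) t).hasDerivAt).add
        ((hc1 k t).mul (hd1.differentiable (by simp) t).hasDerivAt)
      exact this.congr_deriv (by ring)
  refine ⟨fun k t => c k t * H t, fun k => (hcsm k).mul hH, fun k => ?_, ?_, fun t ht => ?_⟩
  -- Using k + 1 rather than k keeps the witness defined at k = 0. The cutoff is then evaluated at
  -- most at k/(k+1) ≤ 1, where it vanishes.
  · refine ⟨t₀ - 1 / (k + 1), by linarith [show (0 : ℝ) < 1 / (k + 1) by positivity],
      fun t ht => ?_⟩
    have : c k t = 0 := by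
      refine hχ0 _ ?_
      have h2 : t₀ - t ≤ 1 / (k + 1) := by linarith
      calc (k : ℝ) * (t₀ - t) ≤ k * (1 / (k + 1)) := by gcongr
        _ ≤ 1 := by rw [mul_one_div, div_le_one (by positivity)]; linarith
    simp [this]
  · set T := t₀ - m
    refine ⟨D * T ^ 2 + (A * T * D + D * T) + (A * D + 2 * (A * D) + D), fun k t ht => ?_⟩
    have hD0 : 0 ≤ D := (norm_nonneg _).trans (hD t ht)
    have hδ : 0 ≤ t₀ - t := sub_nonneg.2 ht.2
    have hδT : t₀ - t ≤ T := by simp only [T]; linarith [ht.1]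
    have hT : 0 ≤ T := hδ.trans hδT
    have hk : (0 : ℝ) ≤ k := k.cast_nonneg
    obtain ⟨a0, a1, a2⟩ := hA (k * (t₀ - t)) (by positivity)
    have e1 : |(-(k : ℝ) * deriv χ (k * (t₀ - t)) * H t)| ≤ A * T * D := by
      rw [abs_mul, abs_mul, abs_neg, abs_of_nonneg hk]
      calc (k : ℝ) * |deriv χ (k * (t₀ - t))| * |H t|
          ≤ k * |deriv χ (k * (t₀ - t))| * (D * (t₀ - t) ^ 2) := by gcongr; exact bH t ht
        _ = (|deriv χ (k * (t₀ - t))| * (k * (t₀ - t))) * (t₀ - t) * D := by ring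
        _ ≤ A * T * D := by gcongr
    have e2 : |(-(k : ℝ) * deriv χ (k * (t₀ - t)) * deriv H t)| ≤ A * D := by
      rw [abs_mul, abs_mul, abs_neg, abs_of_nonneg hk]
      calc (k : ℝ) * |deriv χ (k * (t₀ - t))| * |deriv H t|
          ≤ k * |deriv χ (k * (t₀ - t))| * (D * (t₀ - t)) := by gcongr; exact bH1 t ht
        _ = (|deriv χ (k * (t₀ - t))| * (k * (t₀ - t))) * D := by ring
        _ ≤ A * D := by gcongr
    have e3 : |(k : ℝ) ^ 2 * deriv (deriv χ) (k * (t₀ - t)) * H t| ≤ A * D := by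
      rw [abs_mul, abs_mul, abs_of_nonneg (sq_nonneg (k : ℝ))]
      calc (k : ℝ) ^ 2 * |deriv (deriv χ) (k * (t₀ - t))| * |H t|
          ≤ k ^ 2 * |deriv (deriv χ) (k * (t₀ - t))| * (D * (t₀ - t) ^ 2) := by
            gcongr; exact bH t ht
        _ = (|deriv (deriv χ) (k * (t₀ - t))| * (k * (t₀ - t)) ^ 2) * D := by ring
        _ ≤ A * D := by gcongr
    have e4 : |c k t * H t| ≤ D * T ^ 2 := by
      rw [abs_mul]
      calc |c k t| * |H t| ≤ 1 * (D * (t₀ - t) ^ 2) := by gcongr; exact bH t ht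
        _ ≤ D * T ^ 2 := by rw [one_mul]; gcongr
    have e5 : |c k t * deriv H t| ≤ D * T := by
      rw [abs_mul]
      calc |c k t| * |deriv H t| ≤ 1 * (D * (t₀ - t)) := by gcongr; exact bH1 t ht
        _ ≤ D * T := by rw [one_mul]; gcongr
    have e6 : |c k t * deriv (deriv H) t| ≤ D := by
      rw [abs_mul]
      calc |c k t| * |deriv (deriv H) t| ≤ 1 * D := by gcongr; exact hD t ht
        _ = D := one_mul D
    have p1 : 0 ≤ A * D := by positivity
    have p2 : 0 ≤ D * T ^ 2 := by positivity
    have p3 : 0 ≤ A * T * D := by positivity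
    have p4 : 0 ≤ D * T := by positivity
    refine ⟨?_, ?_, ?_⟩
    · linarith
    · rw [(hg1 k t).deriv]
      linarith [abs_add_le (-(k : ℝ) * deriv χ (k * (t₀ - t)) * H t) (c k t * deriv H t)]
    · rw [show deriv (fun t => c k t * H t) = fun t =>
        -(k : ℝ) * deriv χ (k * (t₀ - t)) * H t + c k t * deriv H t from
        funext fun t => (hg1 k t).deriv, (hg2 k t).deriv]
      refine (abs_add_three _ _ _).trans ?_
      rw [abs_mul 2, abs_two]
      linarith
  -- Up to the midpoint of t and t₀ the distance to t₀ is at least (t₀ - t)/2, so the constant 4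
  -- makes the argument of χ exceed 2.
  · obtain ⟨n, hn⟩ := exists_nat_gt (4 / (t₀ - t))
    have hpos : 0 < t₀ - t := sub_pos.2 ht
    filter_upwards [eventually_ge_atTop n] with k hk
    filter_upwards [gt_mem_nhds (show t < (t + t₀) / 2 by linarith)] with r hr
    have hkn : (n : ℝ) ≤ k := by exact_mod_cast hk
    have : c k r = 1 := by
      refine hχ1 _ ?_
      rw [div_lt_iff₀ hpos] at hn
      have h3 : (t₀ - t) / 2 ≤ t₀ - r := by linarith
      have h4 : (n : ℝ) * ((t₀ - t) / 2) ≤ k * (t₀ - r) :=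
        mul_le_mul hkn h3 (by linarith) (by positivity)
      linarith
    simp [this]

end Cutoff

/-! ### Radial functions in H²_0 and the solution of the problem from a radial profile. -/

section Radial

variable {M : Type} [TopologicalSpace M] [MeasurableSpace M] {G : Geometry M}
  {q : M → ℝ} {a b : ℝ → ℝ}

theorem Geometry.IsRadial.isTest (hq : G.IsRadial q a b) {F : ℝ → ℝ} (hF : ContDiff ℝ ∞ F)
    {c t₀ : ℝ} (hc : c < t₀) (h : ∀ t, c ≤ t → F t = 0) : IsTest G {x | q x < t₀} (F ∘ q) := by
  have hs : tsupport (F ∘ q) ⊆ {x | q x ≤ c} := by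
    refine closure_minimal (fun x hx => ?_) (isClosed_le hq.continuous continuous_const)
    by_contra hx'
    exact hx (h _ (not_le.1 hx').le)
  exact ⟨hq.smooth_comp hF, (hq.isCompact c).of_isClosed_subset (isClosed_tsupport _) hs,
    fun x hx => lt_of_le_of_lt (hs hx) hc⟩

variable [OpensMeasurableSpace M] [IsFiniteMeasureOnCompacts G.vol]

/-- A radial function vanishing to second order on the boundary lies in `H²_0`. -/
theorem Geometry.IsRadial.memH20 (hG : G.IsRegular) (hq : G.IsRadial q a b) {t₀ : ℝ} {H : ℝ → ℝ}
    (hH : ContDiff ℝ ∞ H) (h0 : H t₀ = 0) (h1 : deriv H t₀ = 0) :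
    MemH20 G {x | q x < t₀} ({x | q x < t₀}.indicator (H ∘ q)) := by
  set Ω := {x | q x < t₀}
  set K := {x | q x ≤ t₀}
  have hK : IsCompact K := hq.isCompact t₀
  have hΩK : Ω ⊆ K := fun x (hx : q x < t₀) => hx.le
  have hΩo : IsOpen Ω := isOpen_lt hq.continuous continuous_const
  have hΩf : G.vol Ω ≠ ⊤ := ((measure_mono hΩK).trans_lt hK.measure_lt_top).ne
  obtain ⟨m, hm⟩ := (hK.image hq.continuous).bddBelow
  have hmem : ∀ x ∈ Ω, q x ∈ Icc m t₀ := fun x hx => ⟨hm ⟨x, hΩK hx, rfl⟩, hΩK hx⟩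
  obtain ⟨g, hg, hgs, ⟨C, hC⟩, hlim⟩ := exists_approx_of_vanishing hH (m := m) h0 h1
  have ht : ∀ k, IsTest G Ω (g k ∘ q) := fun k => by
    obtain ⟨c, hc, h⟩ := hgs k
    exact hq.isTest (hg k) hc h
  set u := Ω.indicator (H ∘ q)
  obtain ⟨BH, hBH⟩ := isCompact_Icc.exists_bound_of_continuousOn (s := Icc m t₀)
    hH.continuous.continuousOn
  have hum : AEStronglyMeasurable u G.vol :=
    ((hH.continuous.comp hq.continuous).measurable.indicator hΩo.measurableSet).aestronglyMeasurable
  have hu : MemLp u 2 G.vol := by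
    rw [memLp_indicator_iff_restrict hΩo.measurableSet]
    have : IsFiniteMeasure (G.vol.restrict Ω) := ⟨by simpa using hΩf.lt_top⟩
    refine MemLp.of_bound (hH.continuous.comp hq.continuous).measurable.aestronglyMeasurable BH ?_
    filter_upwards [ae_restrict_mem hΩo.measurableSet] with x hx using hBH _ (hmem x hx)
  have hind : ∀ c : ℝ, Integrable (Ω.indicator fun _ => c) G.vol := fun c =>
    (integrable_indicator_iff hΩo.measurableSet).2 (integrableOn_const hΩf)
  refine ⟨hu, fun k => g k ∘ q, ht, ?_, ?_⟩
  · rw [tendsto_eLpNorm_two_zero_iff fun k => (hG.memLp_of_isTest (ht k)).sub hu]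
    have := tendsto_integral_filter_of_dominated_convergence (μ := G.vol) (l := atTop)
      (F := fun k x => (g k ∘ q - u) x ^ 2) (f := fun _ => 0)
      (Ω.indicator fun _ => (C + BH) ^ 2)
      (Eventually.of_forall fun k =>
        ((hG.memLp_of_isTest (ht k)).sub hu).aestronglyMeasurable.pow 2)
      (Eventually.of_forall fun k => Eventually.of_forall fun x => ?_) (hind _)
      (Eventually.of_forall fun x => ?_)
    · simpa using this
    · by_cases hx : x ∈ Ω
      · have b1 := (hC k _ (hmem x hx)).1
        have b2 := hBH _ (hmem x hx)
        simp only [u, Pi.sub_apply, indicator_of_mem hx, Function.comp_apply, norm_pow]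
        gcongr
        exact (norm_sub_le _ _).trans (add_le_add b1 b2)
      · simp [u, hx, (ht k).eq_zero hx, -Function.comp_apply]
    · by_cases hx : x ∈ Ω
      · refine tendsto_const_nhds.congr' ?_
        filter_upwards [hlim _ hx] with k hk
        simp [u, hx, hk.self_of_nhds]
      · refine tendsto_const_nhds.congr fun k => ?_
        simp [u, hx, (ht k).eq_zero hx, -Function.comp_apply]
  · obtain ⟨E, hE, hEb⟩ := hq.bound
    obtain ⟨E0, hE0⟩ := hK.exists_bound_of_continuousOn hE.continuousOn
    have hjk : ∀ jk : ℕ × ℕ, IsTest G Ω ((g jk.1 - g jk.2) ∘ q) := fun jk =>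
      hG.isTest_sub (ht jk.1) (ht jk.2)
    have hcd : ∀ jk : ℕ × ℕ, ContDiff ℝ ∞ (g jk.1 - g jk.2) := fun jk => (hg jk.1).sub (hg jk.2)
    have hdg : ∀ k, Differentiable ℝ (g k) := fun k => (hg k).differentiable (by simp)
    have hddg : ∀ k, Differentiable ℝ (deriv (g k)) := fun k =>
      (contDiff_infty_iff_deriv.1 (hg k)).2.differentiable (by simp)
    have hder : ∀ jk : ℕ × ℕ, deriv (g jk.1 - g jk.2) = deriv (g jk.1) - deriv (g jk.2) :=
      fun jk => funext fun t => deriv_sub (hdg _ t) (hdg _ t)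
    have hder2 : ∀ (jk : ℕ × ℕ) t, deriv (deriv (g jk.1 - g jk.2)) t
        = deriv (deriv (g jk.1)) t - deriv (deriv (g jk.2)) t := fun jk t => by
      rw [hder]
      exact deriv_sub (hddg _ t) (hddg _ t)
    have := tendsto_integral_filter_of_dominated_convergence (μ := G.vol) (l := atTop)
      (F := fun (jk : ℕ × ℕ) x => ((g jk.1 - g jk.2) ∘ q) x ^ 2
        + G.gradSq ((g jk.1 - g jk.2) ∘ q) x + G.hessSq ((g jk.1 - g jk.2) ∘ q) x)
      (f := fun _ => 0)
      (Ω.indicator fun _ => (2 * C) ^ 2 + E0 * ((2 * C) ^ 2 + (2 * C) ^ 2))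
      (Eventually.of_forall fun jk => ?_)
      (Eventually.of_forall fun jk => Eventually.of_forall fun x => ?_) (hind _)
      (Eventually.of_forall fun x => ?_)
    · rw [integral_zero] at this
      exact this
    · exact ((((hG.continuous (hjk jk).1).pow 2).add (hG.continuous_gradSq (hjk jk).1)).add
        (hG.continuous_hessSq (hjk jk).1)).measurable.aestronglyMeasurable
    · have hnn := hG.gradSq_nonneg ((g jk.1 - g jk.2) ∘ q) x
      have hnn' := hG.hessSq_nonneg ((g jk.1 - g jk.2) ∘ q) x
      rw [Real.norm_of_nonneg (by positivity)]
      by_cases hx : x ∈ Ω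
      · have hb := hEb (hcd jk) x
        rw [hder2, hder] at hb
        obtain ⟨c0, c1, c2⟩ := hC jk.1 _ (hmem x hx)
        obtain ⟨d0, d1, d2⟩ := hC jk.2 _ (hmem x hx)
        have hsq : ∀ {y z : ℝ}, |y| ≤ C → |z| ≤ C → (y - z) ^ 2 ≤ (2 * C) ^ 2 := by
          intro y z hy hz
          rw [← sq_abs]
          have := (norm_sub_le y z).trans (add_le_add hy hz)
          rw [Real.norm_eq_abs] at this
          gcongr
          linarith
        have hEx : E x ≤ E0 := (le_abs_self _).trans (hE0 x (hΩK hx))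
        have hE00 : 0 ≤ E0 := (norm_nonneg _).trans (hE0 x (hΩK hx))
        rw [indicator_of_mem hx, add_assoc]
        refine add_le_add (hsq c0 d0) (hb.trans ?_)
        refine (mul_le_mul_of_nonneg_right hEx (by positivity)).trans ?_
        exact mul_le_mul_of_nonneg_left (add_le_add (hsq c1 d1) (hsq c2 d2)) hE00
      · have hz : ((g jk.1 - g jk.2) ∘ q) =ᶠ[𝓝 x] 0 :=
          notMem_tsupport_iff_eventuallyEq.1 fun h => hx ((hjk jk).2.2 h)
        rw [indicator_of_notMem hx, hG.gradSq_eq_zero hz, hG.hessSq_eq_zero hz, hz.self_of_nhds]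
        simp
    · refine tendsto_const_nhds.congr' ?_
      -- Inside the ball both approximants eventually coincide with `H` near q(x). Elsewhere they
      -- vanish near x, because their supports lie in the ball. Either way all terms of the H²
      -- integrand are eventually zero at x, and dominated convergence applies.
      have hz : ∀ᶠ jk : ℕ × ℕ in atTop, ((g jk.1 - g jk.2) ∘ q) =ᶠ[𝓝 x] 0 := by
        by_cases hx : x ∈ Ω
        · rw [← prod_atTop_atTop_eq]
          filter_upwards [(hlim _ hx).prod_mk (hlim _ hx)] with jk hjk
          have : g jk.1 - g jk.2 =ᶠ[𝓝 (q x)] 0 := by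
            filter_upwards [hjk.1, hjk.2] with t h1 h2
            simp [h1, h2]
          exact hq.continuous.continuousAt.eventually this
        · exact Eventually.of_forall fun jk =>
            notMem_tsupport_iff_eventuallyEq.1 fun h => hx ((hjk jk).2.2 h)
      filter_upwards [hz] with jk hz
      rw [hG.gradSq_eq_zero hz, hG.hessSq_eq_zero hz, hz.self_of_nhds]
      simp

/-- The clamped plate problem in a geodesic ball, given a solution of the radial equation. -/
theorem Geometry.IsRadial.deflection (hG : G.IsRegular) (hq : G.IsRadial q a b) {t₀ : ℝ}
    {H w : ℝ → ℝ} (hH : ContDiff ℝ ∞ H) (hw : ContDiff ℝ ∞ w) (h0 : H t₀ = 0)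
    (h1 : deriv H t₀ = 0)
    (hHw : ∀ x, q x < t₀ → a (q x) * deriv (deriv H) (q x) + b (q x) * deriv H (q x) = w (q x))
    (hw1 : ∀ x, q x < t₀ → a (q x) * deriv (deriv w) (q x) + b (q x) * deriv w (q x) = 1) :
    (∃ u, IsDeflection G {x | q x < t₀} u) ∧ ∀ u, IsDeflection G {x | q x < t₀} u →
      (∀ᵐ x ∂G.vol.restrict {x | q x < t₀}, u x = H (q x)) ∧
      IntegrableOn u {x | q x < t₀} G.vol ∧
      ∫ x in {x | q x < t₀}, u x ∂G.vol = ∫ x in {x | q x < t₀}, H (q x) ∂G.vol := by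
  set Ω := {x | q x < t₀}
  set K := {x | q x ≤ t₀}
  have hK : IsCompact K := hq.isCompact t₀
  have hΩK : Ω ⊆ K := fun x (hx : q x < t₀) => hx.le
  have hΩo : IsOpen Ω := isOpen_lt hq.continuous continuous_const
  have hΩf : G.vol Ω ≠ ⊤ := ((measure_mono hΩK).trans_lt hK.measure_lt_top).ne
  have hfin : IsFiniteMeasure (G.vol.restrict Ω) := ⟨by simpa using hΩf.lt_top⟩
  have hwc : Continuous (w ∘ q) := hw.continuous.comp hq.continuous
  obtain ⟨W, hW⟩ := hK.exists_bound_of_continuousOn hwc.continuousOn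
  have hwm : MemLp (w ∘ q) 2 (G.vol.restrict Ω) := by
    refine MemLp.of_bound hwc.measurable.aestronglyMeasurable W ?_
    filter_upwards [ae_restrict_mem hΩo.measurableSet] with x hx using hW x (hΩK hx)
  have hlapw : ∀ x ∈ Ω, G.lap (w ∘ q) x = 1 := fun x hx => by
    rw [hq.lap_comp hw, hw1 x hx]
  have hmem := hq.memH20 hG hH h0 h1
  have hsol : IsDeflection G Ω (Ω.indicator (H ∘ q)) := by
    refine ⟨hmem, w ∘ q, ⟨hwm, fun φ hφ => ?_⟩, fun v Δv hv hΔv => ?_⟩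
    · have e := hG.setIntegral_mul_lap hφ (hq.smooth_comp hH)
      calc ∫ x in Ω, (w ∘ q) x * φ x ∂G.vol = ∫ x in Ω, G.lap (H ∘ q) x * φ x ∂G.vol := by
            refine setIntegral_congr_fun hΩo.measurableSet fun x hx => ?_
            simp only [hq.lap_comp hH, hHw x hx, Function.comp_apply]
        _ = ∫ x in Ω, (H ∘ q) x * G.lap φ x ∂G.vol := e.symm
        _ = _ := by
            refine setIntegral_congr_fun hΩo.measurableSet fun x hx => ?_
            simp only [indicator_of_mem hx]
    · exact hG.integral_mul_weakLaplacian hΩo hΩf (hq.smooth_comp hw) hwm hlapw hv hΔv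
  refine ⟨⟨_, hsol⟩, fun u hu => ?_⟩
  -- As |w| ≤ W on the ball, w - W lies between -2W and 0 and still has Laplacian 1, as the Poincaré
  -- inequality requires.
  have hρ : ContDiff ℝ ∞ fun t => w t - W := hw.sub contDiff_const
  have hd : deriv (fun t => w t - W) = deriv w := funext fun t => deriv_sub_const W
  have hae : u =ᵐ[G.vol] Ω.indicator (H ∘ q) := by
    refine hG.isDeflection_unique hΩo hΩf (B := 2 * W) (hq.smooth_comp hρ) (fun x hx => ?_)
      (fun x hx => ?_) (fun x hx => ?_) hu hsol
    · rw [hq.lap_comp hρ, hd, hw1 x hx]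
    · have := (abs_le.1 (hW x (hΩK hx))).2
      simp only [Function.comp_apply] at this ⊢
      linarith
    · have := (abs_le.1 (hW x (hΩK hx))).1
      simp only [Function.comp_apply] at this ⊢
      linarith
  have hae' : ∀ᵐ x ∂G.vol.restrict Ω, u x = H (q x) := by
    filter_upwards [ae_restrict_of_ae hae, ae_restrict_mem hΩo.measurableSet] with x hx hxΩ
    rw [hx, indicator_of_mem hxΩ]
    rfl
  exact ⟨hae', (hu.1.1.restrict Ω).integrable (by norm_num), integral_congr_ae hae'⟩

end Radial

/-! ### Chain and product rules for second derivatives. -/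

section Calculus

variable {E : Type*} [NormedAddCommGroup E] [NormedSpace ℝ E] {f g : E → ℝ} {x : E}

theorem _root_.ContDiffAt.eventually_differentiableAt_two (hf : ContDiffAt ℝ 2 f x) :
    ∀ᶠ y in 𝓝 x, DifferentiableAt ℝ f y :=
  (hf.eventually (by simp)).mono fun _ hy => hy.differentiableAt (by simp)

theorem _root_.ContDiffAt.differentiableAt_fderiv (hf : ContDiffAt ℝ 2 f x) :
    DifferentiableAt ℝ (fderiv ℝ f) x :=
  (hf.fderiv_right (m := 1) (by norm_num)).differentiableAt (by simp)

theorem _root_.ContDiff.contDiffAt_two (hf : ContDiff ℝ ∞ f) : ContDiffAt ℝ 2 f x :=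
  (contDiff_infty.1 hf 2).contDiffAt

theorem fderiv_fderiv_comp_apply {F : ℝ → ℝ} (hF : ContDiffAt ℝ 2 F (f x))
    (hf : ContDiffAt ℝ 2 f x) (v w : E) :
    fderiv ℝ (fderiv ℝ (F ∘ f)) x v w = deriv (deriv F) (f x) * fderiv ℝ f x v * fderiv ℝ f x w
      + deriv F (f x) * fderiv ℝ (fderiv ℝ f) x v w := by
  have h1 : fderiv ℝ (F ∘ f) =ᶠ[𝓝 x] fun y => deriv F (f y) • fderiv ℝ f y := by
    have hF' := hf.continuousAt.eventually hF.eventually_differentiableAt_two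
    filter_upwards [hf.eventually_differentiableAt_two, hF'] with y hy hFy
    exact ((hFy.hasDerivAt).comp_hasFDerivAt y hy.hasFDerivAt).fderiv
  have hF1 : DifferentiableAt ℝ (deriv F) (f x) :=
    hF.differentiableAt_fderiv.clm_apply (differentiableAt_const (1 : ℝ))
  have h2 := (hF1.hasDerivAt.comp_hasFDerivAt x
    (hf.differentiableAt (by simp)).hasFDerivAt).smul hf.differentiableAt_fderiv.hasFDerivAt
  rw [h1.fderiv_eq]
  have h3 := h2.fderiv
  simp only [Function.comp_def] at h3
  erw [h3]
  simp
  ring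

theorem fderiv_fderiv_mul_apply (hf : ContDiffAt ℝ 2 f x) (hg : ContDiffAt ℝ 2 g x) (v w : E) :
    fderiv ℝ (fderiv ℝ (f * g)) x v w = f x * fderiv ℝ (fderiv ℝ g) x v w
      + fderiv ℝ f x v * fderiv ℝ g x w + fderiv ℝ f x w * fderiv ℝ g x v
      + g x * fderiv ℝ (fderiv ℝ f) x v w := by
  have h1 : fderiv ℝ (f * g) =ᶠ[𝓝 x] fun y => f y • fderiv ℝ g y + g y • fderiv ℝ f y := by
    filter_upwards [hf.eventually_differentiableAt_two, hg.eventually_differentiableAt_two]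
      with y h1 h2 using fderiv_mul h1 h2
  have h2 := ((hf.differentiableAt (by simp)).hasFDerivAt.smul
      hg.differentiableAt_fderiv.hasFDerivAt).add
    ((hg.differentiableAt (by simp)).hasFDerivAt.smul hf.differentiableAt_fderiv.hasFDerivAt)
  rw [h1.fderiv_eq]
  erw [h2.fderiv]
  simp
  ring

theorem fderiv_comp_apply' {F : ℝ → ℝ} (hF : DifferentiableAt ℝ F (f x))
    (hf : DifferentiableAt ℝ f x) : fderiv ℝ (F ∘ f) x = deriv F (f x) • fderiv ℝ f x :=
  ((hF.hasDerivAt).comp_hasFDerivAt x hf.hasFDerivAt).fderiv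

/-- By the chain rule and (a + b)² ≤ 2a² + 2b², the bound separates a factor depending only on `f`
from one depending only on the derivatives of `F`. This yields a constant uniform in `F`, as
`Geometry.IsRadial.bound` demands. -/
theorem fderiv_fderiv_comp_apply_sq_le {F : ℝ → ℝ} (hF : ContDiffAt ℝ 2 F (f x))
    (hf : ContDiffAt ℝ 2 f x) (v w : E) :
    (fderiv ℝ (fderiv ℝ (F ∘ f)) x v w) ^ 2 ≤
      2 * ((fderiv ℝ f x v * fderiv ℝ f x w) ^ 2 + (fderiv ℝ (fderiv ℝ f) x v w) ^ 2)
        * (deriv F (f x) ^ 2 + deriv (deriv F) (f x) ^ 2) := by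
  rw [fderiv_fderiv_comp_apply hF hf]
  set A := deriv (deriv F) (f x)
  set B := deriv F (f x)
  set c := fderiv ℝ f x v
  set d := fderiv ℝ f x w
  set e := fderiv ℝ (fderiv ℝ f) x v w
  nlinarith [sq_nonneg (A * c * d - B * e), sq_nonneg (B * c * d), sq_nonneg (A * e)]

end Calculus

/-! ### The Euclidean Laplacian and Green's second identity. -/

section Laplacian

variable {E : Type*} [NormedAddCommGroup E] [InnerProductSpace ℝ E] [FiniteDimensional ℝ E]
  {ι : Type*} [Fintype ι] {f g : E → ℝ} {x : E}

theorem laplacian_eq_sum_fderiv (v : OrthonormalBasis ι ℝ E) (f : E → ℝ) (x : E) :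
    Laplacian.laplacian f x = ∑ i, fderiv ℝ (fderiv ℝ f) x (v i) (v i) := by
  rw [InnerProductSpace.laplacian_eq_iteratedFDeriv_orthonormalBasis f v]
  simp [iteratedFDeriv_two_apply]

theorem norm_sq_eq_sum_apply_sq (v : OrthonormalBasis ι ℝ E) (L : E →L[ℝ] ℝ) :
    ‖L‖ ^ 2 = ∑ i, L (v i) ^ 2 := by
  have h : ∀ y, L y = inner ℝ ((InnerProductSpace.toDual ℝ E).symm L) y := fun y => by simp
  rw [← (InnerProductSpace.toDual ℝ E).symm.norm_map L, ← v.sum_sq_norm_inner_left]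
  exact Finset.sum_congr rfl fun i _ => by rw [h (v i), Real.norm_eq_abs, sq_abs]

theorem laplacian_comp {F : ℝ → ℝ} (hF : ContDiffAt ℝ 2 F (f x)) (hf : ContDiffAt ℝ 2 f x) :
    Laplacian.laplacian (F ∘ f) x = deriv (deriv F) (f x) * ‖fderiv ℝ f x‖ ^ 2
      + deriv F (f x) * Laplacian.laplacian f x := by
  rw [laplacian_eq_sum_fderiv (stdOrthonormalBasis ℝ E),
    laplacian_eq_sum_fderiv (stdOrthonormalBasis ℝ E),
    norm_sq_eq_sum_apply_sq (stdOrthonormalBasis ℝ E), Finset.mul_sum, Finset.mul_sum,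
    ← Finset.sum_add_distrib]
  refine Finset.sum_congr rfl fun i _ => ?_
  rw [fderiv_fderiv_comp_apply hF hf]
  ring

theorem laplacian_mul (v : OrthonormalBasis ι ℝ E) (hf : ContDiffAt ℝ 2 f x)
    (hg : ContDiffAt ℝ 2 g x) :
    Laplacian.laplacian (f * g) x = f x * Laplacian.laplacian g x
      + 2 * ∑ i, fderiv ℝ f x (v i) * fderiv ℝ g x (v i) + g x * Laplacian.laplacian f x := by
  rw [laplacian_eq_sum_fderiv v, laplacian_eq_sum_fderiv v, laplacian_eq_sum_fderiv v,
    Finset.mul_sum, Finset.mul_sum, Finset.mul_sum, ← Finset.sum_add_distrib,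
    ← Finset.sum_add_distrib]
  refine Finset.sum_congr rfl fun i _ => ?_
  rw [fderiv_fderiv_mul_apply hf hg]
  ring

/-- The difference of the two sides is 2|∇f|². -/
theorem two_mul_laplacian_le_laplacian_sq (hf : ContDiffAt ℝ 2 f x) :
    2 * (f x * Laplacian.laplacian f x) ≤ Laplacian.laplacian (f * f) x := by
  rw [laplacian_mul (stdOrthonormalBasis ℝ E) hf hf]
  have : 0 ≤ ∑ i, fderiv ℝ f x (stdOrthonormalBasis ℝ E i)
      * fderiv ℝ f x (stdOrthonormalBasis ℝ E i) :=
    Finset.sum_nonneg fun i _ => mul_self_nonneg _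
  linarith

theorem laplacian_congr_of_eventuallyEq (h : f =ᶠ[𝓝 x] g) :
    Laplacian.laplacian f x = Laplacian.laplacian g x :=
  (InnerProductSpace.laplacian_congr_nhds h).self_of_nhds

theorem fderiv_fderiv_eq_of_eventuallyEq {E : Type*} [NormedAddCommGroup E] [NormedSpace ℝ E]
    {f g : E → ℝ} {x : E} (h : f =ᶠ[𝓝 x] g) :
    fderiv ℝ (fderiv ℝ f) x = fderiv ℝ (fderiv ℝ g) x :=
  h.fderiv.fderiv_eq

theorem fderiv_fderiv_eq_zero {E : Type*} [NormedAddCommGroup E] [NormedSpace ℝ E]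
    {f : E → ℝ} {x : E} (h : f =ᶠ[𝓝 x] 0) : fderiv ℝ (fderiv ℝ f) x = 0 := by
  rw [fderiv_fderiv_eq_of_eventuallyEq h]
  simp

theorem fderiv_eq_zero {E : Type*} [NormedAddCommGroup E] [NormedSpace ℝ E]
    {f : E → ℝ} {x : E} (h : f =ᶠ[𝓝 x] 0) : fderiv ℝ f x = 0 := by
  rw [h.fderiv_eq]
  simp

theorem laplacian_eq_zero (h : f =ᶠ[𝓝 x] 0) : Laplacian.laplacian f x = 0 := by
  rw [laplacian_eq_sum_fderiv (stdOrthonormalBasis ℝ E), fderiv_fderiv_eq_zero h]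
  simp

theorem _root_.ContDiffOn.continuousOn_fderiv_fderiv {E : Type*} [NormedAddCommGroup E]
    [NormedSpace ℝ E] {f : E → ℝ} {U : Set E} (hf : ContDiffOn ℝ ∞ f U) (hU : IsOpen U) :
    ContinuousOn (fderiv ℝ (fderiv ℝ f)) U :=
  ((hf.fderiv_of_isOpen hU (m := ∞) (by simp)).fderiv_of_isOpen hU (m := ∞) (by simp)).continuousOn

theorem _root_.ContDiffOn.continuousOn_laplacian {U : Set E} (hf : ContDiffOn ℝ ∞ f U)
    (hU : IsOpen U) : ContinuousOn (Laplacian.laplacian f) U := by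
  have h := hf.continuousOn_fderiv_fderiv hU
  rw [show Laplacian.laplacian f = fun x => ∑ i, fderiv ℝ (fderiv ℝ f) x
    (stdOrthonormalBasis ℝ E i) (stdOrthonormalBasis ℝ E i) from
    funext fun x => laplacian_eq_sum_fderiv _ f x]
  fun_prop

variable [MeasurableSpace E] [BorelSpace E]

theorem integral_mul_fderiv_fderiv (hf : ContDiff ℝ ∞ f) (hg : ContDiff ℝ ∞ g)
    (hc : HasCompactSupport g) (v : E) :
    ∫ x, f x * fderiv ℝ (fderiv ℝ g) x v v = ∫ x, fderiv ℝ (fderiv ℝ f) x v v * g x := by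
  have key : ∀ h : E → ℝ, ContDiff ℝ ∞ h → ContDiff ℝ ∞ (fun x => fderiv ℝ h x v) :=
    fun h hh => (hh.fderiv_right (m := ∞) (by simp)).clm_apply contDiff_const
  have key2 : ∀ h : E → ℝ, ContDiff ℝ ∞ h → ∀ x,
      fderiv ℝ (fun x => fderiv ℝ h x v) x v = fderiv ℝ (fderiv ℝ h) x v v := fun h hh x => by
    rw [fderiv_clm_apply ((hh.fderiv_right (m := ∞) (by simp)).differentiable (by simp) x)
      (differentiableAt_const v)]
    simp
  have hd : ∀ h : E → ℝ, ContDiff ℝ ∞ h → ∀ x, DifferentiableAt ℝ h x :=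
    fun h hh x => hh.differentiable (by simp) x
  have hcg : HasCompactSupport fun x => fderiv ℝ g x v := hc.fderiv_apply (𝕜 := ℝ) v
  have hcg2 : HasCompactSupport fun x => fderiv ℝ (fun x => fderiv ℝ g x v) x v :=
    hcg.fderiv_apply (𝕜 := ℝ) v
  have hint : ∀ h k : E → ℝ, ContDiff ℝ ∞ h → ContDiff ℝ ∞ k → HasCompactSupport k →
      Integrable fun x => h x * k x := fun h k hh hk hck =>
    (hh.mul hk).continuous.integrable_of_hasCompactSupport hck.mul_left
  have e1 := integral_mul_fderiv_eq_neg_fderiv_mul_of_integrable (μ := (volume : Measure E))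
    (f := f) (g := fun x => fderiv ℝ g x v) (v := v)
    (hint _ _ (key f hf) (key g hg) hcg) (hint _ _ hf (key _ (key g hg)) hcg2)
    (hint _ _ hf (key g hg) hcg) (fun x _ => hd f hf x) (fun x _ => hd _ (key g hg) x)
  have e2 := integral_mul_fderiv_eq_neg_fderiv_mul_of_integrable (μ := (volume : Measure E))
    (f := fun x => fderiv ℝ f x v) (g := g) (v := v)
    (hint _ _ (key _ (key f hf)) hg hc) (hint _ _ (key f hf) (key g hg) hcg)
    (hint _ _ (key f hf) hg hc) (fun x _ => hd _ (key f hf) x) (fun x _ => hd _ hg x)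
  simp only [key2 f hf, key2 g hg] at e1 e2
  rw [e1, e2, neg_neg]

/-- Green's second identity. -/
theorem integral_mul_laplacian (hf : ContDiff ℝ ∞ f) (hg : ContDiff ℝ ∞ g)
    (hc : HasCompactSupport g) :
    ∫ x, f x * Laplacian.laplacian g x = ∫ x, Laplacian.laplacian f x * g x := by
  simp_rw [laplacian_eq_sum_fderiv (stdOrthonormalBasis ℝ E), Finset.mul_sum, Finset.sum_mul]
  have h2 : ∀ h : E → ℝ, ContDiff ℝ ∞ h → ∀ v, Continuous fun x => fderiv ℝ (fderiv ℝ h) x v v :=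
    fun h hh v => by
      have := continuousOn_univ.1 (hh.contDiffOn.continuousOn_fderiv_fderiv isOpen_univ)
      fun_prop
  rw [integral_finsetSum, integral_finsetSum]
  · exact Finset.sum_congr rfl fun i _ => integral_mul_fderiv_fderiv hf hg hc _
  · exact fun i _ => ((h2 f hf _).mul hg.continuous).integrable_of_hasCompactSupport hc.mul_left
  · exact fun i _ => (hf.continuous.mul (h2 g hg _)).integrable_of_hasCompactSupport
      (hasCompactSupport_of_local hc fun x hx => by simp [fderiv_fderiv_eq_zero hx])

/-- Green's second identity for functions that are smooth on an open set. -/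
theorem integral_mul_laplacian_of_contDiffOn {U : Set E} (hU : IsOpen U)
    (hf : ContDiffOn ℝ ∞ f U) (hg : ContDiff ℝ ∞ g) (hc : HasCompactSupport g)
    (hs : tsupport g ⊆ U) :
    ∫ x, f x * Laplacian.laplacian g x = ∫ x, Laplacian.laplacian f x * g x := by
  obtain ⟨V, hV, hVg, hVU⟩ : ∃ V, IsOpen V ∧ tsupport g ⊆ V ∧ closure V ⊆ U := by
    obtain ⟨V, hV, h1, h2, -⟩ := exists_open_between_and_isCompact_closure hc.isCompact hU hs
    exact ⟨V, hV, h1, h2⟩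
  -- Multiplying `f` by a cutoff that is 1 near the support of `g` and vanishes off `V` makes it
  -- smooth everywhere without changing either integrand.
  obtain ⟨χ, hχ1, hχ0, -⟩ := exists_contMDiffMap_one_nhds_of_subset_interior (n := ⊤) 𝓘(ℝ, E)
    (isClosed_tsupport g) (hVg.trans hV.interior_eq.ge)
  have hχs : ContDiff ℝ ∞ χ := χ.contMDiff.contDiff
  have hχf : ContDiff ℝ ∞ (fun x => χ x * f x) := by
    rw [contDiff_iff_contDiffAt]
    intro x
    by_cases hx : x ∈ U
    · exact hχs.contDiffAt.mul (hf.contDiffAt (hU.mem_nhds hx))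
    · have : (fun x => χ x * f x) =ᶠ[𝓝 x] fun _ => 0 := by
        filter_upwards [isClosed_closure.isOpen_compl.mem_nhds fun h => hx (hVU h)] with y hy
        rw [hχ0 y fun h => hy (subset_closure h), zero_mul]
      exact contDiffAt_const.congr_of_eventuallyEq this
  have heq : ∀ x ∈ tsupport g, (fun x => χ x * f x) =ᶠ[𝓝 x] f := fun x hx => by
    filter_upwards [eventually_nhdsSet_iff_forall.1 hχ1 x hx] with y hy
    rw [hy, one_mul]
  have e := integral_mul_laplacian hχf hg hc
  convert e using 2 with x x
  · ext x
    by_cases hx : x ∈ tsupport g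
    · rw [show χ x * f x = f x from (heq x hx).self_of_nhds]
    · rw [laplacian_eq_zero (notMem_tsupport_iff_eventuallyEq.1 hx), mul_zero, mul_zero]
  · ext x
    by_cases hx : x ∈ tsupport g
    · rw [laplacian_congr_of_eventuallyEq (heq x hx)]
    · rw [image_eq_zero_of_notMem_tsupport hx, mul_zero, mul_zero]

end Laplacian

theorem ae_zero_of_forall_isTest {M : Type} [TopologicalSpace M] [MeasurableSpace M]
    [BorelSpace M] [T2Space M] {E : Type*} [NormedAddCommGroup E] [NormedSpace ℝ E]
    [FiniteDimensional ℝ E] {X : Type*} [TopologicalSpace X] (I : ModelWithCorners ℝ E X)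
    [ChartedSpace X M] [IsManifold I ∞ M] [SigmaCompactSpace M] {G : Geometry M}
    (hG : ∀ f, ContMDiff I 𝓘(ℝ, ℝ) ∞ f → G.Smooth f) {Ω : Set M} {w : M → ℝ} (hΩ : IsOpen Ω)
    (hw : IntegrableOn w Ω G.vol) (h : ∀ φ, IsTest G Ω φ → ∫ x in Ω, w x * φ x ∂G.vol = 0) :
    ∀ᵐ x ∂G.vol.restrict Ω, w x = 0 := by
  rw [ae_restrict_iff' hΩ.measurableSet]
  refine hΩ.ae_eq_zero_of_integral_contMDiff_smul_eq_zero I hw.locallyIntegrableOn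
    fun g hg hc hs => ?_
  have ht : IsTest G Ω g := ⟨hG g hg, hc, hs⟩
  rw [← h g ht, setIntegral_eq_integral_of_forall_compl_eq_zero]
  · exact integral_congr_ae (Eventually.of_forall fun x => mul_comm _ _)
  · intro x hx
    rw [ht.eq_zero hx, mul_zero]

/-! ### The ball in ℝ^N. -/

section Euclidean

variable {N : ℕ}

instance : IsFiniteMeasureOnCompacts (euclidean N).vol :=
  inferInstanceAs (IsFiniteMeasureOnCompacts (volume : Measure (EuclideanSpace ℝ (Fin N))))

theorem continuous_fderiv_fderiv {E : Type*} [NormedAddCommGroup E] [NormedSpace ℝ E]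
    {f : E → ℝ} (hf : ContDiff ℝ ∞ f) : Continuous (fderiv ℝ (fderiv ℝ f)) :=
  continuousOn_univ.1 (hf.contDiffOn.continuousOn_fderiv_fderiv isOpen_univ)

/-- Cauchy–Schwarz on the N diagonal entries of the Hessian; the off-diagonal squares are then added
for free. -/
theorem laplacian_sq_le (f : EuclideanSpace ℝ (Fin N) → ℝ) (x : EuclideanSpace ℝ (Fin N)) :
    Laplacian.laplacian f x ^ 2 ≤ N * ∑ i, ∑ j,
      (fderiv ℝ (fderiv ℝ f) x (EuclideanSpace.single i 1) (EuclideanSpace.single j 1)) ^ 2 := by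
  rw [laplacian_eq_sum_fderiv (EuclideanSpace.basisFun (Fin N) ℝ)]
  refine (sq_sum_le_card_mul_sum_sq).trans ?_
  simp only [EuclideanSpace.basisFun_apply, Finset.card_univ, Fintype.card_fin]
  gcongr with i
  exact Finset.single_le_sum (f := fun j => (fderiv ℝ (fderiv ℝ f) x (EuclideanSpace.single i 1)
    (EuclideanSpace.single j 1)) ^ 2) (fun j _ => sq_nonneg _) (Finset.mem_univ i)

theorem contDiff_of_smooth {f : EuclideanSpace ℝ (Fin N) → ℝ} (hf : (euclidean N).Smooth f) :
    ContDiff ℝ ∞ f := hf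

theorem euclidean_isRegular : (euclidean N).IsRegular where
  smooth_sub hf hg := (contDiff_of_smooth hf).sub (contDiff_of_smooth hg)
  smooth_sq hf := (contDiff_of_smooth hf).mul (contDiff_of_smooth hf)
  continuous hf := (contDiff_of_smooth hf).continuous
  continuous_lap hf := continuousOn_univ.1
    ((contDiff_of_smooth hf).contDiffOn.continuousOn_laplacian isOpen_univ)
  continuous_gradSq hf := ((contDiff_of_smooth hf).continuous_fderiv (by simp)).norm.pow 2
  continuous_hessSq hf := by
    have := continuous_fderiv_fderiv (contDiff_of_smooth hf)
    simp only [euclidean]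
    fun_prop
  lap_eq_zero h := laplacian_eq_zero h
  gradSq_eq_zero h := by simp [euclidean, fderiv_eq_zero h]
  hessSq_eq_zero h := by simp [euclidean, fderiv_fderiv_eq_zero h]
  gradSq_nonneg f x := sq_nonneg _
  hessSq_nonneg f x := by
    simp only [euclidean]
    positivity
  lap_sub hf hg := funext fun x => (contDiff_of_smooth hf).contDiffAt_two.laplacian_sub
    (contDiff_of_smooth hg).contDiffAt_two
  lap_sq_ge hf x := two_mul_laplacian_le_laplacian_sq (contDiff_of_smooth hf).contDiffAt_two
  lap_bound := ⟨N, by positivity, fun _ x => laplacian_sq_le _ x⟩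
  green hf hφ hc := integral_mul_laplacian (contDiff_of_smooth hf) (contDiff_of_smooth hφ) hc
  ae_zero hΩ hw h := ae_zero_of_forall_isTest 𝓘(ℝ, EuclideanSpace ℝ (Fin N))
    (fun _ hf => hf.contDiff) hΩ hw h

theorem hasFDerivAt_norm_sub_sq {E : Type*} [NormedAddCommGroup E] [InnerProductSpace ℝ E]
    (p x : E) : HasFDerivAt (fun y => ‖y - p‖ ^ 2) ((2 : ℝ) • innerSL ℝ (x - p)) x := by
  refine ((hasFDerivAt_id x).sub_const p).norm_sq.congr_fderiv ?_
  ext v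
  simp [two_mul]

theorem fderiv_fderiv_norm_sub_sq {E : Type*} [NormedAddCommGroup E] [InnerProductSpace ℝ E]
    (p x v w : E) : fderiv ℝ (fderiv ℝ fun y => ‖y - p‖ ^ 2) x v w = 2 * inner ℝ v w := by
  have h1 : fderiv ℝ (fun y => ‖y - p‖ ^ 2) = fun y => (2 : ℝ) • innerSL ℝ (y - p) :=
    funext fun y => (hasFDerivAt_norm_sub_sq p y).fderiv
  have h2 : HasFDerivAt (fun y => (2 : ℝ) • innerSL ℝ (y - p))
      ((2 : ℝ) • (innerSL ℝ : E →L[ℝ] _)) x :=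
    (((innerSL ℝ).hasFDerivAt (x := x - p)).comp x ((hasFDerivAt_id x).sub_const p)).const_smul
      (2 : ℝ)
  rw [h1, h2.fderiv]
  rfl

theorem laplacian_norm_sub_sq {E : Type*} [NormedAddCommGroup E] [InnerProductSpace ℝ E]
    [FiniteDimensional ℝ E] (p x : E) :
    Laplacian.laplacian (fun y => ‖y - p‖ ^ 2) x = 2 * Module.finrank ℝ E := by
  rw [laplacian_eq_sum_fderiv (stdOrthonormalBasis ℝ E)]
  simp_rw [fderiv_fderiv_norm_sub_sq]
  simp
  ring

theorem euclidean_isRadial (p : EuclideanSpace ℝ (Fin N)) :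
    (euclidean N).IsRadial (fun x => ‖x - p‖ ^ 2) (fun t => 4 * t) (fun _ => 2 * N) := by
  have hq : ContDiff ℝ ∞ fun x : EuclideanSpace ℝ (Fin N) => ‖x - p‖ ^ 2 :=
    (contDiff_id.sub contDiff_const).norm_sq ℝ
  refine ⟨hq.continuous, fun c => ?_, fun hF => hF.comp hq, fun {F} hF x => ?_, ?_⟩
  · refine (isCompact_closedBall p √c).of_isClosed_subset
      (isClosed_le hq.continuous continuous_const) fun x (hx : ‖x - p‖ ^ 2 ≤ c) => ?_
    rw [mem_closedBall_iff_norm]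
    exact Real.le_sqrt_of_sq_le hx
  · have h := laplacian_comp hF.contDiffAt_two (hq.contDiffAt_two (x := x))
    refine h.trans ?_
    rw [laplacian_norm_sub_sq, finrank_euclideanSpace_fin, (hasFDerivAt_norm_sub_sq p x).fderiv,
      norm_smul, innerSL_apply_norm, mul_pow]
    norm_num
    ring
  · have h1 := hq.continuous_fderiv (by simp)
    have h2 := continuous_fderiv_fderiv hq
    set q : EuclideanSpace ℝ (Fin N) → ℝ := fun x => ‖x - p‖ ^ 2
    let e : Fin N → EuclideanSpace ℝ (Fin N) := fun i => EuclideanSpace.single i 1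
    refine ⟨fun x => ‖fderiv ℝ q x‖ ^ 2 + ∑ i, ∑ j,
      2 * ((fderiv ℝ q x (e i) * fderiv ℝ q x (e j)) ^ 2
      + (fderiv ℝ (fderiv ℝ q) x (e i) (e j)) ^ 2), by fun_prop, fun {F} hF x => ?_⟩
    rw [add_mul]
    refine add_le_add ?_ ?_
    · change ‖fderiv ℝ (F ∘ q) x‖ ^ 2 ≤ _
      rw [fderiv_comp_apply' (hF.differentiable (by simp) _) (hq.differentiable (by simp) _),
        norm_smul, mul_pow, Real.norm_eq_abs, sq_abs, mul_comm]
      gcongr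
      linarith [sq_nonneg (deriv (deriv F) (q x))]
    · rw [Finset.sum_mul]
      simp_rw [Finset.sum_mul]
      change ∑ i, ∑ j, (fderiv ℝ (fderiv ℝ (F ∘ q)) x (e i) (e j)) ^ 2 ≤ _
      exact Finset.sum_le_sum fun i _ => Finset.sum_le_sum fun j _ =>
        fderiv_fderiv_comp_apply_sq_le hF.contDiffAt_two hq.contDiffAt_two (e i) (e j)

theorem integral_ball_euclideanProfile (hN : 1 ≤ N) (p : EuclideanSpace ℝ (Fin N)) {R : ℝ}
    (hR : 0 < R) :
    ∫ x in Metric.ball p R, euclideanProfile N R (dist p x) =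
      (volume : Measure (EuclideanSpace ℝ (Fin N))).toSphere.real Set.univ *
        (R ^ (N + 4) / ((N : ℝ) ^ 2 * ((N : ℝ) + 2) ^ 2 * ((N : ℝ) + 4))) := by
  -- With N = n + 1 the polar weight r^(N-1) becomes r^n, free of truncated subtraction.
  obtain ⟨n, rfl⟩ : ∃ n, N = n + 1 := ⟨N - 1, by omega⟩
  have e1 : ∫ x in Metric.ball p R, euclideanProfile (n + 1) R (dist p x)
      = ∫ x : EuclideanSpace ℝ (Fin (n + 1)),
        (Iio R).indicator (euclideanProfile (n + 1) R) ‖x‖ := by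
    rw [← integral_indicator Metric.isOpen_ball.measurableSet,
      ← integral_sub_right_eq_self (fun x : EuclideanSpace ℝ (Fin (n + 1)) =>
        (Iio R).indicator (euclideanProfile (n + 1) R) ‖x‖) p]
    refine integral_congr_ae (Eventually.of_forall fun x => ?_)
    simp only [indicator, Metric.mem_ball, mem_Iio, dist_eq_norm, norm_sub_rev p x]
  have e2 : ∫ y in Ioi (0 : ℝ), y ^ n * (Iio R).indicator (euclideanProfile (n + 1) R) y
      = R ^ (n + 5) / (((n + 1 : ℕ) : ℝ) ^ 2 * (((n + 1 : ℕ) : ℝ) + 2) ^ 2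
        * (((n + 1 : ℕ) : ℝ) + 4)) := by
    have : ∀ y, y ^ n * (Iio R).indicator (euclideanProfile (n + 1) R) y
        = (Iio R).indicator (fun y => y ^ n * euclideanProfile (n + 1) R y) y := fun y => by
      by_cases hy : y ∈ Iio R <;> simp [hy]
    simp_rw [this]
    rw [setIntegral_indicator measurableSet_Iio, Ioi_inter_Iio, ← integral_Ioc_eq_integral_Ioo,
      ← intervalIntegral.integral_of_le hR.le]
    have hp : ∀ y, y ^ n * euclideanProfile (n + 1) R y
        = 1 / (8 * ((n + 1 : ℕ) : ℝ) * (((n + 1 : ℕ) : ℝ) + 2)) *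
          (R ^ 4 * y ^ n - 2 * R ^ 2 * y ^ (n + 2) + y ^ (n + 4)) := fun y => by
      rw [euclideanProfile]
      field_simp
      ring
    simp_rw [hp]
    rw [intervalIntegral.integral_const_mul, intervalIntegral.integral_add,
      intervalIntegral.integral_sub, intervalIntegral.integral_const_mul,
      intervalIntegral.integral_const_mul, integral_pow, integral_pow, integral_pow]
    · simp only [ne_eq, Nat.add_eq_zero_iff, one_ne_zero, and_false, not_false_eq_true, zero_pow,
        sub_zero]
      push_cast
      have h1 : (n : ℝ) + 1 ≠ 0 := by positivity
      have h2 : (n : ℝ) + 1 + 2 ≠ 0 := by positivity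
      have h3 : (n : ℝ) + 1 + 4 ≠ 0 := by positivity
      have h4 : (n : ℝ) + 2 + 1 ≠ 0 := by positivity
      have h5 : (n : ℝ) + 4 + 1 ≠ 0 := by positivity
      field_simp
      ring
    all_goals exact Continuous.intervalIntegrable (by fun_prop) _ _
  rw [e1, integral_fun_norm_addHaar, Measure.toSphere_real_apply_univ]
  simp only [finrank_euclideanSpace, Fintype.card_fin, Nat.add_sub_cancel, smul_eq_mul,
    nsmul_eq_mul]
  rw [e2]
  ring

theorem euclidean_deflection (hN : 1 ≤ N) (p : EuclideanSpace ℝ (Fin N)) {R : ℝ} (hR : 0 < R) :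
    (∃ u, IsDeflection (euclidean N) (Metric.ball p R) u) ∧
      ∀ u, IsDeflection (euclidean N) (Metric.ball p R) u →
        (∀ᵐ x ∂(euclidean N).vol.restrict (Metric.ball p R),
          u x = euclideanProfile N R (dist p x)) ∧
        IntegrableOn u (Metric.ball p R) (euclidean N).vol ∧
        ∫ x in Metric.ball p R, u x ∂(euclidean N).vol =
          (volume : Measure (EuclideanSpace ℝ (Fin N))).toSphere.real Set.univ *
            (R ^ (N + 4) / ((N : ℝ) ^ 2 * ((N : ℝ) + 2) ^ 2 * ((N : ℝ) + 4))) := by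
  have hΩ : Metric.ball p R = {x | ‖x - p‖ ^ 2 < R ^ 2} := by
    ext x
    rw [mem_ball_iff_norm, mem_ofPred_eq, sq_lt_sq₀ (norm_nonneg _) hR.le]
  have hN0 : (N : ℝ) ≠ 0 := by exact_mod_cast (by omega : N ≠ 0)
  have hN2 : (N : ℝ) + 2 ≠ 0 := by positivity
  set c : ℝ := R ^ 4 / (8 * N * (N + 2))
  -- In the variable t = |x - p|² the profile is a quadratic with a double root at R². Since Δ|x -
  -- p|² = 2N, `w` has slope 1/(2N), and its constant term is the one for which Δ(H∘q) = w∘q.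
  set H : ℝ → ℝ := fun t => c * (1 - t / R ^ 2) ^ 2
  set w : ℝ → ℝ := fun t => t / (2 * N) - R ^ 2 / (2 * (N + 2))
  have hH : ContDiff ℝ ∞ H := by fun_prop
  have hw : ContDiff ℝ ∞ w := by fun_prop
  have dH : deriv H = fun t => -(2 * c / R ^ 2) * (1 - t / R ^ 2) := funext fun t => by
    have := ((((hasDerivAt_id t).div_const (R ^ 2)).const_sub 1).pow 2).const_mul c
    refine (this.congr_deriv ?_).deriv
    simp
    ring
  have ddH : deriv (deriv H) = fun t => 2 * c / R ^ 4 := funext fun t => by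
    rw [dH]
    have := (((hasDerivAt_id t).div_const (R ^ 2)).const_sub 1).const_mul (-(2 * c / R ^ 2))
    refine (this.congr_deriv ?_).deriv
    field_simp
  have dw : deriv w = fun _ => 1 / (2 * (N : ℝ)) := funext fun t => by
    exact (((hasDerivAt_id t).div_const (2 * (N : ℝ))).sub_const (R ^ 2 / (2 * (N + 2)))).deriv
  have ddw : deriv (deriv w) = fun t => 0 := by
    rw [dw]
    simp
  have hprof : ∀ x, H (‖x - p‖ ^ 2) = euclideanProfile N R (dist p x) := fun x => by
    rw [dist_comm, dist_eq_norm]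
    rfl
  have main := (euclidean_isRadial p).deflection euclidean_isRegular (t₀ := R ^ 2) hH hw
    (by simp [H, hR.ne']) (by simp [dH, hR.ne'])
    (fun x _ => by
      rw [ddH, dH]
      simp only [w, c]
      field_simp
      ring)
    (fun x _ => by
      rw [ddw, dw]
      field_simp
      ring)
  rw [← hΩ] at main
  simp only [hprof] at main
  refine ⟨main.1, fun u hu => ?_⟩
  obtain ⟨h1, h2, h3⟩ := main.2 u hu
  exact ⟨h1, h2, h3.trans (integral_ball_euclideanProfile hN p hR)⟩

end Euclidean

/-! ### Smoothness and derivative of the dilogarithm on (-∞, 1). -/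

section Dilogarithm

/-- The singularity of log(1 - t)/t at 0 is removable. The divided slope fills it in with the
derivative, and analyticity of the logarithm makes the result analytic there. -/
theorem contDiffAt_log_one_sub_div {t : ℝ} (ht : t < 1) :
    ContDiffAt ℝ ∞ (dslope (fun s => Real.log (1 - s)) 0) t := by
  have han : ∀ t : ℝ, t < 1 → AnalyticAt ℝ (fun s => Real.log (1 - s)) t := fun t ht =>
    (analyticAt_const.sub analyticAt_id).log (by simp; linarith)
  rcases eq_or_ne t 0 with rfl | h0
  · obtain ⟨p, hp⟩ := han 0 one_pos
    exact (hp.has_fpower_series_dslope_fslope).analyticAt.contDiffAt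
  · have : dslope (fun s => Real.log (1 - s)) 0 =ᶠ[𝓝 t] fun s => Real.log (1 - s) / s := by
      filter_upwards [isOpen_ne.mem_nhds h0] with s hs
      rw [dslope_of_ne _ hs, slope_def_field]
      simp
    refine ContDiffAt.congr_of_eventuallyEq ?_ this
    exact ((han t ht).div analyticAt_id h0).contDiffAt

/-- The two integrands differ only at t = 0, where division by zero gives 0 instead of -1. The slope
form has the advantage of being continuous. -/
theorem dilog_eq_integral_dslope (x : ℝ) :
    dilog x = -∫ t in (0 : ℝ)..x, dslope (fun s => Real.log (1 - s)) 0 t := by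
  rw [dilog]
  congr 1
  refine intervalIntegral.integral_congr_ae ?_
  have h0 : ∀ᵐ t : ℝ, t ≠ 0 := by simp [ae_iff]
  filter_upwards [h0] with t ht _
  rw [dslope_of_ne _ ht, slope_def_field]
  simp

theorem hasDerivAt_dilog {x : ℝ} (hx : x < 1) :
    HasDerivAt dilog (-dslope (fun s => Real.log (1 - s)) 0 x) x := by
  rw [show dilog = fun x => -∫ t in (0 : ℝ)..x, dslope (fun s => Real.log (1 - s)) 0 t from
    funext dilog_eq_integral_dslope]
  have hcont : ContinuousOn (dslope (fun s => Real.log (1 - s)) 0) (Iio 1) := fun t ht =>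
    (contDiffAt_log_one_sub_div ht).continuousAt.continuousWithinAt
  refine (intervalIntegral.integral_hasDerivAt_right ?_ ?_ ?_).neg
  · refine (hcont.mono fun t ht => ?_).intervalIntegrable
    exact lt_of_le_of_lt ht.2 (max_lt one_pos hx)
  · exact hcont.stronglyMeasurableAtFilter isOpen_Iio x hx
  · exact (contDiffAt_log_one_sub_div hx).continuousAt

theorem contDiffOn_dilog : ContDiffOn ℝ ∞ dilog (Iio 1) := by
  rw [contDiffOn_infty_iff_deriv_of_isOpen isOpen_Iio]
  refine ⟨fun x hx => (hasDerivAt_dilog hx).differentiableAt.differentiableWithinAt, ?_⟩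
  refine ContDiffOn.congr (f := fun x => -dslope (fun s => Real.log (1 - s)) 0 x)
    (fun x hx => (contDiffAt_log_one_sub_div hx).contDiffWithinAt.neg) fun x hx => ?_
  exact (hasDerivAt_dilog hx).deriv

end Dilogarithm

/-! ### The common profile of both curved cases: its differential equation and its integral. -/

section Profile

/-- The common form of the spherical and hyperbolic deflections, in the variable
`q = cos² (r / 2)` or `q = cosh² (r / 2)`. -/
noncomputable def logProfile (q₀ q : ℝ) : ℝ :=
  Real.log q ^ 2 / 2 - Real.log q₀ ^ 2 / 2 + dilog (1 - 1 / q) - dilog (1 - 1 / q₀)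
    + q₀ / (1 - q₀) * Real.log q₀ * (Real.log q - Real.log q₀)

theorem contDiffOn_logProfile (q₀ : ℝ) : ContDiffOn ℝ ∞ (logProfile q₀) (Ioi 0) := by
  have hlog : ContDiffOn ℝ ∞ Real.log (Ioi 0) :=
    Real.contDiffOn_log.mono fun x (hx : 0 < x) => hx.ne'
  have hdil : ContDiffOn ℝ ∞ (fun q : ℝ => dilog (1 - 1 / q)) (Ioi 0) := by
    refine contDiffOn_dilog.comp (contDiffOn_const.sub
      (contDiffOn_const.div contDiffOn_id fun x (hx : 0 < x) => hx.ne')) fun x (hx : 0 < x) => ?_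
    have : 0 < 1 / x := by positivity
    simp only [mem_Iio]
    linarith
  unfold logProfile
  exact (((((hlog.pow 2).div_const 2).sub contDiffOn_const).add hdil).sub contDiffOn_const).add
    (contDiffOn_const.mul (hlog.sub contDiffOn_const))

theorem logProfile_self (q₀ : ℝ) : logProfile q₀ q₀ = 0 := by
  simp [logProfile]

/-- The derivative of `logProfile q₀`, multiplied by `q (q - 1)`. -/
theorem deriv_logProfile_mul (q₀ : ℝ) {q : ℝ} (hq : 0 < q) :
    q * (1 - q) * deriv (logProfile q₀) q
      = -(q * Real.log q) + q₀ / (1 - q₀) * Real.log q₀ * (1 - q) := by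
  have hx : 1 - 1 / q < 1 := by
    have : 0 < 1 / q := by positivity
    linarith
  have h1 : HasDerivAt (fun q : ℝ => 1 - 1 / q) (1 / q ^ 2) q := by
    have := (hasDerivAt_inv hq.ne').const_sub 1
    simp only [one_div]
    exact this.congr_deriv (by simp)
  have h2 := (hasDerivAt_dilog hx).comp q h1
  have hlog := Real.hasDerivAt_log hq.ne'
  have h3 := (((((hlog.pow 2).div_const 2).sub_const (Real.log q₀ ^ 2 / 2)).add h2).sub_const
    (dilog (1 - 1 / q₀))).add ((hlog.sub_const (Real.log q₀)).const_mul
      (q₀ / (1 - q₀) * Real.log q₀))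
  have h4 : deriv (logProfile q₀) q = _ := h3.deriv
  rw [h4]
  -- At q = 1, the centre of the disk, both sides vanish. Elsewhere log(1 - x) = -log q for x = 1 -
  -- 1/q, so the dilogarithm contributes only elementary terms.
  rcases eq_or_ne q 1 with rfl | h
  · simp
  · have hne : 1 - 1 / q ≠ 0 := by
      rw [sub_ne_zero, ne_comm, ne_eq, div_eq_one_iff_eq hq.ne']
      exact fun h' => h h'.symm
    rw [dslope_of_ne _ hne, slope_def_field]
    have e : Real.log (1 - (1 - 1 / q)) = -Real.log q := by
      rw [sub_sub_cancel, one_div, Real.log_inv]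
    have h1q : q - 1 ≠ 0 := sub_ne_zero.2 h
    simp only [e, sub_zero, Real.log_one]
    rw [show 1 - 1 / q = (q - 1) / q by field_simp]
    field_simp
    ring

/-- The coefficient q₀ log q₀ / (1 - q₀) in the profile is chosen exactly for this: it imposes the
second clamped condition. -/
theorem deriv_logProfile_self {q₀ : ℝ} (h0 : 0 < q₀) (h1 : q₀ ≠ 1) :
    deriv (logProfile q₀) q₀ = 0 := by
  have h := deriv_logProfile_mul q₀ h0
  have h1' : 1 - q₀ ≠ 0 := sub_ne_zero.2 h1.symm
  rw [show -(q₀ * Real.log q₀) + q₀ / (1 - q₀) * Real.log q₀ * (1 - q₀) = 0 by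
    field_simp; ring] at h
  exact (mul_eq_zero.1 h).resolve_left (mul_ne_zero h0.ne' h1')

/-- The left side is the derivative of q(1 - q)P', where P is the profile, so it comes from
differentiating `deriv_logProfile_mul`. -/
theorem logProfile_ode (q₀ : ℝ) {q : ℝ} (hq : 0 < q) :
    q * (1 - q) * deriv (deriv (logProfile q₀)) q + (1 - 2 * q) * deriv (logProfile q₀) q
      = -Real.log q - (1 + q₀ / (1 - q₀) * Real.log q₀) := by
  have hd : DifferentiableAt ℝ (deriv (logProfile q₀)) q :=
    (contDiffAt_infty.1 ((contDiffOn_logProfile q₀).contDiffAt (Ioi_mem_nhds hq))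
      2).differentiableAt_fderiv.clm_apply
        (differentiableAt_const (1 : ℝ))
  have h1 : HasDerivAt (fun q => q * (1 - q) * deriv (logProfile q₀) q)
      ((1 * (1 - q) + q * (-1)) * deriv (logProfile q₀) q
        + q * (1 - q) * deriv (deriv (logProfile q₀)) q) q :=
    ((hasDerivAt_id q).mul ((hasDerivAt_id q).const_sub 1)).mul hd.hasDerivAt
  have h2 : HasDerivAt (fun q => -(q * Real.log q) + q₀ / (1 - q₀) * Real.log q₀ * (1 - q))
      (-(1 * Real.log q + q * q⁻¹) + q₀ / (1 - q₀) * Real.log q₀ * (-1)) q :=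
    ((hasDerivAt_id q).mul (Real.hasDerivAt_log hq.ne')).neg.add
      (((hasDerivAt_id q).const_sub 1).const_mul _)
  have heq : (fun q => q * (1 - q) * deriv (logProfile q₀) q) =ᶠ[𝓝 q]
      fun q => -(q * Real.log q) + q₀ / (1 - q₀) * Real.log q₀ * (1 - q) := by
    filter_upwards [Ioi_mem_nhds hq] with r hr using deriv_logProfile_mul q₀ hr
  have h3 := h1.unique (h2.congr_of_eventuallyEq heq)
  rw [mul_inv_cancel₀ hq.ne'] at h3
  linarith

/-- Integration by parts against q - 1: the boundary terms vanish at 1 and at q₀, and (q - 1)P' is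
elementary by `deriv_logProfile_mul`. No dilogarithm survives. -/
theorem integral_logProfile {q₀ : ℝ} (h0 : 0 < q₀) (h1 : q₀ ≠ 1) :
    ∫ q in (1 : ℝ)..q₀, logProfile q₀ q
      = q₀ - 1 + q₀ / (1 - q₀) * Real.log q₀ ^ 2 := by
  have hpos : ∀ q ∈ uIcc 1 q₀, 0 < q := fun q hq =>
    lt_of_lt_of_le (lt_min one_pos h0) hq.1
  set A := q₀ / (1 - q₀) * Real.log q₀ with hA
  have hder : ∀ q ∈ uIcc 1 q₀, HasDerivAt (fun q => (q - 1) * logProfile q₀ q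
      - (q * Real.log q - q + A * (q - Real.log q))) (logProfile q₀ q) q := fun q hq => by
    have hq0 := hpos q hq
    have hd : DifferentiableAt ℝ (logProfile q₀) q :=
      ((contDiffOn_logProfile q₀).contDiffAt (Ioi_mem_nhds hq0)).differentiableAt (by simp)
    have hlog := Real.hasDerivAt_log hq0.ne'
    have := (((hasDerivAt_id q).sub_const 1).mul hd.hasDerivAt).sub
      ((((hasDerivAt_id q).mul hlog).sub (hasDerivAt_id q)).add
        (((hasDerivAt_id q).sub hlog).const_mul A))
    refine this.congr_deriv ?_
    have h2 := deriv_logProfile_mul q₀ hq0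
    rw [← hA] at h2
    have h3 : (q - 1) * deriv (logProfile q₀) q = Real.log q - A * (1 - q) / q := by
      field_simp
      linarith
    simp only [id]
    rw [h3]
    field_simp
    ring
  rw [intervalIntegral.integral_eq_sub_of_hasDerivAt hder]
  · have h1' : 1 - q₀ ≠ 0 := sub_ne_zero.2 h1.symm
    rw [logProfile_self, Real.log_one, hA]
    field_simp
    ring
  · exact ((contDiffOn_logProfile q₀).continuousOn.mono hpos).intervalIntegrable

/-- A function that is smooth near a compact interval agrees near it with a smooth function. -/
theorem exists_contDiff_eventuallyEq {f : ℝ → ℝ} {U : Set ℝ} (hU : IsOpen U)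
    (hf : ContDiffOn ℝ ∞ f U) {m n : ℝ} (h : Icc m n ⊆ U) :
    ∃ F : ℝ → ℝ, ContDiff ℝ ∞ F ∧ ∀ t ∈ Icc m n, F =ᶠ[𝓝 t] f := by
  obtain ⟨V, hV, hVK, hVU, -⟩ :=
    exists_open_between_and_isCompact_closure (isCompact_Icc (a := m) (b := n)) hU h
  obtain ⟨χ, hχ1, hχ0, -⟩ := exists_contMDiffMap_one_nhds_of_subset_interior (n := ⊤) 𝓘(ℝ, ℝ)
    (isClosed_Icc (a := m) (b := n)) (hVK.trans hV.interior_eq.ge)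
  have hχs : ContDiff ℝ ∞ χ := χ.contMDiff.contDiff
  refine ⟨fun x => χ x * f x, ?_, fun t ht => ?_⟩
  · rw [contDiff_iff_contDiffAt]
    intro x
    by_cases hx : x ∈ U
    · exact hχs.contDiffAt.mul (hf.contDiffAt (hU.mem_nhds hx))
    · have : (fun x => χ x * f x) =ᶠ[𝓝 x] fun _ => 0 := by
        filter_upwards [isClosed_closure.isOpen_compl.mem_nhds fun h => hx (hVU h)] with y hy
        rw [hχ0 y fun h => hy (subset_closure h), zero_mul]
      exact contDiffAt_const.congr_of_eventuallyEq this
  · filter_upwards [eventually_nhdsSet_iff_forall.1 hχ1 t ht] with y hy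
    rw [hy, one_mul]

end Profile

/-! ### Geodesic disks in curvature ±1. -/

section RadialLog

variable {M : Type} [TopologicalSpace M] [MeasurableSpace M] [OpensMeasurableSpace M]
  {G : Geometry M} [IsFiniteMeasureOnCompacts G.vol] {q : M → ℝ}

/-- The clamped plate problem in a geodesic disk of the surface of constant curvature `ε = ±1`. -/
theorem Geometry.IsRadial.deflection_log {ε : ℝ} (hε : ε = 1 ∨ ε = -1) (hG : G.IsRegular)
    (hq : G.IsRadial q (fun t => t * (1 - ε * t)) (fun t => 1 - 2 * ε * t))
    (hq0 : ∀ x, 0 ≤ q x) {t₀ : ℝ} (ht₀ : 0 < t₀) (ht₁ : ε * t₀ < 1) :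
    (∃ u, IsDeflection G {x | q x < t₀} u) ∧ ∀ u, IsDeflection G {x | q x < t₀} u →
      (∀ᵐ x ∂G.vol.restrict {x | q x < t₀}, u x = logProfile (1 - ε * t₀) (1 - ε * q x)) ∧
      IntegrableOn u {x | q x < t₀} G.vol ∧
      ∫ x in {x | q x < t₀}, u x ∂G.vol
        = ∫ x in {x | q x < t₀}, logProfile (1 - ε * t₀) (1 - ε * q x) ∂G.vol := by
  set q₀ := 1 - ε * t₀ with hq₀
  have hq₀0 : 0 < q₀ := by linarith
  have hε2 : ε * ε = 1 := by rcases hε with rfl | rfl <;> norm_num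
  have hε0 : ε ≠ 0 := fun h => by simp [h] at hε2
  have hq₀1 : q₀ ≠ 1 := fun h => by
    have : ε * t₀ = 0 := by linarith
    exact (mul_ne_zero hε0 ht₀.ne') this
  set U : Set ℝ := {t | 0 < 1 - ε * t}
  have hU : IsOpen U := isOpen_lt continuous_const (by fun_prop)
  have hIU : Icc 0 t₀ ⊆ U := fun t ht => by
    change 0 < 1 - ε * t
    rcases hε with rfl | rfl <;> linarith [ht.1, ht.2]
  have hlin : ∀ t, HasDerivAt (fun t => 1 - ε * t) (-ε) t := fun t => by
    simpa using ((hasDerivAt_id t).const_mul ε).const_sub 1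
  have hlinc : ContDiff ℝ ∞ fun t => 1 - ε * t := by fun_prop
  -- `Geometry.IsRadial` accepts only functions smooth on all of ℝ, while `contDiffOn_logProfile`
  -- covers only 1 - εt > 0. Only the germs along [0, t₀] matter, so a globally smooth replacement
  -- suffices.
  obtain ⟨H, hH, hHe⟩ := exists_contDiff_eventuallyEq hU (f := fun t => logProfile q₀ (1 - ε * t))
    ((contDiffOn_logProfile q₀).comp hlinc.contDiffOn fun t ht => ht) hIU
  -- This is the constant on the right of `logProfile_ode`, so that `w` is the Laplacian of the
  -- profile. Any constant would give Δw = 1, because t(1 - εt)w' = t.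
  set c := 1 + q₀ / (1 - q₀) * Real.log q₀
  obtain ⟨w, hw, hwe⟩ := exists_contDiff_eventuallyEq hU
    (f := fun t => ε * (-Real.log (1 - ε * t) - c))
    (contDiffOn_const.mul (((Real.contDiffOn_log.comp hlinc.contDiffOn
      fun t (ht : 0 < 1 - ε * t) => ht.ne').neg).sub contDiffOn_const)) hIU
  have hsm : ∀ t ∈ U, ContDiffAt ℝ ∞ (logProfile q₀) (1 - ε * t) := fun t ht =>
    (contDiffOn_logProfile q₀).contDiffAt (Ioi_mem_nhds ht)
  have dP : ∀ t ∈ U, HasDerivAt (fun t => logProfile q₀ (1 - ε * t))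
      (-ε * deriv (logProfile q₀) (1 - ε * t)) t := fun t ht => by
    have := (((hsm t ht).differentiableAt (by simp)).hasDerivAt).comp t (hlin t)
    exact this.congr_deriv (mul_comm _ _)
  have ddP : ∀ t ∈ U, HasDerivAt (fun t => -ε * deriv (logProfile q₀) (1 - ε * t))
      (deriv (deriv (logProfile q₀)) (1 - ε * t)) t := fun t ht => by
    have hd : DifferentiableAt ℝ (deriv (logProfile q₀)) (1 - ε * t) :=
      (contDiffAt_infty.1 (hsm t ht) 2).differentiableAt_fderiv.clm_apply
        (differentiableAt_const (1 : ℝ))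
    have := (hd.hasDerivAt.comp t (hlin t)).const_mul (-ε)
    refine this.congr_deriv ?_
    linear_combination deriv (deriv (logProfile q₀)) (1 - ε * t) * hε2
  have dH : ∀ t ∈ Icc 0 t₀, deriv H t = -ε * deriv (logProfile q₀) (1 - ε * t) := fun t ht => by
    rw [(hHe t ht).deriv_eq, (dP t (hIU ht)).deriv]
  have ddH : ∀ t ∈ Icc 0 t₀, deriv (deriv H) t = deriv (deriv (logProfile q₀)) (1 - ε * t) :=
    fun t ht => by
      have : deriv (fun t => logProfile q₀ (1 - ε * t)) =ᶠ[𝓝 t]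
          fun t => -ε * deriv (logProfile q₀) (1 - ε * t) := by
        filter_upwards [hU.mem_nhds (hIU ht)] with s hs using (dP s hs).deriv
      rw [(hHe t ht).deriv.deriv_eq, this.deriv_eq, (ddP t (hIU ht)).deriv]
  have dL : ∀ t ∈ U, HasDerivAt (fun t => ε * (-Real.log (1 - ε * t) - c)) (1 - ε * t)⁻¹ t :=
    fun t ht => by
      have := ((((Real.hasDerivAt_log (ne_of_gt ht)).comp t (hlin t)).neg.sub_const c).const_mul ε)
      refine this.congr_deriv ?_
      linear_combination (1 - ε * t)⁻¹ * hε2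
  have ddL : ∀ t ∈ U, HasDerivAt (fun t => (1 - ε * t)⁻¹) (ε * ((1 - ε * t) ^ 2)⁻¹) t :=
    fun t ht => by
      have := (hasDerivAt_inv (ne_of_gt ht)).comp t (hlin t)
      exact this.congr_deriv (by ring)
  have dw : ∀ t ∈ Icc 0 t₀, deriv w t = (1 - ε * t)⁻¹ := fun t ht => by
    rw [(hwe t ht).deriv_eq, (dL t (hIU ht)).deriv]
  have ddw : ∀ t ∈ Icc 0 t₀, deriv (deriv w) t = ε * ((1 - ε * t) ^ 2)⁻¹ := fun t ht => by
    have : deriv (fun t => ε * (-Real.log (1 - ε * t) - c)) =ᶠ[𝓝 t] fun t => (1 - ε * t)⁻¹ := by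
      filter_upwards [hU.mem_nhds (hIU ht)] with s hs using (dL s hs).deriv
    rw [(hwe t ht).deriv.deriv_eq, this.deriv_eq, (ddL t (hIU ht)).deriv]
  have ht₀m : t₀ ∈ Icc 0 t₀ := ⟨ht₀.le, le_rfl⟩
  have main := hq.deflection hG (t₀ := t₀) hH hw
    (by rw [(hHe t₀ ht₀m).self_of_nhds]; exact logProfile_self q₀)
    (by rw [dH t₀ ht₀m, ← hq₀, deriv_logProfile_self hq₀0 hq₀1, mul_zero])
    (fun x hx => by
      have hm : q x ∈ Icc 0 t₀ := ⟨hq0 x, hx.le⟩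
      have h1 := logProfile_ode q₀ (hIU hm)
      rw [dH _ hm, ddH _ hm, (hwe _ hm).self_of_nhds]
      simp only [c]
      linear_combination ε * h1
        - q x * (1 - ε * q x) * deriv (deriv (logProfile q₀)) (1 - ε * q x) * hε2)
    (fun x hx => by
      have hm : q x ∈ Icc 0 t₀ := ⟨hq0 x, hx.le⟩
      have hne : 1 - ε * q x ≠ 0 := ne_of_gt (hIU hm)
      have h2 := inv_mul_cancel₀ hne
      rw [dw _ hm, ddw _ hm, ← inv_pow]
      linear_combination (1 + q x * ε * (1 - ε * q x)⁻¹) * h2)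
  have hae : ∀ᵐ x ∂G.vol.restrict {x | q x < t₀}, H (q x) = logProfile q₀ (1 - ε * q x) := by
    filter_upwards [ae_restrict_mem (isOpen_lt hq.continuous continuous_const).measurableSet]
      with x hx
    exact (hHe _ ⟨hq0 x, le_of_lt hx⟩).self_of_nhds
  refine ⟨main.1, fun u hu => ?_⟩
  obtain ⟨h1, h2, h3⟩ := main.2 u hu
  refine ⟨?_, h2, h3.trans (integral_congr_ae hae)⟩
  filter_upwards [h1, hae] with x h1 h2 using h1.trans h2

end RadialLog

/-! ### The half-plane model: smoothness, volume and Green's identity. -/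

section HalfPlane

open UpperHalfPlane

instance : IsFiniteMeasureOnCompacts hyperbolicPlane.vol :=
  inferInstanceAs (IsFiniteMeasureOnCompacts (volume : Measure UpperHalfPlane))

theorem halfPlaneExt_coe (f : UpperHalfPlane → ℝ) (z : UpperHalfPlane) :
    halfPlaneExt f (z : ℂ) = f z := by
  rw [halfPlaneExt, ofComplex_apply]

theorem halfPlaneExt_eventuallyEq {f g : UpperHalfPlane → ℝ} {z : UpperHalfPlane}
    (h : f =ᶠ[𝓝 z] g) : halfPlaneExt f =ᶠ[𝓝 (z : ℂ)] halfPlaneExt g := by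
  rw [← isOpenEmbedding_coe.map_nhds_eq, EventuallyEq, eventually_map]
  filter_upwards [h] with w hw
  rw [halfPlaneExt_coe, halfPlaneExt_coe, hw]

theorem halfPlaneExt_eventuallyEq_of_coe {f : UpperHalfPlane → ℝ} {g : ℂ → ℝ}
    (h : ∀ w : UpperHalfPlane, f w = g w) (z : UpperHalfPlane) :
    halfPlaneExt f =ᶠ[𝓝 (z : ℂ)] g := by
  rw [← isOpenEmbedding_coe.map_nhds_eq, EventuallyEq, eventually_map]
  exact Eventually.of_forall fun w => by rw [halfPlaneExt_coe, h]

theorem contDiffOn_halfPlaneExt {f : UpperHalfPlane → ℝ} (hf : hyperbolicPlane.Smooth f) :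
    ContDiffOn ℝ ∞ (halfPlaneExt f) {z | 0 < z.im} := fun z hz => by
  have h1 : ContMDiffAt 𝓘(ℝ, ℂ) 𝓘(ℝ, ℂ) ∞ ofComplex z := by
    rw [_root_.contMDiffAt_iff]
    constructor
    · rw [ContinuousAt, nhds_induced, tendsto_comap_iff]
      refine Tendsto.congr' (eventuallyEq_coe_comp_ofComplex hz).symm ?_
      simpa [ofComplex_apply_of_im_pos hz] using! tendsto_id
    · simpa using! contDiffAt_id.congr_of_eventuallyEq (eventuallyEq_coe_comp_ofComplex hz)
  have h2 : ContMDiff 𝓘(ℝ, ℂ) 𝓘(ℝ, ℝ) ∞ f := hf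
  exact ((h2 (ofComplex z)).comp z h1).contDiffAt.contDiffWithinAt

theorem smooth_of_contDiffOn {f : UpperHalfPlane → ℝ} {g : ℂ → ℝ}
    (hg : ContDiffOn ℝ ∞ g {z | 0 < z.im}) (h : ∀ w : UpperHalfPlane, f w = g w) :
    hyperbolicPlane.Smooth f := by
  change ContMDiff 𝓘(ℝ, ℂ) 𝓘(ℝ, ℝ) ∞ f
  rw [show f = g ∘ ((↑) : UpperHalfPlane → ℂ) from funext h]
  intro z
  have h1 : ContMDiffAt 𝓘(ℝ, ℂ) 𝓘(ℝ, ℂ) ∞ ((↑) : UpperHalfPlane → ℂ) z := contMDiffAt_extChartAt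
  exact (hg.contDiffAt (isOpen_upperHalfPlaneSet.mem_nhds z.im_pos)).contMDiffAt.comp z h1

theorem integral_hyperbolicPlane (f : ℂ → ℝ) :
    ∫ z : UpperHalfPlane, f z ∂hyperbolicPlane.vol =
      ∫ z in {z : ℂ | 0 < z.im}, (z.im ^ 2)⁻¹ * f z := by
  change ∫ z : UpperHalfPlane, f z = _
  have hm : Measurable fun z : UpperHalfPlane => (1 / NNReal.mk z.im z.im_pos.le) ^ 2 := by
    refine Continuous.measurable (.pow (.div₀ continuous_const ?_ ?_) _)
    · exact UpperHalfPlane.continuous_im.subtype_mk _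
    · exact fun x ↦ NNReal.ne_iff.mp x.im_ne_zero
  rw [UpperHalfPlane.volume_def, integral_withDensity_eq_integral_smul hm]
  have hr : range ((↑) : UpperHalfPlane → ℂ) = {z : ℂ | 0 < z.im} := by
    rw [UpperHalfPlane.range_coe]
  rw [← hr, ← measurableEmbedding_coe.map_comap, measurableEmbedding_coe.integral_map]
  refine integral_congr_ae (Eventually.of_forall fun z => ?_)
  simp [NNReal.smul_def]

theorem continuous_comp_coe {X : Type*} [TopologicalSpace X] {g : ℂ → X}
    (hg : ContinuousOn g {z | 0 < z.im}) : Continuous fun z : UpperHalfPlane => g z :=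
  hg.comp_continuous UpperHalfPlane.continuous_coe fun z => z.im_pos

theorem isOpen_im_pos : IsOpen {z : ℂ | 0 < z.im} :=
  isOpen_lt continuous_const Complex.continuous_im

/-- Conformal invariance in dimension two: the factor y² of the Laplacian cancels the density y⁻² of
the volume, leaving Green's identity in ℂ on the open half-plane. -/
theorem hyperbolicPlane_green {f φ : UpperHalfPlane → ℝ} (hf : hyperbolicPlane.Smooth f)
    (hφ : hyperbolicPlane.Smooth φ) (hc : HasCompactSupport φ) :
    ∫ z, f z * hyperbolicPlane.lap φ z ∂hyperbolicPlane.vol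
      = ∫ z, hyperbolicPlane.lap f z * φ z ∂hyperbolicPlane.vol := by
  set U := {z : ℂ | 0 < z.im}
  have hU : IsOpen U := isOpen_im_pos
  set K : Set ℂ := (↑) '' tsupport φ
  have hK : IsCompact K := hc.isCompact.image UpperHalfPlane.continuous_coe
  have hKU : K ⊆ U := by
    rintro _ ⟨z, -, rfl⟩
    exact z.im_pos
  have hout : ∀ z ∈ U \ K, halfPlaneExt φ =ᶠ[𝓝 z] 0 := fun z hz => by
    lift z to UpperHalfPlane using hz.1
    refine (halfPlaneExt_eventuallyEq (notMem_tsupport_iff_eventuallyEq.1 fun h =>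
      hz.2 ⟨z, h, rfl⟩)).trans ?_
    exact Eventually.of_forall fun w => rfl
  -- The values of `halfPlaneExt φ` off the half-plane are irrelevant. Replacing them by zero gives
  -- a smooth function on ℂ, since the support of φ is compact in the open half-plane.
  set φ₀ : ℂ → ℝ := U.indicator (halfPlaneExt φ)
  have hin : ∀ z ∈ U, φ₀ =ᶠ[𝓝 z] halfPlaneExt φ := fun z hz => by
    filter_upwards [hU.mem_nhds hz] with w hw
    simp [φ₀, hw]
  have hz0 : ∀ z ∉ K, φ₀ z = 0 := fun z hz => by
    by_cases h : z ∈ U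
    · rw [(hin z h).self_of_nhds, (hout z ⟨h, hz⟩).self_of_nhds]
      rfl
    · simp [φ₀, h]
  have hs : tsupport φ₀ ⊆ K := closure_minimal (fun z hz => by
    by_contra h
    exact hz (hz0 z h)) hK.isClosed
  have hsm : ContDiff ℝ ∞ φ₀ := by
    rw [contDiff_iff_contDiffAt]
    intro z
    by_cases hz : z ∈ K
    · exact ((contDiffOn_halfPlaneExt hφ).contDiffAt (hU.mem_nhds (hKU hz))).congr_of_eventuallyEq
        (hin z (hKU hz))
    · refine (contDiffAt_const (c := (0 : ℝ))).congr_of_eventuallyEq ?_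
      filter_upwards [hK.isClosed.isOpen_compl.mem_nhds hz] with w hw using hz0 w hw
  have hcs : HasCompactSupport φ₀ := hK.of_isClosed_subset (isClosed_tsupport _) hs
  have key := integral_mul_laplacian_of_contDiffOn hU (contDiffOn_halfPlaneExt hf) hsm hcs
    (hs.trans hKU)
  have e1 : ∫ z, f z * hyperbolicPlane.lap φ z ∂hyperbolicPlane.vol
      = ∫ z, halfPlaneExt f z * Laplacian.laplacian φ₀ z := by
    have h := integral_hyperbolicPlane fun z =>
      halfPlaneExt f z * (z.im ^ 2 * Laplacian.laplacian (halfPlaneExt φ) z)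
    simp only [halfPlaneExt_coe] at h
    refine h.trans ?_
    rw [← setIntegral_eq_integral_of_forall_compl_eq_zero (s := U)
      (f := fun z => halfPlaneExt f z * Laplacian.laplacian φ₀ z)]
    · refine setIntegral_congr_fun hU.measurableSet fun z hz => ?_
      have hne : z.im ≠ 0 := ne_of_gt hz
      simp only [laplacian_congr_of_eventuallyEq (hin z hz)]
      field_simp
    · intro z hz
      rw [laplacian_eq_zero (notMem_tsupport_iff_eventuallyEq.1 fun h => hz (hKU (hs h))), mul_zero]
  have e2 : ∫ z, hyperbolicPlane.lap f z * φ z ∂hyperbolicPlane.vol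
      = ∫ z, Laplacian.laplacian (halfPlaneExt f) z * φ₀ z := by
    have h := integral_hyperbolicPlane fun z =>
      z.im ^ 2 * Laplacian.laplacian (halfPlaneExt f) z * halfPlaneExt φ z
    simp only [halfPlaneExt_coe] at h
    refine h.trans ?_
    rw [← setIntegral_eq_integral_of_forall_compl_eq_zero (s := U)
      (f := fun z => Laplacian.laplacian (halfPlaneExt f) z * φ₀ z)]
    · refine setIntegral_congr_fun hU.measurableSet fun z hz => ?_
      have hne : z.im ≠ 0 := ne_of_gt hz
      simp only [(hin z hz).self_of_nhds]
      field_simp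
    · intro z hz
      rw [hz0 z fun h => hz (hKU h), mul_zero]
  rw [e1, e2, key]

theorem laplacian_complex (f : ℂ → ℝ) (z : ℂ) : Laplacian.laplacian f z =
    fderiv ℝ (fderiv ℝ f) z 1 1 + fderiv ℝ (fderiv ℝ f) z Complex.I Complex.I := by
  rw [laplacian_eq_sum_fderiv Complex.orthonormalBasisOneI]
  simp

theorem contDiffAt_halfPlaneExt {f : UpperHalfPlane → ℝ} (hf : hyperbolicPlane.Smooth f)
    (z : UpperHalfPlane) : ContDiffAt ℝ 2 (halfPlaneExt f) z :=
  contDiffAt_infty.1 ((contDiffOn_halfPlaneExt hf).contDiffAt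
    (isOpen_im_pos.mem_nhds z.im_pos)) 2

theorem hyperbolicPlane_isRegular : hyperbolicPlane.IsRegular where
  smooth_sub hf hg := ContMDiff.sub hf hg
  smooth_sq hf := ContMDiff.mul hf hf
  continuous {f} hf := by
    simpa only [halfPlaneExt_coe] using
      continuous_comp_coe (contDiffOn_halfPlaneExt hf).continuousOn
  continuous_lap hf := (UpperHalfPlane.continuous_im.pow 2).mul
    (continuous_comp_coe ((contDiffOn_halfPlaneExt hf).continuousOn_laplacian isOpen_im_pos))
  continuous_gradSq hf := by
    have := continuous_comp_coe
      ((contDiffOn_halfPlaneExt hf).continuousOn_fderiv_of_isOpen isOpen_im_pos (by simp))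
    have := UpperHalfPlane.continuous_im
    simp only [hyperbolicPlane]
    fun_prop
  continuous_hessSq hf := by
    have h1 := continuous_comp_coe
      ((contDiffOn_halfPlaneExt hf).continuousOn_fderiv_of_isOpen isOpen_im_pos (by simp))
    have h2 := continuous_comp_coe
      ((contDiffOn_halfPlaneExt hf).continuousOn_fderiv_fderiv isOpen_im_pos)
    have h3 := UpperHalfPlane.continuous_im
    have h4 : ∀ z : UpperHalfPlane, z.im ≠ 0 := fun z => z.im_ne_zero
    simp only [hyperbolicPlane]
    fun_prop (disch := exact h4)
  lap_eq_zero h := by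
    simp [hyperbolicPlane, laplacian_eq_zero (halfPlaneExt_eventuallyEq h)]
  gradSq_eq_zero h := by
    simp [hyperbolicPlane, fderiv_eq_zero (halfPlaneExt_eventuallyEq h)]
  hessSq_eq_zero h := by
    simp [hyperbolicPlane, fderiv_eq_zero (halfPlaneExt_eventuallyEq h),
      fderiv_fderiv_eq_zero (halfPlaneExt_eventuallyEq h)]
  gradSq_nonneg f z := by
    simp only [hyperbolicPlane]
    positivity
  hessSq_nonneg f z := by
    simp only [hyperbolicPlane]
    positivity
  lap_sub hf hg := funext fun z => by
    have h := (contDiffAt_halfPlaneExt hf z).laplacian_sub (contDiffAt_halfPlaneExt hg z)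
    simp only [hyperbolicPlane, Pi.sub_apply, ← mul_sub]
    rw [← h]
    rfl
  lap_sq_ge {f} hf z := by
    have h := mul_le_mul_of_nonneg_left
      (two_mul_laplacian_le_laplacian_sq (contDiffAt_halfPlaneExt hf z)) (sq_nonneg z.im)
    rw [halfPlaneExt_coe] at h
    refine le_trans (le_of_eq ?_) h
    simp only [hyperbolicPlane]
    ring
  -- The Christoffel terms ±f_y/y cancel in the trace, so f_xx + f_yy is the sum of the two diagonal
  -- covariant entries.
  lap_bound := ⟨2, by norm_num, fun {f} _ z => by
    simp only [hyperbolicPlane, laplacian_complex]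
    set a := fderiv ℝ (fderiv ℝ (halfPlaneExt f)) z 1 1
    set b := fderiv ℝ (fderiv ℝ (halfPlaneExt f)) z Complex.I Complex.I
    set c := fderiv ℝ (halfPlaneExt f) z Complex.I / z.im
    set d := fderiv ℝ (fderiv ℝ (halfPlaneExt f)) z 1 Complex.I
      + fderiv ℝ (halfPlaneExt f) z 1 / z.im
    have : (a + b) ^ 2 ≤ 2 * ((a - c) ^ 2 + 2 * d ^ 2 + (b + c) ^ 2) := by
      nlinarith [sq_nonneg (a - c - (b + c)), sq_nonneg d]
    calc (z.im ^ 2 * (a + b)) ^ 2 = z.im ^ 4 * (a + b) ^ 2 := by ring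
      _ ≤ z.im ^ 4 * (2 * ((a - c) ^ 2 + 2 * d ^ 2 + (b + c) ^ 2)) := by gcongr
      _ = _ := by ring⟩
  green hf hφ hc := hyperbolicPlane_green hf hφ hc
  ae_zero hΩ hw h := by
    have : IsManifold 𝓘(ℝ, ℂ) ∞ UpperHalfPlane :=
      UpperHalfPlane.isOpenEmbedding_coe.isManifold_singleton
    exact ae_zero_of_forall_isTest 𝓘(ℝ, ℂ) (fun _ hf => hf) hΩ hw h

end HalfPlane

/-! ### The function sinh²(d/2) on the half-plane as a radial variable. -/

section HalfPlaneRadial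

open UpperHalfPlane

/-- `sinh² (d(p, z) / 2)` as a function on the half-plane in `ℂ`. -/
noncomputable def halfPlaneRadial (p : UpperHalfPlane) : ℂ → ℝ :=
  (fun z => ‖z - (p : ℂ)‖ ^ 2) * ((fun t : ℝ => (4 * p.im)⁻¹ * t⁻¹) ∘ Complex.im)

theorem halfPlaneRadial_apply (p : UpperHalfPlane) (z : ℂ) :
    halfPlaneRadial p z = ‖z - p‖ ^ 2 * ((4 * p.im)⁻¹ * z.im⁻¹) := rfl

theorem halfPlaneRadial_eq_sinh_sq (p z : UpperHalfPlane) :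
    halfPlaneRadial p z = Real.sinh (dist p z / 2) ^ 2 := by
  rw [UpperHalfPlane.sinh_half_dist, div_pow, mul_pow, Real.sq_sqrt (by positivity),
    halfPlaneRadial_apply, dist_comm, dist_eq_norm]
  have h1 := p.im_ne_zero
  have h2 := z.im_ne_zero
  change _ * ((4 * p.im)⁻¹ * z.im⁻¹) = _
  field_simp
  norm_num

theorem contDiffOn_halfPlaneRadial (p : UpperHalfPlane) :
    ContDiffOn ℝ ∞ (halfPlaneRadial p) {z | 0 < z.im} := by
  have h1 : ContDiff ℝ ∞ fun z : ℂ => ‖z - p‖ ^ 2 := (contDiff_id.sub contDiff_const).norm_sq ℝ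
  have h2 : ContDiffOn ℝ ∞ (fun z : ℂ => (4 * p.im)⁻¹ * z.im⁻¹) {z | 0 < z.im} :=
    contDiffOn_const.mul (Complex.imCLM.contDiff.contDiffOn.inv fun z hz => ne_of_gt hz)
  exact h1.contDiffOn.mul h2

theorem hasFDerivAt_halfPlaneRadial (p : UpperHalfPlane) {z : ℂ} (hz : 0 < z.im) :
    HasFDerivAt (halfPlaneRadial p) (‖z - p‖ ^ 2 • (-((4 * p.im)⁻¹ * (z.im ^ 2)⁻¹)) • Complex.imCLM
      + ((4 * p.im)⁻¹ * z.im⁻¹) • (2 : ℝ) • innerSL ℝ (z - p)) z := by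
  have h1 := hasFDerivAt_norm_sub_sq (p : ℂ) z
  have h2 : HasDerivAt (fun t : ℝ => (4 * p.im)⁻¹ * t⁻¹) (-((4 * p.im)⁻¹ * (z.im ^ 2)⁻¹)) z.im :=
    ((hasDerivAt_inv hz.ne').const_mul _).congr_deriv (by ring)
  exact h1.mul (h2.comp_hasFDerivAt z Complex.imCLM.hasFDerivAt)

theorem norm_fderiv_halfPlaneRadial_sq (p : UpperHalfPlane) {z : ℂ} (hz : 0 < z.im) :
    z.im ^ 2 * ‖fderiv ℝ (halfPlaneRadial p) z‖ ^ 2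
      = halfPlaneRadial p z * (1 + halfPlaneRadial p z) := by
  rw [norm_sq_eq_sum_apply_sq Complex.orthonormalBasisOneI,
    (hasFDerivAt_halfPlaneRadial p hz).fderiv, halfPlaneRadial_apply]
  have h1 := p.im_ne_zero
  have h2 := hz.ne'
  simp [Complex.inner, ← Complex.normSq_eq_norm_sq, Complex.normSq_apply]
  field_simp
  ring

theorem laplacian_halfPlaneRadial (p : UpperHalfPlane) {z : ℂ} (hz : 0 < z.im) :
    z.im ^ 2 * Laplacian.laplacian (halfPlaneRadial p) z = 1 + 2 * halfPlaneRadial p z := by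
  have h1 := p.im_ne_zero
  have h2 := hz.ne'
  have hd : ∀ t : ℝ, t ≠ 0 →
      HasDerivAt (fun t : ℝ => (4 * p.im)⁻¹ * t⁻¹) (-((4 * p.im)⁻¹ * (t ^ 2)⁻¹)) t := fun t ht =>
    ((hasDerivAt_inv ht).const_mul _).congr_deriv (by ring)
  have hdd : HasDerivAt (fun t : ℝ => -((4 * p.im)⁻¹ * (t ^ 2)⁻¹))
      ((4 * p.im)⁻¹ * (2 * (z.im ^ 3)⁻¹)) z.im := by
    refine (((hasDerivAt_pow 2 z.im).fun_inv (pow_ne_zero 2 h2)).const_mul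
      (4 * p.im)⁻¹).neg.congr_deriv ?_
    field_simp
    ring
  have e1 : deriv (fun t : ℝ => (4 * p.im)⁻¹ * t⁻¹) =ᶠ[𝓝 z.im]
      fun t => -((4 * p.im)⁻¹ * (t ^ 2)⁻¹) := by
    filter_upwards [isOpen_ne.mem_nhds h2] with t ht using (hd t ht).deriv
  have c1 : ContDiffAt ℝ 2 (fun t : ℝ => (4 * p.im)⁻¹ * t⁻¹) z.im :=
    contDiffAt_const.mul (contDiffAt_id.inv h2)
  have c2 : ContDiffAt ℝ 2 Complex.im z := Complex.imCLM.contDiff.contDiffAt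
  have him : fderiv ℝ Complex.im = fun _ => Complex.imCLM :=
    funext fun z => Complex.imCLM.hasFDerivAt.fderiv
  have hlim : Laplacian.laplacian Complex.im z = 0 := by
    rw [laplacian_complex, him]
    simp
  have c3 : ContDiffAt ℝ 2 (fun z : ℂ => ‖z - p‖ ^ 2) z :=
    ((contDiff_id.sub contDiff_const).norm_sq ℝ).contDiffAt
  have f3 : fderiv ℝ ((fun t : ℝ => (4 * p.im)⁻¹ * t⁻¹) ∘ Complex.im) z
      = (-((4 * p.im)⁻¹ * (z.im ^ 2)⁻¹)) • Complex.imCLM :=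
    ((hd _ h2).comp_hasFDerivAt z Complex.imCLM.hasFDerivAt).fderiv
  rw [halfPlaneRadial, laplacian_mul Complex.orthonormalBasisOneI c3 (c1.comp z c2),
    laplacian_comp c1 c2, hlim, e1.deriv_eq, hdd.deriv, f3, laplacian_norm_sub_sq,
    (hasFDerivAt_norm_sub_sq _ _).fderiv, him]
  simp [Complex.inner, ← Complex.normSq_eq_norm_sq, Complex.normSq_apply]
  field_simp
  ring

theorem hyperbolicPlane_isRadial (p : UpperHalfPlane) :
    hyperbolicPlane.IsRadial (fun z => halfPlaneRadial p z) (fun t => t * (1 - -1 * t))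
      (fun t => 1 - 2 * -1 * t) := by
  have hq := contDiffOn_halfPlaneRadial p
  have hcont := continuous_comp_coe hq.continuousOn
  have hqz : ∀ z : UpperHalfPlane, ContDiffAt ℝ 2 (halfPlaneRadial p) z := fun z =>
    contDiffAt_infty.1 (hq.contDiffAt (isOpen_im_pos.mem_nhds z.im_pos)) 2
  have hext : ∀ (F : ℝ → ℝ) (z : UpperHalfPlane),
      halfPlaneExt (F ∘ fun z => halfPlaneRadial p z) =ᶠ[𝓝 (z : ℂ)] F ∘ halfPlaneRadial p :=
    fun F z => halfPlaneExt_eventuallyEq_of_coe (g := F ∘ halfPlaneRadial p) (fun w => rfl) z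
  refine ⟨hcont, fun c => ?_, fun hF => ?_, fun {F} hF z => ?_, ?_⟩
  · refine (isCompact_closedBall p (2 * Real.arsinh √c)).of_isClosed_subset
      (isClosed_le hcont continuous_const) fun z (hz : halfPlaneRadial p z ≤ c) => ?_
    rw [halfPlaneRadial_eq_sinh_sq] at hz
    have h1 := Real.le_sqrt_of_sq_le hz
    rw [← Real.sinh_arsinh √c, Real.sinh_le_sinh] at h1
    rw [Metric.mem_closedBall, dist_comm]
    linarith
  · exact smooth_of_contDiffOn (hF.comp_contDiffOn hq) fun w => rfl
  · have h1 := laplacian_comp hF.contDiffAt_two (hqz z)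
    simp only [hyperbolicPlane]
    rw [laplacian_congr_of_eventuallyEq (hext F z), h1]
    have h2 := norm_fderiv_halfPlaneRadial_sq p z.im_pos
    have h3 := laplacian_halfPlaneRadial p z.im_pos
    rw [UpperHalfPlane.coe_im] at h2 h3
    linear_combination deriv (deriv F) (halfPlaneRadial p z) * h2
      + deriv F (halfPlaneRadial p z) * h3
  · have h1 := continuous_comp_coe (hq.continuousOn_fderiv_of_isOpen isOpen_im_pos (by simp))
    have h2 := continuous_comp_coe (hq.continuousOn_fderiv_fderiv isOpen_im_pos)
    have h3 := UpperHalfPlane.continuous_im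
    have h4 : ∀ z : UpperHalfPlane, z.im ≠ 0 := fun z => z.im_ne_zero
    set Q := halfPlaneRadial p
    let S : ℂ → ℂ → ℂ → ℝ := fun z v w =>
      2 * ((fderiv ℝ Q z v * fderiv ℝ Q z w) ^ 2 + (fderiv ℝ (fderiv ℝ Q) z v w) ^ 2)
    have hS : ∀ v w, Continuous fun z : UpperHalfPlane => S z v w := fun v w => by
      have hv : ∀ v, Continuous fun z : UpperHalfPlane => fderiv ℝ Q z v :=
        fun v => h1.clm_apply continuous_const
      exact continuous_const.mul ((((hv v).mul (hv w)).pow 2).add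
        (((h2.clm_apply continuous_const).clm_apply continuous_const).pow 2))
    have hX : ∀ v, Continuous fun z : UpperHalfPlane => 2 * (fderiv ℝ Q z v / z.im) ^ 2 := fun v =>
      continuous_const.mul (((h1.clm_apply continuous_const).div h3 h4).pow 2)
    have hSX : ∀ v w v', Continuous fun z : UpperHalfPlane =>
        2 * S z v w + 2 * (fderiv ℝ Q z v' / z.im) ^ 2 := fun v w v' =>
      (continuous_const.mul (hS v w)).add (hX v')
    refine ⟨fun z => z.im ^ 2 * (fderiv ℝ Q z 1 ^ 2 + fderiv ℝ Q z Complex.I ^ 2)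
      + z.im ^ 4 * ((2 * S z 1 1 + 2 * (fderiv ℝ Q z Complex.I / z.im) ^ 2)
        + 2 * (2 * S z 1 Complex.I + 2 * (fderiv ℝ Q z 1 / z.im) ^ 2)
        + (2 * S z Complex.I Complex.I + 2 * (fderiv ℝ Q z Complex.I / z.im) ^ 2)),
      ((h3.pow 2).mul (((h1.clm_apply continuous_const).pow 2).add
        ((h1.clm_apply continuous_const).pow 2))).add ((h3.pow 4).mul
          (((hSX _ _ _).add (continuous_const.mul (hSX _ _ _))).add (hSX _ _ _))),
      fun {F} hF z => ?_⟩
    simp only [hyperbolicPlane]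
    rw [fderiv_fderiv_eq_of_eventuallyEq (hext F z), (hext F z).fderiv_eq,
      fderiv_comp_apply' (hF.differentiable (by simp) _) ((hqz z).differentiableAt (by simp))]
    have b : ∀ v w, (fderiv ℝ (fderiv ℝ (F ∘ Q)) z v w) ^ 2
        ≤ S z v w * (deriv F (Q z) ^ 2 + deriv (deriv F) (Q z) ^ 2) := fun v w =>
      fderiv_fderiv_comp_apply_sq_le hF.contDiffAt_two (hqz z) v w
    simp only [smul_apply, smul_eq_mul]
    have b11 := b 1 1
    have b1I := b 1 Complex.I
    have bII := b Complex.I Complex.I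
    set D11 := fderiv ℝ (fderiv ℝ (F ∘ Q)) z 1 1
    set D1I := fderiv ℝ (fderiv ℝ (F ∘ Q)) z 1 Complex.I
    set DII := fderiv ℝ (fderiv ℝ (F ∘ Q)) z Complex.I Complex.I
    set X := fderiv ℝ Q z 1
    set Y := fderiv ℝ Q z Complex.I
    set A := deriv F (Q z)
    set B := deriv (deriv F) (Q z)
    set y := z.im
    -- Each component of the covariant Hessian is a second derivative plus or minus a first
    -- derivative over y. The sign σ lets one estimate treat all three.
    have key : ∀ {D T Z : ℝ}, D ^ 2 ≤ T * (A ^ 2 + B ^ 2) → ∀ σ : ℝ, σ = 1 ∨ σ = -1 →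
        (D + σ * (A * Z / y)) ^ 2 ≤ (2 * T + 2 * (Z / y) ^ 2) * (A ^ 2 + B ^ 2) := by
      intro D T Z h σ hσ
      have hσ2 : σ ^ 2 = 1 := by rcases hσ with rfl | rfl <;> norm_num
      rw [mul_div_assoc]
      nlinarith [sq_nonneg (D - σ * (A * (Z / y))), sq_nonneg (B * (Z / y)),
        mul_le_mul_of_nonneg_right (le_of_eq hσ2) (sq_nonneg (A * (Z / y)))]
    have k1 := key b11 (Z := Y) (-1) (Or.inr rfl)
    have k2 := key b1I (Z := X) 1 (Or.inl rfl)
    have k3 := key bII (Z := Y) 1 (Or.inl rfl)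
    rw [neg_one_mul, ← sub_eq_add_neg] at k1
    rw [one_mul] at k2 k3
    calc _ ≤ y ^ 2 * ((X ^ 2 + Y ^ 2) * (A ^ 2 + B ^ 2)) + y ^ 4 * (
          (2 * S z 1 1 + 2 * (Y / y) ^ 2) * (A ^ 2 + B ^ 2)
          + 2 * ((2 * S z 1 Complex.I + 2 * (X / y) ^ 2) * (A ^ 2 + B ^ 2))
          + (2 * S z Complex.I Complex.I + 2 * (Y / y) ^ 2) * (A ^ 2 + B ^ 2)) := by
          refine add_le_add (mul_le_mul_of_nonneg_left ?_ (sq_nonneg y))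
            (mul_le_mul_of_nonneg_left (add_le_add (add_le_add k1 (by linarith)) k3)
              (by positivity))
          nlinarith [sq_nonneg (B * X), sq_nonneg (B * Y)]
      _ = _ := by ring

end HalfPlaneRadial

/-! ### Integration of radial functions through the disk model, and the hyperbolic result. -/

section HalfPlaneIntegral

open UpperHalfPlane ComplexConjugate

theorem integral_ball_fun_norm_complex (k : ℝ → ℝ) {ρ : ℝ} (hρ : 0 ≤ ρ) :
    ∫ w in Metric.ball (0 : ℂ) ρ, k ‖w‖ = 2 * Real.pi * ∫ r in (0 : ℝ)..ρ, r * k r := by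
  have e1 : ∫ w in Metric.ball (0 : ℂ) ρ, k ‖w‖ = ∫ w : ℂ, (Iio ρ).indicator k ‖w‖ := by
    rw [← integral_indicator Metric.isOpen_ball.measurableSet]
    refine integral_congr_ae (Eventually.of_forall fun x => ?_)
    simp only [indicator, Metric.mem_ball, mem_Iio, dist_zero_right]
  rw [e1, integral_fun_norm_addHaar]
  have e2 : ∀ y, y * (Iio ρ).indicator k y = (Iio ρ).indicator (fun y => y * k y) y := fun y => by
    by_cases hy : y ∈ Iio ρ <;> simp [hy]
  simp only [Complex.finrank_real_complex, Nat.add_one_sub_one, pow_one, smul_eq_mul, e2]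
  rw [setIntegral_indicator measurableSet_Iio, Ioi_inter_Iio, ← integral_Ioc_eq_integral_Ioo,
    ← intervalIntegral.integral_of_le hρ]
  simp [Measure.real, Complex.volume_ball]
  ring

/-- The inverse Cayley transform, mapping the unit disk to the half-plane and `0` to `p`. -/
noncomputable def cayley (p : ℂ) (w : ℂ) : ℂ := (p - conj p * w) / (1 - w)

variable (p : UpperHalfPlane) {w z : ℂ}

theorem one_sub_ne_zero_of_norm_lt (hw : ‖w‖ < 1) : 1 - w ≠ 0 := fun h => by
  rw [sub_eq_zero] at h
  simp [← h] at hw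

theorem normSq_lt_one (hw : ‖w‖ < 1) : Complex.normSq w < 1 := by
  rw [Complex.normSq_eq_norm_sq]
  nlinarith [norm_nonneg w]

theorem normSq_sub_conj : Complex.normSq ((p : ℂ) - conj (p : ℂ)) = 4 * p.im ^ 2 := by
  rw [Complex.sub_conj]
  simp [Complex.normSq_apply]
  ring

theorem cayley_im (hw : ‖w‖ < 1) :
    (cayley p w).im = p.im * (1 - Complex.normSq w) / Complex.normSq (1 - w) := by
  have h := Complex.normSq_pos.2 (one_sub_ne_zero_of_norm_lt hw)
  rw [cayley, Complex.div_im, ← sub_div]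
  congr 1
  simp [Complex.normSq_apply]
  ring

theorem cayley_sub (hw : ‖w‖ < 1) :
    cayley p w - p = w * (p - conj (p : ℂ)) / (1 - w) := by
  have h := one_sub_ne_zero_of_norm_lt hw
  rw [cayley]
  field_simp
  ring

theorem cayley_im_pos (hw : ‖w‖ < 1) : 0 < (cayley p w).im := by
  rw [cayley_im p hw]
  have h := Complex.normSq_pos.2 (one_sub_ne_zero_of_norm_lt hw)
  have h2 := normSq_lt_one hw
  have h3 := p.im_pos
  have : 0 < 1 - Complex.normSq w := by linarith
  positivity

/-- In the disk model |w| = tanh(d/2), and sinh² = tanh²/(1 - tanh²). -/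
theorem halfPlaneRadial_cayley (hw : ‖w‖ < 1) :
    halfPlaneRadial p (cayley p w) = ‖w‖ ^ 2 / (1 - ‖w‖ ^ 2) := by
  have h := (Complex.normSq_pos.2 (one_sub_ne_zero_of_norm_lt hw)).ne'
  have h2 : 1 - Complex.normSq w ≠ 0 := by linarith [normSq_lt_one hw]
  have h3 := p.im_ne_zero
  rw [halfPlaneRadial_apply, cayley_sub p hw, cayley_im p hw, ← Complex.normSq_eq_norm_sq,
    ← Complex.normSq_eq_norm_sq, Complex.normSq_div, Complex.normSq_mul, normSq_sub_conj]
  field_simp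

theorem hasDerivAt_cayley (hw : ‖w‖ < 1) :
    HasDerivAt (cayley p) ((p - conj (p : ℂ)) / (1 - w) ^ 2) w := by
  have h := one_sub_ne_zero_of_norm_lt hw
  have := (((hasDerivAt_id w).const_mul (conj (p : ℂ))).const_sub (p : ℂ)).div
    ((hasDerivAt_id w).const_sub 1) h
  refine this.congr_deriv ?_
  congr 1
  simp
  ring

theorem injOn_cayley : InjOn (cayley p) (Metric.ball 0 1) := fun a ha b hb h => by
  have h1 := one_sub_ne_zero_of_norm_lt (mem_ball_zero_iff.1 ha)
  have h2 := one_sub_ne_zero_of_norm_lt (mem_ball_zero_iff.1 hb)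
  have h3 : (p : ℂ) - conj (p : ℂ) ≠ 0 := by
    rw [← Complex.normSq_pos, normSq_sub_conj]
    have := p.im_pos
    positivity
  rw [cayley, cayley, div_eq_div_iff h1 h2] at h
  have : ((p : ℂ) - conj (p : ℂ)) * (a - b) = 0 := by linear_combination h
  exact sub_eq_zero.1 ((mul_eq_zero.1 this).resolve_left h3)

/-- The radius is tanh(R/2) when t₀ = sinh²(R/2). The preimage of z is (z - p)/(z - p̄), and |z -
p̄|² = |z - p|² + 4 Im z Im p. -/
theorem image_cayley_ball {t₀ : ℝ} (ht₀ : 0 < t₀) :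
    cayley p '' Metric.ball 0 √(t₀ / (1 + t₀)) = {z | 0 < z.im ∧ halfPlaneRadial p z < t₀} := by
  have hlt : t₀ / (1 + t₀) < 1 := by rw [div_lt_one (by positivity)]; linarith
  ext z
  constructor
  · rintro ⟨w, hw, rfl⟩
    rw [mem_ball_zero_iff] at hw
    have h1 : ‖w‖ ^ 2 < t₀ / (1 + t₀) := (Real.lt_sqrt (norm_nonneg _)).1 hw
    have hw1 : ‖w‖ < 1 := by nlinarith [norm_nonneg w]
    refine ⟨cayley_im_pos p hw1, ?_⟩
    rw [halfPlaneRadial_cayley p hw1, div_lt_iff₀ (by linarith)]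
    rw [lt_div_iff₀ (by positivity)] at h1
    linarith
  · rintro ⟨hz, hq⟩
    have hp := p.im_pos
    have hne : z - conj (p : ℂ) ≠ 0 := fun h => by
      have := congrArg Complex.im h
      simp at this
      linarith
    have hS : Complex.normSq (z - conj (p : ℂ)) = Complex.normSq (z - p) + 4 * z.im * p.im := by
      simp [Complex.normSq_apply]
      ring
    have hpc : (p : ℂ) - conj (p : ℂ) ≠ 0 := by
      rw [← Complex.normSq_pos, normSq_sub_conj]
      positivity
    refine ⟨(z - p) / (z - conj (p : ℂ)), ?_, ?_⟩
    · rw [mem_ball_zero_iff, Real.lt_sqrt (norm_nonneg _), ← Complex.normSq_eq_norm_sq,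
        Complex.normSq_div, hS]
      rw [halfPlaneRadial_apply, ← Complex.normSq_eq_norm_sq, ← mul_inv, ← div_eq_mul_inv,
        div_lt_iff₀ (by positivity)] at hq
      have := Complex.normSq_nonneg (z - p)
      rw [div_lt_div_iff₀ (by positivity) (by positivity)]
      linarith
    · have h1 : 1 - (z - p) / (z - conj (p : ℂ))
          = ((p : ℂ) - conj (p : ℂ)) / (z - conj (p : ℂ)) := by
        field_simp
        ring
      rw [cayley, h1]
      field_simp
      ring

theorem integral_halfPlaneRadial {t₀ : ℝ} (ht₀ : 0 < t₀) {g : ℝ → ℝ}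
    (hg : ContinuousOn g (Icc 0 t₀)) :
    ∫ z in {z : UpperHalfPlane | halfPlaneRadial p z < t₀}, g (halfPlaneRadial p z)
      ∂hyperbolicPlane.vol = 4 * Real.pi * ∫ t in (0 : ℝ)..t₀, g t := by
  set ρ := √(t₀ / (1 + t₀))
  have hlt : t₀ / (1 + t₀) < 1 := by rw [div_lt_one (by positivity)]; linarith
  have hρ0 : 0 ≤ ρ := Real.sqrt_nonneg _
  have hρ2 : ρ ^ 2 = t₀ / (1 + t₀) := Real.sq_sqrt (by positivity)
  have hρ1 : ρ < 1 := by nlinarith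
  have hball : ∀ w ∈ Metric.ball (0 : ℂ) ρ, ‖w‖ < 1 := fun w hw =>
    (mem_ball_zero_iff.1 hw).trans hρ1
  have hmeas : MeasurableSet {z : UpperHalfPlane | halfPlaneRadial p z < t₀} :=
    (isOpen_lt (hyperbolicPlane_isRadial p).continuous continuous_const).measurableSet
  have hV : MeasurableSet {z | 0 < z.im ∧ halfPlaneRadial p z < t₀} := by
    have := (contDiffOn_halfPlaneRadial p).continuousOn.isOpen_inter_preimage isOpen_im_pos
      (isOpen_Iio (a := t₀))
    exact this.measurableSet
  set f : ℂ → ℝ := {z | halfPlaneRadial p z < t₀}.indicator fun z => g (halfPlaneRadial p z)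
  have e1 : ∫ z in {z : UpperHalfPlane | halfPlaneRadial p z < t₀}, g (halfPlaneRadial p z)
      ∂hyperbolicPlane.vol = ∫ z : UpperHalfPlane, f z ∂hyperbolicPlane.vol := by
    rw [← integral_indicator hmeas]
    rfl
  have e2 : ∫ z in {z : ℂ | 0 < z.im}, (z.im ^ 2)⁻¹ * f z
      = ∫ z in {z | 0 < z.im ∧ halfPlaneRadial p z < t₀},
        (z.im ^ 2)⁻¹ * g (halfPlaneRadial p z) := by
    rw [← integral_indicator isOpen_im_pos.measurableSet, ← integral_indicator hV]
    refine integral_congr_ae (Eventually.of_forall fun z => ?_)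
    by_cases h1 : 0 < z.im <;> by_cases h2 : halfPlaneRadial p z < t₀ <;>
      simp [indicator, f, h1, h2]
  -- The real Jacobian of a holomorphic map is the squared modulus of its derivative. Divided by (Im
  -- z)² it becomes the area density 4/(1 - |w|²)² of the disk, with no trace of p.
  have e3 : ∫ z in {z | 0 < z.im ∧ halfPlaneRadial p z < t₀},
        (z.im ^ 2)⁻¹ * g (halfPlaneRadial p z)
      = ∫ w in Metric.ball (0 : ℂ) ρ,
        4 / (1 - ‖w‖ ^ 2) ^ 2 * g (‖w‖ ^ 2 / (1 - ‖w‖ ^ 2)) := by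
    rw [← image_cayley_ball p ht₀, integral_image_eq_integral_abs_det_fderiv_smul volume
      Metric.isOpen_ball.measurableSet
      (fun w hw => ((hasDerivAt_cayley p (hball w hw)).hasFDerivAt.restrictScalars
        ℝ).hasFDerivWithinAt)
      ((injOn_cayley p).mono (Metric.ball_subset_ball hρ1.le))]
    refine setIntegral_congr_fun Metric.isOpen_ball.measurableSet fun w hw => ?_
    have hw1 := hball w hw
    have h1 := (Complex.normSq_pos.2 (one_sub_ne_zero_of_norm_lt hw1)).ne'
    have h2 : 1 - Complex.normSq w ≠ 0 := by linarith [normSq_lt_one hw1]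
    have h3 := p.im_ne_zero
    have hdet : (ContinuousLinearMap.restrictScalars ℝ (ContinuousLinearMap.toSpanSingleton ℂ
        ((p - conj (p : ℂ)) / (1 - w) ^ 2))).det = 4 * p.im ^ 2 / Complex.normSq (1 - w) ^ 2 := by
      simp [ContinuousLinearMap.det, LinearMap.det_restrictScalars, Algebra.norm_complex_eq,
        normSq_sub_conj]
    rw [hdet, halfPlaneRadial_cayley p hw1, cayley_im p hw1, abs_of_nonneg (by positivity),
      smul_eq_mul, ← Complex.normSq_eq_norm_sq]
    field_simp
  have e4 := integral_ball_fun_norm_complex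
    (fun r => 4 / (1 - r ^ 2) ^ 2 * g (r ^ 2 / (1 - r ^ 2))) hρ0
  have hpos : ∀ r ∈ Icc 0 ρ, 0 < 1 - r ^ 2 := fun r hr => by nlinarith [hr.1, hr.2]
  -- Substituting t = r²/(1 - r²) gives dt = 2r dr/(1 - r²)², half of the radial density 4r/(1 -
  -- r²)². Hence 2π becomes 4π.
  have e5 : ∫ r in (0 : ℝ)..ρ, (g ∘ fun r => r ^ 2 / (1 - r ^ 2)) r * (2 * r / (1 - r ^ 2) ^ 2)
      = ∫ t in (0 ^ 2 / (1 - 0 ^ 2) : ℝ)..(ρ ^ 2 / (1 - ρ ^ 2)), g t := by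
    have hd : ∀ r ∈ uIcc 0 ρ,
        HasDerivAt (fun r : ℝ => r ^ 2 / (1 - r ^ 2)) (2 * r / (1 - r ^ 2) ^ 2) r := fun r hr => by
      rw [uIcc_of_le hρ0] at hr
      refine ((hasDerivAt_pow 2 r).div ((hasDerivAt_pow 2 r).const_sub 1)
        (hpos r hr).ne').congr_deriv ?_
      congr 1
      push_cast
      ring
    refine intervalIntegral.integral_comp_mul_deriv' hd ?_ (hg.mono ?_)
    · rw [uIcc_of_le hρ0]
      exact ContinuousOn.div (by fun_prop) (by fun_prop) fun r hr => pow_ne_zero 2 (hpos r hr).ne'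
    · rintro _ ⟨r, hr, rfl⟩
      rw [uIcc_of_le hρ0] at hr
      have hr2 : r ^ 2 ≤ ρ ^ 2 := by gcongr; exacts [hr.1, hr.2]
      refine ⟨div_nonneg (sq_nonneg r) (hpos r hr).le, ?_⟩
      simp only
      rw [div_le_iff₀ (hpos r hr)]
      rw [hρ2, le_div_iff₀ (by positivity)] at hr2
      linarith
  have e6 : ρ ^ 2 / (1 - ρ ^ 2) = t₀ := by
    rw [hρ2]
    field_simp
    ring
  have e7 := integral_hyperbolicPlane f
  rw [e1, e7, e2, e3, e4]
  rw [e6] at e5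
  simp only [ne_eq, OfNat.ofNat_ne_zero, not_false_eq_true, zero_pow, zero_div] at e5
  rw [← e5, ← intervalIntegral.integral_const_mul, ← intervalIntegral.integral_const_mul]
  refine intervalIntegral.integral_congr fun r _ => ?_
  simp only [Function.comp_apply]
  ring

theorem hyperbolicProfile_eq (R r : ℝ) : hyperbolicProfile R r
    = logProfile (1 - -1 * Real.sinh (R / 2) ^ 2) (1 - -1 * Real.sinh (r / 2) ^ 2) := by
  have hc : ∀ x : ℝ, 1 - -1 * Real.sinh x ^ 2 = Real.cosh x ^ 2 := fun x => by
    rw [Real.cosh_sq]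
    ring
  have ht : ∀ x : ℝ, 1 - 1 / Real.cosh x ^ 2 = Real.tanh x ^ 2 := fun x => by
    have h := (Real.cosh_pos x).ne'
    rw [Real.tanh_eq_sinh_div_cosh, div_pow, Real.sinh_sq]
    field_simp
  rw [hc, hc, logProfile, hyperbolicProfile, ht, ht, Real.log_pow, Real.log_pow,
    Real.log_div (Real.cosh_pos _).ne' (Real.cosh_pos _).ne', div_pow,
    show 1 - Real.cosh (R / 2) ^ 2 = -Real.sinh (R / 2) ^ 2 by rw [Real.cosh_sq]; ring, div_neg]
  push_cast
  ring

theorem hyperbolicPlane_deflection {R : ℝ} (hR : 0 < R) :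
    (∃ u, IsDeflection hyperbolicPlane (Metric.ball p R) u) ∧
      ∀ u, IsDeflection hyperbolicPlane (Metric.ball p R) u →
        (∀ᵐ x ∂hyperbolicPlane.vol.restrict (Metric.ball p R),
          u x = hyperbolicProfile R (dist p x)) ∧
        IntegrableOn u (Metric.ball p R) hyperbolicPlane.vol ∧
        ∫ x in Metric.ball p R, u x ∂hyperbolicPlane.vol =
          4 * Real.pi * (Real.sinh (R / 2) ^ 2
            - 4 * (Real.cosh (R / 2) / Real.sinh (R / 2)) ^ 2
              * Real.log (Real.cosh (R / 2)) ^ 2) := by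
  set t₀ := Real.sinh (R / 2) ^ 2 with ht₀
  have hs : 0 < Real.sinh (R / 2) := Real.sinh_pos_iff.2 (by linarith)
  have ht₀0 : 0 < t₀ := by positivity
  have hΩ : Metric.ball p R = {z : UpperHalfPlane | halfPlaneRadial p z < t₀} := by
    ext z
    rw [Metric.mem_ball', mem_ofPred_eq, halfPlaneRadial_eq_sinh_sq, ht₀,
      sq_lt_sq₀ (Real.sinh_nonneg_iff.2 (by positivity)) hs.le, Real.sinh_lt_sinh]
    constructor <;> intro h <;> linarith
  have main := (hyperbolicPlane_isRadial p).deflection_log (Or.inr rfl) hyperbolicPlane_isRegular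
    (fun z => by simp only [halfPlaneRadial_eq_sinh_sq]; positivity) ht₀0 (by linarith)
  rw [← hΩ] at main
  refine ⟨main.1, fun u hu => ?_⟩
  obtain ⟨h1, h2, h3⟩ := main.2 u hu
  refine ⟨?_, h2, h3.trans ?_⟩
  · simpa only [halfPlaneRadial_eq_sinh_sq, ht₀, ← hyperbolicProfile_eq] using h1
  · have hpos : ∀ t ∈ Icc 0 t₀, 0 < 1 - -1 * t := fun t ht => by linarith [ht.1]
    rw [hΩ, integral_halfPlaneRadial p ht₀0 (g := fun t => logProfile (1 - -1 * t₀) (1 - -1 * t))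
      ((contDiffOn_logProfile _).continuousOn.comp (by fun_prop) hpos)]
    congr 1
    have e : ∫ t in (0 : ℝ)..t₀, logProfile (1 - -1 * t₀) (1 - -1 * t)
        = ∫ q in (1 : ℝ)..(1 + t₀), logProfile (1 + t₀) q := by
      simp only [neg_mul, one_mul, sub_neg_eq_add]
      rw [intervalIntegral.integral_comp_add_left (fun q => logProfile (1 + t₀) q), add_zero]
    have hc : 1 + t₀ = Real.cosh (R / 2) ^ 2 := by rw [Real.cosh_sq]; ring
    rw [e, integral_logProfile (by positivity) (by linarith), hc, Real.log_pow,
      show 1 - Real.cosh (R / 2) ^ 2 = -t₀ by rw [← hc]; ring, ← hc]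
    push_cast
    rw [div_pow, ← ht₀, ← hc]
    field_simp
    ring

end HalfPlaneIntegral

/-! ### The sphere through functions on ℝ³ that are constant along rays. -/

section Sphere

local notation "E₃" => EuclideanSpace ℝ (Fin 3)

instance : IsFiniteMeasureOnCompacts sphereTwo.vol :=
  inferInstanceAs (IsFiniteMeasureOnCompacts (volume : Measure E₃).toSphere)

instance : IsFiniteMeasure sphereTwo.vol :=
  inferInstanceAs (IsFiniteMeasure (volume : Measure E₃).toSphere)

theorem norm_coe_S2 (x : S2) : ‖(x : E₃)‖ = 1 := mem_sphere_zero_iff_norm.1 x.2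

theorem coe_S2_ne_zero (x : S2) : (x : E₃) ≠ 0 := fun h => by
  have := norm_coe_S2 x
  simp [h] at this

theorem radialExt_of_eq (f : S2 → ℝ) {y : E₃} (hy : y ≠ 0) {w : S2}
    (hw : (w : E₃) = ‖y‖⁻¹ • y) : radialExt f y = f w := by
  rw [radialExt, dif_neg hy]
  congr 1
  exact Subtype.ext hw.symm

theorem radialExt_coe (f : S2 → ℝ) (x : S2) : radialExt f (x : E₃) = f x :=
  radialExt_of_eq f (coe_S2_ne_zero x) (by simp)

theorem exists_coe_eq_inv_norm_smul {y : E₃} (hy : y ≠ 0) : ∃ w : S2, (w : E₃) = ‖y‖⁻¹ • y :=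
  ⟨⟨‖y‖⁻¹ • y, by
    rw [mem_sphere_zero_iff_norm, norm_smul, norm_inv, norm_norm,
      inv_mul_cancel₀ (norm_ne_zero_iff.mpr hy)]⟩, rfl⟩

theorem radialExt_smul (f : S2 → ℝ) {c : ℝ} (hc : 0 < c) (y : E₃) :
    radialExt f (c • y) = radialExt f y := by
  rcases eq_or_ne y 0 with rfl | hy
  · rw [smul_zero]
  · obtain ⟨w, hw⟩ := exists_coe_eq_inv_norm_smul hy
    rw [radialExt_of_eq f hy hw, radialExt_of_eq f (smul_ne_zero hc.ne' hy)]
    rw [hw, norm_smul, Real.norm_of_nonneg hc.le, smul_smul, mul_inv, mul_right_comm,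
      inv_mul_cancel₀ hc.ne', one_mul]

theorem radialExt_eventuallyEq {f g : S2 → ℝ} {x : S2} (h : f =ᶠ[𝓝 x] g) :
    radialExt f =ᶠ[𝓝 (x : E₃)] radialExt g := by
  rw [EventuallyEq, nhds_subtype_eq_comap, eventually_comap] at h
  have hc : Tendsto (fun y : E₃ => ‖y‖⁻¹ • y) (𝓝 (x : E₃)) (𝓝 (x : E₃)) := by
    have : ContinuousAt (fun y : E₃ => ‖y‖⁻¹ • y) (x : E₃) :=
      (continuous_norm.continuousAt.inv₀ (norm_ne_zero_iff.2 (coe_S2_ne_zero x))).smul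
        continuousAt_id
    simpa [ContinuousAt, norm_coe_S2] using this
  filter_upwards [hc.eventually h, isOpen_ne.mem_nhds (coe_S2_ne_zero x)] with y hy hy0
  obtain ⟨w, hw⟩ := exists_coe_eq_inv_norm_smul hy0
  rw [radialExt_of_eq f hy0 hw, radialExt_of_eq g hy0 hw, hy w hw]

theorem radialExt_eventuallyEq_zero {f : S2 → ℝ} {x : S2} (h : f =ᶠ[𝓝 x] 0) :
    radialExt f =ᶠ[𝓝 (x : E₃)] 0 := by
  refine (radialExt_eventuallyEq h).trans (Eventually.of_forall fun y => ?_)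
  simp [radialExt]

theorem contDiffOn_radialExt {f : S2 → ℝ} (hf : sphereTwo.Smooth f) :
    ContDiffOn ℝ ∞ (radialExt f) {0}ᶜ := by
  have hf' : ContMDiff (𝓡 2) 𝓘(ℝ, ℝ) ∞ f := hf
  let U : TopologicalSpace.Opens E₃ := ⟨{0}ᶜ, isOpen_compl_singleton⟩
  have hn : ContMDiff 𝓘(ℝ, E₃) 𝓘(ℝ, E₃) ∞ fun y : U => ‖(y : E₃)‖⁻¹ • (y : E₃) := fun y => by
    rw [contMDiffAt_subtype_iff (f := fun y : E₃ => ‖y‖⁻¹ • y), contMDiffAt_iff_contDiffAt]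
    have hy : (y : E₃) ≠ 0 := y.2
    exact ((contDiffAt_norm ℝ hy).inv (norm_ne_zero_iff.2 hy)).smul contDiffAt_id
  have hs : ∀ y : U, ‖(y : E₃)‖⁻¹ • (y : E₃) ∈ Metric.sphere (0 : E₃) 1 := fun y => by
    have hy : (y : E₃) ≠ 0 := y.2
    rw [mem_sphere_zero_iff_norm, norm_smul, norm_inv, norm_norm,
      inv_mul_cancel₀ (norm_ne_zero_iff.mpr hy)]
  have h1 := hf'.comp (ContMDiff.codRestrict_sphere (n := 2) hn hs)
  intro y hy
  have h2 : ContMDiffAt 𝓘(ℝ, E₃) 𝓘(ℝ, ℝ) ∞ (radialExt f) y := by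
    rw [← contMDiffAt_subtype_iff (U := U) (x := ⟨y, hy⟩)]
    refine (h1 ⟨y, hy⟩).congr_of_eventuallyEq (Eventually.of_forall fun z => ?_)
    exact radialExt_of_eq f z.2 rfl
  exact (contMDiffAt_iff_contDiffAt.1 h2).contDiffWithinAt

theorem sphereTwo_smooth_of_contDiffOn {f : S2 → ℝ} {g : E₃ → ℝ} (hg : ContDiffOn ℝ ∞ g {0}ᶜ)
    (h : ∀ x : S2, f x = g x) : sphereTwo.Smooth f := by
  change ContMDiff (𝓡 2) 𝓘(ℝ, ℝ) ∞ f
  rw [show f = g ∘ ((↑) : S2 → E₃) from funext h]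
  intro x
  exact (hg.contDiffAt (isOpen_compl_singleton.mem_nhds (coe_S2_ne_zero x))).contMDiffAt.comp x
    (contMDiff_coe_sphere x)

theorem continuous_comp_coe_S2 {X : Type*} [TopologicalSpace X] {g : E₃ → X}
    (hg : ContinuousOn g {0}ᶜ) : Continuous fun x : S2 => g x :=
  hg.comp_continuous continuous_subtype_val fun x => coe_S2_ne_zero x

theorem contDiffAt_radialExt {f : S2 → ℝ} (hf : sphereTwo.Smooth f) {y : E₃} (hy : y ≠ 0) :
    ContDiffAt ℝ 2 (radialExt f) y :=
  contDiffAt_infty.1 ((contDiffOn_radialExt hf).contDiffAt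
    (isOpen_compl_singleton.mem_nhds hy)) 2

theorem fderiv_radialExt_self {f : S2 → ℝ} (hf : sphereTwo.Smooth f) {y : E₃} (hy : y ≠ 0) :
    fderiv ℝ (radialExt f) y y = 0 := by
  have h1 : HasFDerivAt (radialExt f) (fderiv ℝ (radialExt f) y) ((1 : ℝ) • y) := by
    rw [one_smul]
    exact ((contDiffAt_radialExt hf hy).differentiableAt (by simp)).hasFDerivAt
  have h2 : HasDerivAt (fun t : ℝ => t • y) y 1 := by
    simpa using (hasDerivAt_id (1 : ℝ)).smul_const y
  have h3 := h1.comp_hasDerivAt (1 : ℝ) h2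
  have h4 : (radialExt f ∘ fun t : ℝ => t • y) =ᶠ[𝓝 1] fun _ => radialExt f y := by
    filter_upwards [lt_mem_nhds (zero_lt_one (α := ℝ))] with t ht using radialExt_smul f ht y
  exact h3.unique ((hasDerivAt_const (1 : ℝ) (radialExt f y)).congr_of_eventuallyEq h4)

/-- Differentiate Euler's relation DF(z)z = 0 at y in the direction y; the extra term DF(y)y
vanishes as well. -/
theorem fderiv_fderiv_radialExt_self {f : S2 → ℝ} (hf : sphereTwo.Smooth f) {y : E₃}
    (hy : y ≠ 0) : fderiv ℝ (fderiv ℝ (radialExt f)) y y y = 0 := by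
  have h1 := (contDiffAt_radialExt hf hy).differentiableAt_fderiv.hasFDerivAt.clm_apply
    (hasFDerivAt_id y)
  have h2 : (fun z => fderiv ℝ (radialExt f) z (id z)) =ᶠ[𝓝 y] fun _ => (0 : ℝ) := by
    filter_upwards [isOpen_ne.mem_nhds hy] with z hz using fderiv_radialExt_self hf hz
  have h3 := h1.unique ((hasFDerivAt_const (0 : ℝ) y).congr_of_eventuallyEq h2)
  have h4 := congrArg (fun L : E₃ →L[ℝ] ℝ => L y) h3
  simpa [fderiv_radialExt_self hf hy] using h4

/-- Second derivatives of a function homogeneous of degree 0 are homogeneous of degree -2. -/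
theorem laplacian_radialExt {f : S2 → ℝ} (hf : sphereTwo.Smooth f) {y : E₃} (hy : y ≠ 0) {w : S2}
    (hw : (w : E₃) = ‖y‖⁻¹ • y) :
    Laplacian.laplacian (radialExt f) y = (‖y‖ ^ 2)⁻¹ * sphereTwo.lap f w := by
  have hc : 0 < ‖y‖⁻¹ := inv_pos.2 (norm_pos_iff.2 hy)
  have h1 : ∀ x, fderiv ℝ (radialExt f) x = ‖y‖⁻¹ • fderiv ℝ (radialExt f) (‖y‖⁻¹ • x) :=
    fun x => by
      rw [← fderiv_comp_smul]
      congr 1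
      exact funext fun x => (radialExt_smul f hc x).symm
  have h2 : fderiv ℝ (fderiv ℝ (radialExt f)) y
      = (‖y‖⁻¹ * ‖y‖⁻¹) • fderiv ℝ (fderiv ℝ (radialExt f)) (‖y‖⁻¹ • y) := by
    conv_lhs => rw [show fderiv ℝ (radialExt f)
      = fun x => ‖y‖⁻¹ • fderiv ℝ (radialExt f) (‖y‖⁻¹ • x) from funext h1]
    have h3 : DifferentiableAt ℝ (fderiv ℝ (radialExt f)) (‖y‖⁻¹ • y) :=
      (contDiffAt_radialExt hf (smul_ne_zero hc.ne' hy)).differentiableAt_fderiv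
    have h4 : DifferentiableAt ℝ (fun x => fderiv ℝ (radialExt f) (‖y‖⁻¹ • x)) y :=
      h3.comp y (differentiableAt_fun_id.fun_const_smul ‖y‖⁻¹)
    rw [fderiv_fun_const_smul h4, fderiv_comp_smul, smul_smul]
  simp only [sphereTwo]
  rw [laplacian_eq_sum_fderiv (EuclideanSpace.basisFun (Fin 3) ℝ),
    laplacian_eq_sum_fderiv (EuclideanSpace.basisFun (Fin 3) ℝ), h2, hw, Finset.mul_sum]
  refine Finset.sum_congr rfl fun i _ => ?_
  simp only [smul_apply, smul_eq_mul]
  rw [← mul_inv, ← sq]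

/-- The Hessian of the extension vanishes on (x, x), so its full trace equals the sum over the three
projected basis vectors. Cauchy–Schwarz on these three terms gives the constant. -/
theorem sphereTwo_lap_sq_le {f : S2 → ℝ} (hf : sphereTwo.Smooth f) (x : S2) :
    sphereTwo.lap f x ^ 2 ≤ 3 * sphereTwo.hessSq f x := by
  simp only [sphereTwo]
  set B := fderiv ℝ (fderiv ℝ (radialExt f)) (x : E₃)
  have hxx : B x x = 0 := fderiv_fderiv_radialExt_self hf (coe_S2_ne_zero x)
  let e : Fin 3 → E₃ := fun i => EuclideanSpace.single i 1
  have hx : (x : E₃) = ∑ i, (x : E₃) i • e i := by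
    conv_lhs => rw [← (EuclideanSpace.basisFun (Fin 3) ℝ).sum_repr (x : E₃)]
    simp [e]
  have hin : ∀ i, inner ℝ (x : E₃) (e i) = (x : E₃) i := fun i => by
    simp [e, EuclideanSpace.inner_single_right]
  have hn : ∑ i, (x : E₃) i ^ 2 = 1 := by
    have := EuclideanSpace.real_norm_sq_eq (x : E₃)
    rw [norm_coe_S2] at this
    linarith
  have hP : ∀ i, tangentProj x (e i) = e i - (x : E₃) i • (x : E₃) := fun i => by
    rw [tangentProj, hin]
  have hl : ∑ i, (x : E₃) i * B (e i) x = 0 := by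
    have : B (∑ i, (x : E₃) i • e i) x = 0 := by rw [← hx]; exact hxx
    simpa using this
  have hr : ∑ i, (x : E₃) i * B x (e i) = 0 := by
    have : B x (∑ i, (x : E₃) i • e i) = 0 := by rw [← hx]; exact hxx
    simpa using this
  have htr : Laplacian.laplacian (radialExt f) (x : E₃)
      = ∑ i, B (tangentProj x (e i)) (tangentProj x (e i)) := by
    rw [laplacian_eq_sum_fderiv (EuclideanSpace.basisFun (Fin 3) ℝ)]
    have : ∀ i, B (tangentProj x (e i)) (tangentProj x (e i))
        = B (e i) (e i) - (x : E₃) i * B (e i) x - (x : E₃) i * B x (e i) := fun i => by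
      rw [hP]
      simp [hxx]
    simp_rw [this]
    rw [Finset.sum_sub_distrib, Finset.sum_sub_distrib, hl, hr]
    simp [e, B]
  rw [htr]
  refine (sq_sum_le_card_mul_sum_sq).trans ?_
  simp only [Finset.card_univ, Fintype.card_fin, Nat.cast_ofNat]
  gcongr with i
  exact Finset.single_le_sum (f := fun j => (B (tangentProj x (e i)) (tangentProj x (e j))) ^ 2)
    (fun j _ => sq_nonneg _) (Finset.mem_univ i)

/-- Integration in polar coordinates of a product of a radial and an angular function. -/
theorem integral_norm_mul_radialExt (a : ℝ → ℝ) (k : S2 → ℝ) :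
    ∫ y : E₃, a ‖y‖ * radialExt k y
      = (∫ x, k x ∂sphereTwo.vol) * ∫ r in Ioi (0 : ℝ), r ^ 2 * a r := by
  have e1 : ∫ y : E₃, a ‖y‖ * radialExt k y
      = ∫ y : ({(0)}ᶜ : Set E₃), a ‖y.1‖ * radialExt k y.1 ∂(volume.comap Subtype.val) := by
    rw [integral_subtype_comap (measurableSet_singleton _).compl
      fun y : E₃ => a ‖y‖ * radialExt k y, restrict_compl_singleton]
  have e2 := (volume : Measure E₃).measurePreserving_homeomorphUnitSphereProd.integral_comp
    (Homeomorph.measurableEmbedding _) fun z : S2 × Ioi (0 : ℝ) => k z.1 * a z.2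
  have e3 : ∀ y : ({(0)}ᶜ : Set E₃), a ‖y.1‖ * radialExt k y.1
      = k (homeomorphUnitSphereProd E₃ y).1 * a (homeomorphUnitSphereProd E₃ y).2 := fun y => by
    have hy : (y : E₃) ≠ 0 := y.2
    rw [radialExt_of_eq k hy (w := (homeomorphUnitSphereProd E₃ y).1) (by simp), mul_comm]
    simp
  have e4 := integral_prod_mul (μ := (volume : Measure E₃).toSphere)
    (ν := Measure.volumeIoiPow (Module.finrank ℝ E₃ - 1)) k fun r => a r
  rw [e1, integral_congr_ae (Eventually.of_forall e3), e2, e4]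
  congr 1
  simp only [finrank_euclideanSpace, Fintype.card_fin, Nat.reduceSub, Measure.volumeIoiPow,
    ENNReal.ofReal]
  rw [integral_withDensity_eq_integral_smul,
    integral_subtype_comap measurableSet_Ioi fun r => Real.toNNReal (r ^ 2) • a r]
  · refine setIntegral_congr_fun measurableSet_Ioi fun r hr => ?_
    simp only [NNReal.smul_def, Real.coe_toNNReal _ (sq_nonneg r), smul_eq_mul]
  · exact (measurable_subtype_coe.pow_const _).real_toNNReal

end Sphere

/-! ### Green's identity on the sphere. -/

section SphereGreen

local notation "E₃" => EuclideanSpace ℝ (Fin 3)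

/-- Euclidean Green is applied to the extensions times a radial cutoff χ. In the antisymmetric
difference the Δχ terms cancel, and polar coordinates factor the rest as the spherical integral of f
Δφ - φ Δf times a positive radial integral. -/
theorem sphereTwo_green {f φ : S2 → ℝ} (hf : sphereTwo.Smooth f) (hφ : sphereTwo.Smooth φ) :
    ∫ x, f x * sphereTwo.lap φ x ∂sphereTwo.vol = ∫ x, sphereTwo.lap f x * φ x ∂sphereTwo.vol := by
  -- The bump acts on |y|² and lives between 1/2 and 3/2, away from the origin, where the extensions
  -- need not be smooth.
  let c : ContDiffBump (1 : ℝ) := ⟨1 / 4, 1 / 2, by norm_num, by norm_num⟩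
  have hc0 : ∀ s : ℝ, c s ≠ 0 → 1 / 2 < s ∧ s < 3 / 2 := fun s hs => by
    have h : s ∈ Function.support c := hs
    rw [c.support_eq, Real.ball_eq_Ioo] at h
    have h1 : (1 : ℝ) - 1 / 2 < s := h.1
    have h2 : s < 1 + 1 / 2 := h.2
    constructor <;> linarith
  have hc2 : ContDiff ℝ ∞ fun y : E₃ => ‖y - 0‖ ^ 2 := (contDiff_id.sub contDiff_const).norm_sq ℝ
  set χ : E₃ → ℝ := c ∘ fun y => ‖y - 0‖ ^ 2 with hχ
  have hχs : ContDiff ℝ ∞ χ := (c.contDiff).comp hc2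
  have hχ0 : χ =ᶠ[𝓝 0] 0 := by
    have : ∀ᶠ y : E₃ in 𝓝 0, ‖y - 0‖ ^ 2 < 1 / 2 := by
      refine hc2.continuous.continuousAt.eventually_lt continuousAt_const ?_
      norm_num
    filter_upwards [this] with y hy
    by_contra h
    exact absurd (hc0 _ h).1 (not_lt.2 hy.le)
  have hχc : HasCompactSupport χ := by
    refine HasCompactSupport.intro (isCompact_closedBall (0 : E₃) 2) fun y hy => ?_
    by_contra h
    have h1 := (hc0 _ h).2
    rw [mem_closedBall_zero_iff, not_le] at hy
    simp only [sub_zero] at h1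
    nlinarith
  have hsmooth : ∀ {g : S2 → ℝ}, sphereTwo.Smooth g → ContDiff ℝ ∞ (χ * radialExt g) := by
    intro g hg
    rw [contDiff_iff_contDiffAt]
    intro y
    rcases eq_or_ne y 0 with rfl | hy
    · refine (contDiffAt_const (c := (0 : ℝ))).congr_of_eventuallyEq ?_
      filter_upwards [hχ0] with y hy
      simp [hy]
    · exact hχs.contDiffAt.mul ((contDiffOn_radialExt hg).contDiffAt
        (isOpen_compl_singleton.mem_nhds hy))
  -- The cross term of the product rule is absent: ∇χ is a multiple of y, and the extension has zero
  -- derivative along y.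
  have hlap : ∀ {g : S2 → ℝ}, sphereTwo.Smooth g → ∀ {y : E₃}, y ≠ 0 →
      Laplacian.laplacian (χ * radialExt g) y
        = χ y * Laplacian.laplacian (radialExt g) y
          + radialExt g y * Laplacian.laplacian χ y := by
    intro g hg y hy
    rw [laplacian_mul (EuclideanSpace.basisFun (Fin 3) ℝ) hχs.contDiffAt_two
      (contDiffAt_radialExt hg hy)]
    have h1 : fderiv ℝ χ y = deriv c (‖y - 0‖ ^ 2) • (2 : ℝ) • innerSL ℝ (y - 0) := by
      rw [hχ, fderiv_comp_apply' (c.contDiff.differentiable (n := ∞) (by simp) _)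
        (hasFDerivAt_norm_sub_sq 0 y).differentiableAt, (hasFDerivAt_norm_sub_sq 0 y).fderiv]
    have h2 : ∑ i, y i * fderiv ℝ (radialExt g) y (EuclideanSpace.single i 1) = 0 := by
      have h := congrArg (fderiv ℝ (radialExt g) y)
        ((EuclideanSpace.basisFun (Fin 3) ℝ).sum_repr y)
      rw [fderiv_radialExt_self hg hy] at h
      simpa using h
    have h3 : ∑ i, fderiv ℝ χ y (EuclideanSpace.basisFun (Fin 3) ℝ i)
        * fderiv ℝ (radialExt g) y (EuclideanSpace.basisFun (Fin 3) ℝ i)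
        = deriv c (‖y - 0‖ ^ 2) * 2 *
          ∑ i, y i * fderiv ℝ (radialExt g) y (EuclideanSpace.single i 1) := by
      rw [Finset.mul_sum]
      refine Finset.sum_congr rfl fun i _ => ?_
      rw [h1]
      simp [EuclideanSpace.inner_single_right]
      ring
    rw [h3, h2]
    ring
  have hgreen := integral_mul_laplacian (hsmooth hf) (hsmooth hφ) (hχc.mul_right)
  have hint : ∀ {g h : S2 → ℝ}, sphereTwo.Smooth g → sphereTwo.Smooth h →
      Integrable fun y => (χ * radialExt g) y * Laplacian.laplacian (χ * radialExt h) y := by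
    intro g h hg hh
    have h1 := continuousOn_univ.1 ((hsmooth hh).contDiffOn.continuousOn_laplacian isOpen_univ)
    exact ((hsmooth hg).continuous.mul h1).integrable_of_hasCompactSupport
      (hχc.mul_right.mul_right)
  have hint2 := hint hφ hf
  simp_rw [mul_comm ((χ * radialExt φ) _)] at hint2
  have hdiff := integral_sub (hint hf hφ) hint2
  rw [hgreen, sub_self] at hdiff
  have hpt : ∀ y : E₃, (χ * radialExt f) y * Laplacian.laplacian (χ * radialExt φ) y
      - Laplacian.laplacian (χ * radialExt f) y * (χ * radialExt φ) y
      = (fun r : ℝ => c (r ^ 2) ^ 2 * (r ^ 2)⁻¹) ‖y‖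
        * radialExt (fun x => f x * sphereTwo.lap φ x - sphereTwo.lap f x * φ x) y := fun y => by
    rcases eq_or_ne y 0 with rfl | hy
    · have : χ 0 = 0 := hχ0.self_of_nhds
      simp [this]
    · obtain ⟨w, hw⟩ := exists_coe_eq_inv_norm_smul hy
      rw [hlap hf hy, hlap hφ hy, laplacian_radialExt hf hy hw, laplacian_radialExt hφ hy hw]
      simp only [Pi.mul_apply, radialExt_of_eq _ hy hw]
      have : χ y = c (‖y‖ ^ 2) := by simp [χ]
      rw [this]
      ring
  rw [integral_congr_ae (Eventually.of_forall hpt), integral_norm_mul_radialExt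
    (fun r : ℝ => c (r ^ 2) ^ 2 * (r ^ 2)⁻¹)] at hdiff
  have hpos : 0 < ∫ r in Ioi (0 : ℝ), r ^ 2 * (c (r ^ 2) ^ 2 * (r ^ 2)⁻¹) := by
    have e : ∫ r in Ioi (0 : ℝ), r ^ 2 * (c (r ^ 2) ^ 2 * (r ^ 2)⁻¹)
        = ∫ r in Ioi (0 : ℝ), c (r ^ 2) ^ 2 := by
      refine setIntegral_congr_fun measurableSet_Ioi fun r (hr : 0 < r) => ?_
      field_simp
    have hcont : Continuous fun r : ℝ => c (r ^ 2) ^ 2 :=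
      (c.continuous.comp (continuous_pow 2)).pow 2
    have hcs : HasCompactSupport fun r : ℝ => c (r ^ 2) ^ 2 := by
      refine HasCompactSupport.intro (isCompact_closedBall (0 : ℝ) 2) fun r hr => ?_
      by_contra h
      have h1 := (hc0 _ (pow_ne_zero_iff two_ne_zero |>.1 h)).2
      rw [mem_closedBall_zero_iff, not_le, Real.norm_eq_abs] at hr
      rw [← sq_abs] at h1
      nlinarith
    rw [e, setIntegral_pos_iff_support_of_nonneg_ae (Eventually.of_forall fun r => sq_nonneg _)
      (hcont.integrable_of_hasCompactSupport hcs).integrableOn]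
    have ho : IsOpen (Function.support (fun r : ℝ => c (r ^ 2) ^ 2) ∩ Ioi 0) :=
      (hcont.isOpen_support).inter isOpen_Ioi
    refine ho.measure_pos volume ⟨1, ?_, zero_lt_one (α := ℝ)⟩
    have : c 1 = 1 := c.one_of_mem_closedBall (Metric.mem_closedBall_self c.rIn_pos.le)
    simp [this]
  have hk := (mul_eq_zero.1 hdiff).resolve_right hpos.ne'
  have hcf : Continuous f := by
    simpa only [radialExt_coe] using continuous_comp_coe_S2 (contDiffOn_radialExt hf).continuousOn
  have hcφ : Continuous φ := by
    simpa only [radialExt_coe] using continuous_comp_coe_S2 (contDiffOn_radialExt hφ).continuousOn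
  have hlf : ∀ {g : S2 → ℝ}, sphereTwo.Smooth g → Continuous (sphereTwo.lap g) := fun hg =>
    continuous_comp_coe_S2 ((contDiffOn_radialExt hg).continuousOn_laplacian
      isOpen_compl_singleton)
  rw [integral_sub] at hk
  · linarith
  · exact (hcf.mul (hlf hφ)).integrable_of_hasCompactSupport (HasCompactSupport.of_compactSpace _)
  · exact ((hlf hf).mul hcφ).integrable_of_hasCompactSupport (HasCompactSupport.of_compactSpace _)

theorem radialExt_sub (f g : S2 → ℝ) : radialExt (f - g) = radialExt f - radialExt g :=
  funext fun y => by
    by_cases hy : y = 0 <;> simp [radialExt, hy]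

theorem radialExt_mul (f g : S2 → ℝ) : radialExt (f * g) = radialExt f * radialExt g :=
  funext fun y => by
    by_cases hy : y = 0 <;> simp [radialExt, hy]

theorem continuous_tangentProj (v : E₃) : Continuous fun x : S2 => tangentProj x v :=
  continuous_const.sub (Continuous.fun_smul (continuous_subtype_val.inner continuous_const)
    continuous_subtype_val)

theorem sphereTwo_isRegular : sphereTwo.IsRegular where
  smooth_sub hf hg := ContMDiff.sub hf hg
  smooth_sq hf := ContMDiff.mul hf hf
  continuous {f} hf := by
    simpa only [radialExt_coe] using
      continuous_comp_coe_S2 (contDiffOn_radialExt hf).continuousOn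
  continuous_lap hf := continuous_comp_coe_S2
    ((contDiffOn_radialExt hf).continuousOn_laplacian isOpen_compl_singleton)
  continuous_gradSq hf := (continuous_comp_coe_S2 ((contDiffOn_radialExt
    hf).continuousOn_fderiv_of_isOpen isOpen_compl_singleton (by simp))).norm.pow 2
  continuous_hessSq hf := by
    have h := continuous_comp_coe_S2
      ((contDiffOn_radialExt hf).continuousOn_fderiv_fderiv isOpen_compl_singleton)
    have h2 := continuous_tangentProj
    simp only [sphereTwo]
    fun_prop
  lap_eq_zero h := laplacian_eq_zero (radialExt_eventuallyEq_zero h)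
  gradSq_eq_zero h := by simp [sphereTwo, fderiv_eq_zero (radialExt_eventuallyEq_zero h)]
  hessSq_eq_zero h := by simp [sphereTwo, fderiv_fderiv_eq_zero (radialExt_eventuallyEq_zero h)]
  gradSq_nonneg f x := sq_nonneg _
  hessSq_nonneg f x := by
    simp only [sphereTwo]
    positivity
  lap_sub {f g} hf hg := funext fun x => by
    have h := (contDiffAt_radialExt hf (coe_S2_ne_zero x)).laplacian_sub
      (contDiffAt_radialExt hg (coe_S2_ne_zero x))
    simp only [sphereTwo, Pi.sub_apply, radialExt_sub]
    exact h
  lap_sq_ge {f} hf x := by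
    have h := two_mul_laplacian_le_laplacian_sq (contDiffAt_radialExt hf (coe_S2_ne_zero x))
    rw [radialExt_coe, ← radialExt_mul] at h
    exact h
  lap_bound := ⟨3, by norm_num, fun hf x => sphereTwo_lap_sq_le hf x⟩
  green hf hφ _ := sphereTwo_green hf hφ
  ae_zero hΩ hw h := ae_zero_of_forall_isTest (𝓡 2) (fun _ hf => hf) hΩ hw h

end SphereGreen

/-! ### The function sin²(d/2) on the sphere as a radial variable. -/

section SphereRadial

local notation "E₃" => EuclideanSpace ℝ (Fin 3)

/-- The extension, constant along rays, of the height function `⟪p, x⟫` on the sphere. -/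
noncomputable def sphereHeight (p : S2) : E₃ → ℝ :=
  (fun y => innerSL ℝ (p : E₃) y) * ((fun t : ℝ => t ^ (-1 / 2 : ℝ)) ∘ fun y => ‖y - 0‖ ^ 2)

/-- The extension, constant along rays, of `sin² (d(p, x) / 2)`. -/
noncomputable def sphereRadial (p : S2) : E₃ → ℝ := (fun u => (1 - u) / 2) ∘ sphereHeight p

theorem sphereHeight_apply (p : S2) (y : E₃) :
    sphereHeight p y = inner ℝ (p : E₃) y * ‖y‖⁻¹ := by
  simp only [sphereHeight, Pi.mul_apply, Function.comp_apply, sub_zero]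
  rw [← Real.rpow_natCast ‖y‖, ← Real.rpow_mul (norm_nonneg y), ← Real.rpow_neg_one]
  norm_num

theorem sphereHeight_coe (p x : S2) : sphereHeight p x = inner ℝ (p : E₃) x := by
  rw [sphereHeight_apply, norm_coe_S2, inv_one, mul_one]

theorem sphereRadial_coe (p x : S2) : sphereRadial p x = (1 - inner ℝ (p : E₃) x) / 2 := by
  rw [sphereRadial, Function.comp_apply, sphereHeight_coe]

theorem sphereRadial_smul (p : S2) {c : ℝ} (hc : 0 < c) (y : E₃) :
    sphereRadial p (c • y) = sphereRadial p y := by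
  simp only [sphereRadial, Function.comp_apply, sphereHeight_apply, inner_smul_right, norm_smul,
    Real.norm_of_nonneg hc.le]
  field_simp

/-- The factor |y|⁻¹ is treated as (|y|²)^(-1/2), so that the chain rule needs only derivatives of a
power and of the squared norm. -/
theorem hasDerivAt_rpow_neg_half {t : ℝ} (ht : t ≠ 0) :
    HasDerivAt (fun t : ℝ => t ^ (-1 / 2 : ℝ)) (-1 / 2 * t ^ (-3 / 2 : ℝ)) t :=
  (Real.hasDerivAt_rpow_const (Or.inl ht)).congr_deriv (by norm_num)

theorem deriv_deriv_rpow_neg_half : deriv (deriv fun t : ℝ => t ^ (-1 / 2 : ℝ)) 1 = 3 / 4 := by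
  have h : deriv (fun t : ℝ => t ^ (-1 / 2 : ℝ)) =ᶠ[𝓝 1] fun t => -1 / 2 * t ^ (-3 / 2 : ℝ) := by
    filter_upwards [isOpen_ne.mem_nhds (one_ne_zero (α := ℝ))] with t ht using
      (hasDerivAt_rpow_neg_half ht).deriv
  rw [h.deriv_eq, ((Real.hasDerivAt_rpow_const (Or.inl one_ne_zero)).const_mul (-1 / 2)).deriv]
  norm_num

theorem contDiffOn_sphereHeight (p : S2) : ContDiffOn ℝ ∞ (sphereHeight p) {0}ᶜ := by
  intro y hy
  have hy' : ‖y - 0‖ ^ 2 ≠ 0 := by simpa using hy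
  have h1 : ContDiffAt ℝ ∞ (fun y : E₃ => ‖y - 0‖ ^ 2) y :=
    ((contDiff_id.sub contDiff_const).norm_sq ℝ).contDiffAt
  exact ((innerSL ℝ (p : E₃)).contDiff.contDiffAt.mul
    ((Real.contDiffAt_rpow_const_of_ne hy').comp y h1)).contDiffWithinAt

theorem contDiffOn_sphereRadial (p : S2) : ContDiffOn ℝ ∞ (sphereRadial p) {0}ᶜ :=
  ContDiff.comp_contDiffOn (g := fun u : ℝ => (1 - u) / 2)
    ((contDiff_const.sub contDiff_id).div_const 2) (contDiffOn_sphereHeight p)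

theorem fderiv_norm_rpow_neg_half (x : S2) :
    fderiv ℝ ((fun t : ℝ => t ^ (-1 / 2 : ℝ)) ∘ fun y : E₃ => ‖y - 0‖ ^ 2) x
      = -innerSL ℝ (x : E₃) := by
  have h1 : ‖(x : E₃) - 0‖ ^ 2 = 1 := by simp
  have h2 := (hasDerivAt_rpow_neg_half (t := ‖(x : E₃) - 0‖ ^ 2)
    (by rw [h1]; norm_num)).comp_hasFDerivAt (x : E₃) (hasFDerivAt_norm_sub_sq 0 (x : E₃))
  rw [h2.fderiv, h1, smul_smul, sub_zero]
  norm_num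

theorem fderiv_sphereHeight (p x : S2) :
    fderiv ℝ (sphereHeight p) x
      = innerSL ℝ (p : E₃) - inner ℝ (p : E₃) x • innerSL ℝ (x : E₃) := by
  have h1 : ‖(x : E₃) - 0‖ ^ 2 = 1 := by simp
  have h2 : DifferentiableAt ℝ ((fun t : ℝ => t ^ (-1 / 2 : ℝ)) ∘ fun y : E₃ => ‖y - 0‖ ^ 2) x :=
    DifferentiableAt.comp (f := fun y : E₃ => ‖y - 0‖ ^ 2) (x : E₃)
      (hasDerivAt_rpow_neg_half (by rw [h1]; norm_num)).differentiableAt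
      (hasFDerivAt_norm_sub_sq 0 (x : E₃)).differentiableAt
  have h3 := (innerSL ℝ (p : E₃)).hasFDerivAt.mul h2.hasFDerivAt
  refine h3.fderiv.trans ?_
  rw [fderiv_norm_rpow_neg_half, Function.comp_apply, h1, Real.one_rpow, innerSL_apply_apply]
  ext v
  simp
  ring

/-- Both factors, ⟨p, y⟩ and |y|⁻¹, are harmonic at x, so only the cross term 2⟨p, -x⟩ of the
product rule remains. -/
theorem laplacian_sphereHeight (p x : S2) :
    Laplacian.laplacian (sphereHeight p) (x : E₃) = -2 * inner ℝ (p : E₃) x := by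
  have h1 : ‖(x : E₃) - 0‖ ^ 2 = 1 := by simp
  have h1' : ‖(x : E₃) - 0‖ ^ 2 ≠ 0 := by rw [h1]; norm_num
  have c1 : ContDiffAt ℝ 2 (fun y : E₃ => ‖y - 0‖ ^ 2) x :=
    ((contDiff_id.sub contDiff_const).norm_sq ℝ).contDiffAt
  have c2 : ContDiffAt ℝ 2 (fun t : ℝ => t ^ (-1 / 2 : ℝ)) (‖(x : E₃) - 0‖ ^ 2) :=
    Real.contDiffAt_rpow_const_of_ne h1'
  have c3 : ContDiffAt ℝ 2 (fun y => innerSL ℝ (p : E₃) y) (x : E₃) :=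
    (innerSL ℝ (p : E₃)).contDiff.contDiffAt
  have hL : fderiv ℝ (fun y => innerSL ℝ (p : E₃) y) = fun _ => innerSL ℝ (p : E₃) :=
    funext fun y => (innerSL ℝ (p : E₃)).hasFDerivAt.fderiv
  have hL2 : Laplacian.laplacian (fun y => innerSL ℝ (p : E₃) y) (x : E₃) = 0 := by
    rw [laplacian_eq_sum_fderiv (EuclideanSpace.basisFun (Fin 3) ℝ), hL]
    simp
  have hm : Laplacian.laplacian
      ((fun t : ℝ => t ^ (-1 / 2 : ℝ)) ∘ fun y : E₃ => ‖y - 0‖ ^ 2) (x : E₃) = 0 := by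
    rw [laplacian_comp (f := fun y : E₃ => ‖y - 0‖ ^ 2) c2 c1, laplacian_norm_sub_sq,
      (hasFDerivAt_norm_sub_sq 0 (x : E₃)).fderiv,
      h1, deriv_deriv_rpow_neg_half, (hasDerivAt_rpow_neg_half one_ne_zero).deriv, norm_smul,
      innerSL_apply_norm, mul_pow, h1]
    norm_num
  have hs := (EuclideanSpace.basisFun (Fin 3) ℝ).sum_inner_mul_inner (p : E₃) (x : E₃)
  rw [sphereHeight, laplacian_mul (EuclideanSpace.basisFun (Fin 3) ℝ) c3
    (ContDiffAt.comp (f := fun y : E₃ => ‖y - 0‖ ^ 2) (x : E₃) c2 c1), hL2, hm,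
    hL, fderiv_norm_rpow_neg_half, ← hs]
  simp only [neg_apply, innerSL_apply_apply, mul_neg, Finset.sum_neg_distrib,
    real_inner_comm (x : E₃)]
  ring

theorem fderiv_sphereRadial (p x : S2) : fderiv ℝ (sphereRadial p) x
    = (-1 / 2 : ℝ) • (innerSL ℝ (p : E₃) - inner ℝ (p : E₃) x • innerSL ℝ (x : E₃)) := by
  have h1 : ∀ u : ℝ, HasDerivAt (fun u : ℝ => (1 - u) / 2) (-1 / 2) u := fun u =>
    ((hasDerivAt_id u).const_sub 1).div_const 2
  have h2 := ((contDiffOn_sphereHeight p).contDiffAt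
    (isOpen_compl_singleton.mem_nhds (coe_S2_ne_zero x))).differentiableAt (by simp)
  rw [sphereRadial, fderiv_comp_apply' (h1 _).differentiableAt h2, (h1 _).deriv,
    fderiv_sphereHeight]

theorem norm_fderiv_sphereRadial_sq (p x : S2) : ‖fderiv ℝ (sphereRadial p) x‖ ^ 2
    = sphereRadial p x * (1 - sphereRadial p x) := by
  have h : innerSL ℝ (p : E₃) - inner ℝ (p : E₃) x • innerSL ℝ (x : E₃)
      = innerSL ℝ ((p : E₃) - inner ℝ (p : E₃) x • (x : E₃)) := by simp
  rw [fderiv_sphereRadial, h, norm_smul, innerSL_apply_norm, mul_pow, norm_sub_sq_real, norm_smul,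
    inner_smul_right, mul_pow, norm_coe_S2, norm_coe_S2, sphereRadial_coe, Real.norm_eq_abs,
    Real.norm_eq_abs, sq_abs, sq_abs]
  ring

theorem laplacian_sphereRadial (p x : S2) :
    Laplacian.laplacian (sphereRadial p) (x : E₃) = 1 - 2 * sphereRadial p x := by
  have h1 : deriv (fun u : ℝ => (1 - u) / 2) = fun _ => -1 / 2 := funext fun u =>
    (((hasDerivAt_id u).const_sub 1).div_const 2).deriv
  have h2 := contDiffAt_infty.1 ((contDiffOn_sphereHeight p).contDiffAt
    (isOpen_compl_singleton.mem_nhds (coe_S2_ne_zero x))) 2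
  have h3 : ContDiffAt ℝ 2 (fun u : ℝ => (1 - u) / 2) (sphereHeight p x) :=
    (contDiffAt_const.sub contDiffAt_id).div_const 2
  rw [sphereRadial_coe, sphereRadial, laplacian_comp h3 h2, h1, laplacian_sphereHeight]
  simp
  ring

theorem sphereTwo_isRadial (p : S2) :
    sphereTwo.IsRadial (fun x => sphereRadial p x) (fun t => t * (1 - 1 * t))
      (fun t => 1 - 2 * 1 * t) := by
  have hq := contDiffOn_sphereRadial p
  have hcont := continuous_comp_coe_S2 hq.continuousOn
  have hqx : ∀ x : S2, ContDiffAt ℝ 2 (sphereRadial p) x := fun x =>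
    contDiffAt_infty.1 (hq.contDiffAt (isOpen_compl_singleton.mem_nhds (coe_S2_ne_zero x))) 2
  have hext : ∀ (F : ℝ → ℝ) (x : S2),
      radialExt (F ∘ fun x => sphereRadial p x) =ᶠ[𝓝 (x : E₃)] F ∘ sphereRadial p := fun F x => by
    filter_upwards [isOpen_ne.mem_nhds (coe_S2_ne_zero x)] with y hy
    obtain ⟨w, hw⟩ := exists_coe_eq_inv_norm_smul hy
    rw [radialExt_of_eq _ hy hw, Function.comp_apply, Function.comp_apply, hw,
      sphereRadial_smul p (inv_pos.2 (norm_pos_iff.2 hy))]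
  refine ⟨hcont, fun c => (isClosed_le hcont continuous_const).isCompact, fun hF =>
    sphereTwo_smooth_of_contDiffOn (hF.comp_contDiffOn hq) fun x => rfl, fun {F} hF x => ?_, ?_⟩
  · have h1 := laplacian_comp hF.contDiffAt_two (hqx x)
    simp only [sphereTwo]
    rw [laplacian_congr_of_eventuallyEq (hext F x), h1, norm_fderiv_sphereRadial_sq,
      laplacian_sphereRadial]
    ring
  · have h1 := continuous_comp_coe_S2
      (hq.continuousOn_fderiv_of_isOpen isOpen_compl_singleton (by simp))
    have h2 := continuous_comp_coe_S2 (hq.continuousOn_fderiv_fderiv isOpen_compl_singleton)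
    have h3 := continuous_tangentProj
    set Q := sphereRadial p
    let e : Fin 3 → E₃ := fun i => EuclideanSpace.single i 1
    refine ⟨fun x => ‖fderiv ℝ Q x‖ ^ 2 + ∑ i, ∑ j, 2 * ((fderiv ℝ Q x (tangentProj x (e i))
      * fderiv ℝ Q x (tangentProj x (e j))) ^ 2
      + (fderiv ℝ (fderiv ℝ Q) x (tangentProj x (e i)) (tangentProj x (e j))) ^ 2),
      by fun_prop, fun {F} hF x => ?_⟩
    simp only [sphereTwo]
    rw [fderiv_fderiv_eq_of_eventuallyEq (hext F x), (hext F x).fderiv_eq, add_mul]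
    refine add_le_add ?_ ?_
    · rw [fderiv_comp_apply' (hF.differentiable (by simp) _) ((hqx x).differentiableAt (by simp)),
        norm_smul, mul_pow, Real.norm_eq_abs, sq_abs, mul_comm]
      gcongr
      linarith [sq_nonneg (deriv (deriv F) (Q x))]
    · rw [Finset.sum_mul]
      simp_rw [Finset.sum_mul]
      exact Finset.sum_le_sum fun i _ => Finset.sum_le_sum fun j _ =>
        fderiv_fderiv_comp_apply_sq_le hF.contDiffAt_two (hqx x) _ _

end SphereRadial

/-! ### Archimedes' theorem for sin²(d/2), and the spherical result. -/

section SphereIntegral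

local notation "E₃" => EuclideanSpace ℝ (Fin 3)

theorem sphereRadial_eq_sin_sq (p x : S2) :
    sphereRadial p x = Real.sin (sphereDist p x / 2) ^ 2 := by
  have h : inner ℝ (p : E₃) x = Real.cos (2 * (sphereDist p x / 2)) := by
    rw [mul_div_cancel₀ _ two_ne_zero, sphereDist, InnerProductGeometry.cos_angle, norm_coe_S2,
      norm_coe_S2, mul_one, div_one]
  rw [sphereRadial_coe, h, Real.cos_two_mul, Real.cos_sq']
  ring

theorem sphereRadial_mem_Icc (p x : S2) : sphereRadial p x ∈ Icc (0 : ℝ) 1 := by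
  rw [sphereRadial_eq_sin_sq]
  exact ⟨sq_nonneg _, Real.sin_sq_le_one _⟩

theorem continuous_sphereRadial_coe (p : S2) : Continuous fun x : S2 => sphereRadial p x :=
  (sphereTwo_isRadial p).continuous

theorem integrable_comp_sphereRadial (p : S2) {f : ℝ → ℝ} (hf : Continuous f) :
    Integrable (fun x : S2 => f (sphereRadial p x)) sphereTwo.vol :=
  (hf.comp (continuous_sphereRadial_coe p)).integrable_of_hasCompactSupport
    (HasCompactSupport.of_compactSpace _)

theorem sphereTwo_vol_real_univ : sphereTwo.vol.real univ = 4 * Real.pi := by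
  change ((volume : Measure E₃).toSphere).real univ = _
  rw [Measure.toSphere_real_apply_univ, Measure.real, EuclideanSpace.volume_ball_fin_three]
  rw [ENNReal.toReal_mul, ENNReal.toReal_ofReal (by positivity)]
  simp
  ring

theorem integral_sphereTwo_lap {f : S2 → ℝ} (hf : sphereTwo.Smooth f) :
    ∫ x, sphereTwo.lap f x ∂sphereTwo.vol = 0 := by
  have h1 : sphereTwo.Smooth fun _ => (1 : ℝ) := contMDiff_const
  have h := sphereTwo_green h1 hf
  have h2 : ∀ x : S2, sphereTwo.lap (fun _ => (1 : ℝ)) x = 0 := fun x => by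
    have h3 := (sphereTwo_isRadial x).lap_comp (F := fun _ => 1) contDiff_const x
    simpa [Function.comp_def] using h3
  simpa [h2] using h

/-- Since Δ(q^(k+1)) = (k+1)²q^k - (k+1)(k+2)q^(k+1) has integral zero, each moment is (k+1)/(k+2)
times the preceding one. The recursion starts from the total area 4π. -/
theorem integral_sphereRadial_pow (p : S2) (k : ℕ) :
    ∫ x : S2, sphereRadial p x ^ k ∂sphereTwo.vol = 4 * Real.pi / (k + 1) := by
  induction k with
  | zero => simp [sphereTwo_vol_real_univ]
  | succ k ih =>
    have hF : ContDiff ℝ ∞ fun t : ℝ => t ^ (k + 1) := contDiff_id.pow _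
    have h := integral_sphereTwo_lap ((sphereTwo_isRadial p).smooth_comp hF)
    have hd : deriv (fun t : ℝ => t ^ (k + 1)) = fun t => ((k : ℝ) + 1) * t ^ k :=
      funext fun t => by simp
    have hdd : ∀ t : ℝ, t * deriv (fun t : ℝ => ((k : ℝ) + 1) * t ^ k) t
        = ((k : ℝ) + 1) * k * t ^ k := fun t => by
      rw [deriv_const_mul _ (by fun_prop)]
      cases k with
      | zero => simp
      | succ n => simp; ring
    have h2 : ∀ x : S2,
        sphereTwo.lap ((fun t : ℝ => t ^ (k + 1)) ∘ fun x : S2 => sphereRadial p x) x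
        = ((k : ℝ) + 1) ^ 2 * sphereRadial p x ^ k
          - ((k : ℝ) + 1) * (k + 2) * sphereRadial p x ^ (k + 1) := fun x => by
      rw [(sphereTwo_isRadial p).lap_comp hF, hd]
      linear_combination (1 - sphereRadial p x) * hdd (sphereRadial p x)
    simp_rw [h2] at h
    rw [integral_sub ((integrable_comp_sphereRadial p (continuous_pow k)).const_mul _)
      ((integrable_comp_sphereRadial p (continuous_pow (k + 1))).const_mul _),
      integral_const_mul, integral_const_mul, ih] at h
    have h3 : (k : ℝ) + 1 ≠ 0 := by positivity
    have h4 : (k : ℝ) + 2 ≠ 0 := by positivity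
    push_cast
    rw [eq_div_iff (by positivity)]
    field_simp at h
    linear_combination -(mul_eq_zero.1 h).resolve_left h3

theorem integral_polynomial_sphereRadial (p : S2) (P : Polynomial ℝ) :
    ∫ x : S2, P.eval (sphereRadial p x) ∂sphereTwo.vol
      = 4 * Real.pi * ∫ t in (0 : ℝ)..1, P.eval t := by
  induction P using Polynomial.induction_on' with
  | add P Q hP hQ =>
    simp only [Polynomial.eval_add]
    rw [integral_add (integrable_comp_sphereRadial p P.continuous)
      (integrable_comp_sphereRadial p Q.continuous), intervalIntegral.integral_add
      (P.continuous.intervalIntegrable _ _) (Q.continuous.intervalIntegrable _ _), hP, hQ, mul_add]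
  | monomial n a =>
    simp only [Polynomial.eval_monomial]
    rw [integral_const_mul, intervalIntegral.integral_const_mul, integral_sphereRadial_pow,
      integral_pow]
    simp
    ring

theorem integral_comp_sphereRadial (p : S2) {f : ℝ → ℝ} (hf : Continuous f) :
    ∫ x : S2, f (sphereRadial p x) ∂sphereTwo.vol = 4 * Real.pi * ∫ t in (0 : ℝ)..1, f t := by
  have hpi := Real.pi_pos
  refine eq_of_forall_dist_le fun ε hε => ?_
  -- Weierstrass approximation with tolerance ε/(8π): both sides carry total mass 4π, so each
  -- contributes an error of at most ε/2.
  obtain ⟨P, hP⟩ := exists_polynomial_near_of_continuousOn 0 1 f hf.continuousOn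
    (ε / (8 * Real.pi)) (by positivity)
  have h1 : |∫ x : S2, (P.eval (sphereRadial p x) - f (sphereRadial p x)) ∂sphereTwo.vol|
      ≤ ε / (8 * Real.pi) * (4 * Real.pi) := by
    rw [← sphereTwo_vol_real_univ, ← Real.norm_eq_abs]
    exact norm_integral_le_of_norm_le_const (Eventually.of_forall fun x =>
      (hP _ (sphereRadial_mem_Icc p x)).le)
  have h2 : |∫ t in (0 : ℝ)..1, (P.eval t - f t)| ≤ ε / (8 * Real.pi) * |1 - 0| := by
    rw [← Real.norm_eq_abs]
    refine intervalIntegral.norm_integral_le_of_norm_le_const fun t ht => ?_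
    rw [uIoc_of_le zero_le_one] at ht
    exact (hP t (Ioc_subset_Icc_self ht)).le
  rw [integral_sub (integrable_comp_sphereRadial p P.continuous)
    (integrable_comp_sphereRadial p hf), integral_polynomial_sphereRadial] at h1
  rw [intervalIntegral.integral_sub (P.continuous.intervalIntegrable _ _)
    (hf.intervalIntegrable _ _)] at h2
  set A := ∫ x : S2, f (sphereRadial p x) ∂sphereTwo.vol
  set B := ∫ t in (0 : ℝ)..1, f t
  set C := ∫ t in (0 : ℝ)..1, P.eval t
  rw [Real.dist_eq]
  have e1 : ε / (8 * Real.pi) * (4 * Real.pi) = ε / 2 := by field_simp; norm_num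
  have e2 : |4 * Real.pi * (C - B)| ≤ ε / 2 := by
    rw [abs_mul, abs_of_pos (by positivity), ← e1, mul_comm]
    gcongr
    simpa using h2
  rw [e1] at h1
  rw [abs_le] at *
  constructor <;> linarith [h1.1, h1.2, e2.1, e2.2]

/-- Finite measures are determined by their integrals of bounded continuous functions. Passing to
measures allows integration over caps, where the integrand is cut off discontinuously. -/
theorem map_sphereRadial (p : S2) : sphereTwo.vol.map (fun x : S2 => sphereRadial p x)
    = ENNReal.ofReal (4 * Real.pi) • (volume : Measure ℝ).restrict (Ioc 0 1) := by
  have hm := (continuous_sphereRadial_coe p).measurable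
  have : IsFiniteMeasure (ENNReal.ofReal (4 * Real.pi) • (volume : Measure ℝ).restrict (Ioc 0 1)) :=
    Measure.smul_finite _ ENNReal.ofReal_ne_top
  refine ext_of_forall_integral_eq_of_IsFiniteMeasure fun f => ?_
  rw [integral_map hm.aemeasurable f.continuous.aestronglyMeasurable,
    integral_comp_sphereRadial p f.continuous, integral_smul_measure,
    ENNReal.toReal_ofReal (by positivity), intervalIntegral.integral_of_le zero_le_one, smul_eq_mul]

theorem integral_sphereRadial (p : S2) {t₀ : ℝ} (ht₀ : 0 ≤ t₀) (ht₁ : t₀ ≤ 1) {g : ℝ → ℝ}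
    (hg : ContinuousOn g (Icc 0 t₀)) :
    ∫ x in {x : S2 | sphereRadial p x < t₀}, g (sphereRadial p x) ∂sphereTwo.vol
      = 4 * Real.pi * ∫ t in (0 : ℝ)..t₀, g t := by
  -- `g` is controlled only on [0, t₀]. Continuing it by its endpoint values gives a continuous
  -- function, measurable for the pushforward, with the same values on the cap.
  set g' : ℝ → ℝ := IccExtend ht₀ ((Icc 0 t₀).domRestrict g)
  have hg' : Continuous g' := (continuousOn_iff_continuous_domRestrict.1 hg).Icc_extend'
  have hgg : ∀ t ∈ Icc 0 t₀, g' t = g t := fun t ht => by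
    simp only [g', IccExtend_of_mem ht₀ _ ht, domRestrict_apply]
  have hcont := continuous_sphereRadial_coe p
  have e1 : ∫ x in {x : S2 | sphereRadial p x < t₀}, g (sphereRadial p x) ∂sphereTwo.vol
      = ∫ x in (fun x : S2 => sphereRadial p x) ⁻¹' Iio t₀, g' (sphereRadial p x)
        ∂sphereTwo.vol := by
    refine setIntegral_congr_fun (isOpen_lt hcont continuous_const).measurableSet
      fun x (hx : sphereRadial p x < t₀) => ?_
    exact (hgg _ ⟨(sphereRadial_mem_Icc p x).1, hx.le⟩).symm
  rw [e1, ← setIntegral_map measurableSet_Iio hg'.aestronglyMeasurable hcont.aemeasurable,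
    map_sphereRadial, Measure.restrict_smul, integral_smul_measure,
    ENNReal.toReal_ofReal (by positivity), smul_eq_mul, Measure.restrict_restrict measurableSet_Iio,
    intervalIntegral.integral_of_le ht₀]
  congr 1
  have hs : Iio t₀ ∩ Ioc 0 1 = Ioo 0 t₀ := by
    ext t
    simp only [mem_inter_iff, mem_Iio, mem_Ioc, mem_Ioo]
    constructor
    · exact fun h => ⟨h.2.1, h.1⟩
    · exact fun h => ⟨h.2, h.1, h.2.le.trans ht₁⟩
  rw [hs, ← integral_Ioc_eq_integral_Ioo]
  exact setIntegral_congr_fun measurableSet_Ioc fun t ht => hgg t (Ioc_subset_Icc_self ht)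

theorem sphereProfile_eq {R r : ℝ} (hR : 0 < Real.cos (R / 2)) (hr : 0 < Real.cos (r / 2)) :
    sphereProfile R r
      = logProfile (1 - 1 * Real.sin (R / 2) ^ 2) (1 - 1 * Real.sin (r / 2) ^ 2) := by
  have hc : ∀ x : ℝ, 1 - 1 * Real.sin x ^ 2 = Real.cos x ^ 2 := fun x => by
    rw [Real.cos_sq']
    ring
  have ht : ∀ x : ℝ, 0 < Real.cos x → 1 - 1 / Real.cos x ^ 2 = -Real.tan x ^ 2 := fun x hx => by
    have h := hx.ne'
    rw [Real.tan_eq_sin_div_cos, div_pow, Real.sin_sq]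
    field_simp
    ring
  rw [hc, hc, logProfile, sphereProfile, ht _ hR, ht _ hr, Real.log_pow, Real.log_pow,
    Real.log_div hr.ne' hR.ne', Real.cot_eq_cos_div_sin, div_pow,
    show 1 - Real.cos (R / 2) ^ 2 = Real.sin (R / 2) ^ 2 by rw [Real.sin_sq]]
  push_cast
  ring

theorem sphereTwo_deflection (p : S2) {R : ℝ} (hR : 0 < R) (hRπ : R < Real.pi) :
    (∃ u, IsDeflection sphereTwo {x | sphereDist p x < R} u) ∧
      ∀ u, IsDeflection sphereTwo {x | sphereDist p x < R} u →
        (∀ᵐ x ∂sphereTwo.vol.restrict {x | sphereDist p x < R},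
          u x = sphereProfile R (sphereDist p x)) ∧
        IntegrableOn u {x | sphereDist p x < R} sphereTwo.vol ∧
        ∫ x in {x | sphereDist p x < R}, u x ∂sphereTwo.vol =
          4 * Real.pi * (Real.sin (R / 2) ^ 2
            - 4 * Real.cot (R / 2) ^ 2 * Real.log (Real.cos (R / 2)) ^ 2) := by
  set t₀ := Real.sin (R / 2) ^ 2 with ht₀
  have hs : 0 < Real.sin (R / 2) := Real.sin_pos_of_pos_of_lt_pi (by linarith) (by linarith)
  have hcR : 0 < Real.cos (R / 2) := Real.cos_pos_of_mem_Ioo ⟨by linarith, by linarith⟩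
  have ht₀0 : 0 < t₀ := by positivity
  have hc : 1 - t₀ = Real.cos (R / 2) ^ 2 := by rw [Real.cos_sq']
  have hc0 : 0 < 1 - t₀ := by rw [hc]; positivity
  have hd0 : ∀ x : S2, 0 ≤ sphereDist p x := fun x => InnerProductGeometry.angle_nonneg _ _
  have hdπ : ∀ x : S2, sphereDist p x ≤ Real.pi := fun x => InnerProductGeometry.angle_le_pi _ _
  have hΩ : {x | sphereDist p x < R} = {x : S2 | sphereRadial p x < t₀} := by
    ext x
    have h0 := hd0 x
    have hπ := hdπ x
    rw [mem_ofPred_eq, mem_ofPred_eq, sphereRadial_eq_sin_sq, ht₀,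
      sq_lt_sq₀ (Real.sin_nonneg_of_nonneg_of_le_pi (by linarith) (by linarith)) hs.le,
      Real.strictMonoOn_sin.lt_iff_lt ⟨by linarith, by linarith⟩ ⟨by linarith, by linarith⟩]
    constructor <;> intro h <;> linarith
  have hmeas : MeasurableSet {x : S2 | sphereRadial p x < t₀} :=
    (isOpen_lt (continuous_sphereRadial_coe p) continuous_const).measurableSet
  have main := (sphereTwo_isRadial p).deflection_log (Or.inl rfl) sphereTwo_isRegular
    (fun x => (sphereRadial_mem_Icc p x).1) ht₀0 (by linarith)
  rw [← hΩ] at main hmeas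
  refine ⟨main.1, fun u hu => ?_⟩
  obtain ⟨h1, h2, h3⟩ := main.2 u hu
  refine ⟨?_, h2, h3.trans ?_⟩
  · filter_upwards [h1, ae_restrict_mem hmeas] with x hx (hxΩ : sphereDist p x < R)
    have h0 := hd0 x
    rw [hx, sphereRadial_eq_sin_sq, ht₀, ← sphereProfile_eq hcR
      (Real.cos_pos_of_mem_Ioo ⟨by linarith, by linarith⟩)]
  · have hpos : ∀ t ∈ Icc 0 t₀, 0 < 1 - 1 * t := fun t ht => by linarith [ht.2]
    rw [hΩ, integral_sphereRadial p ht₀0.le (by linarith)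
      (g := fun t => logProfile (1 - 1 * t₀) (1 - 1 * t))
      ((contDiffOn_logProfile _).continuousOn.comp (by fun_prop) hpos)]
    congr 1
    -- The substitution q = 1 - t reverses orientation; hence the sign, which is absent in the
    -- hyperbolic case q = 1 + t.
    have e : ∫ t in (0 : ℝ)..t₀, logProfile (1 - 1 * t₀) (1 - 1 * t)
        = -∫ q in (1 : ℝ)..(1 - t₀), logProfile (1 - t₀) q := by
      simp only [one_mul]
      rw [intervalIntegral.integral_comp_sub_left (fun q => logProfile (1 - t₀) q), sub_zero,
        intervalIntegral.integral_symm]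
    rw [e, integral_logProfile hc0 (by linarith), Real.cot_eq_cos_div_sin, div_pow, ← ht₀, ← hc,
      sub_sub_cancel, hc, Real.log_pow, ← hc]
    push_cast
    field_simp
    ring

end SphereIntegral

end ClampedPlate

theorem mainTheorem5 :
    (∀ (N : ℕ) (_ : 1 ≤ N) (p : EuclideanSpace ℝ (Fin N)) (R : ℝ) (_ : 0 < R),
      (∃ u, ClampedPlate.IsDeflection (ClampedPlate.euclidean N) (Metric.ball p R) u) ∧
      ∀ u, ClampedPlate.IsDeflection (ClampedPlate.euclidean N) (Metric.ball p R) u →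
        (∀ᵐ x ∂(ClampedPlate.euclidean N).vol.restrict (Metric.ball p R),
          u x = ClampedPlate.euclideanProfile N R (dist p x)) ∧
        IntegrableOn u (Metric.ball p R) (ClampedPlate.euclidean N).vol ∧
        ∫ x in Metric.ball p R, u x ∂(ClampedPlate.euclidean N).vol =
          (volume : Measure (EuclideanSpace ℝ (Fin N))).toSphere.real Set.univ *
            (R ^ (N + 4) / ((N : ℝ) ^ 2 * ((N : ℝ) + 2) ^ 2 * ((N : ℝ) + 4)))) ∧
    (∀ (p : ClampedPlate.S2) (R : ℝ) (_ : 0 < R) (_ : R < Real.pi),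
      (∃ u, ClampedPlate.IsDeflection ClampedPlate.sphereTwo
        {x | ClampedPlate.sphereDist p x < R} u) ∧
      ∀ u, ClampedPlate.IsDeflection ClampedPlate.sphereTwo
          {x | ClampedPlate.sphereDist p x < R} u →
        (∀ᵐ x ∂ClampedPlate.sphereTwo.vol.restrict {x | ClampedPlate.sphereDist p x < R},
          u x = ClampedPlate.sphereProfile R (ClampedPlate.sphereDist p x)) ∧
        IntegrableOn u {x | ClampedPlate.sphereDist p x < R} ClampedPlate.sphereTwo.vol ∧
        ∫ x in {x | ClampedPlate.sphereDist p x < R}, u x ∂ClampedPlate.sphereTwo.vol =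
          4 * Real.pi * (Real.sin (R / 2) ^ 2
            - 4 * Real.cot (R / 2) ^ 2 * Real.log (Real.cos (R / 2)) ^ 2)) ∧
    (∀ (p : UpperHalfPlane) (R : ℝ) (_ : 0 < R),
      (∃ u, ClampedPlate.IsDeflection ClampedPlate.hyperbolicPlane (Metric.ball p R) u) ∧
      ∀ u, ClampedPlate.IsDeflection ClampedPlate.hyperbolicPlane (Metric.ball p R) u →
        (∀ᵐ x ∂ClampedPlate.hyperbolicPlane.vol.restrict (Metric.ball p R),
          u x = ClampedPlate.hyperbolicProfile R (dist p x)) ∧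
        IntegrableOn u (Metric.ball p R) ClampedPlate.hyperbolicPlane.vol ∧
        ∫ x in Metric.ball p R, u x ∂ClampedPlate.hyperbolicPlane.vol =
          4 * Real.pi * (Real.sinh (R / 2) ^ 2
            - 4 * (Real.cosh (R / 2) / Real.sinh (R / 2)) ^ 2
              * Real.log (Real.cosh (R / 2)) ^ 2)) := by
  exact ⟨fun _ hN p _ hR => ClampedPlate.euclidean_deflection hN p hR,
    fun p _ hR hRπ => ClampedPlate.sphereTwo_deflection p hR hRπ,
    fun p _ hR => ClampedPlate.hyperbolicPlane_deflection p hR⟩
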